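/- A receiver selects one of $n\ge 1$ agents. The values $v_i\sim D_i$ of the agents are independent. An independent signaling scheme consists of a mapping rule, in which each agent $i$ with value $v_i$ independently sends a random (discretely distributed) signal $\sigma_i\in\Gamma_i$, and a selection rule, which for each joint signal $\sigma=(\sigma_i)_i$ of positive probability selects, possibly at random, an agent with the largest posterior mean $\mathbb{E}[v_i\mid\sigma_i]$. A signaling policy $\Omega$ is a probability distribution over independent signaling schemes. The expected utility of agent $i$ is $U_i(\Omega)=\mathbb{E}_{\omega\sim\Omega}\left[\sum_\sigma \Pr_\omega[\sigma]\cdot\Pr_\omega[i\text{ is selected}\mid\sigma]\cdot\mathbb{E}_\omega[v_i\mid\sigma_i]\right]$. A policy $\Omega$ is $1$-majorized if for every $k\in\{1,\dots,n\}$ and every signaling policy $\Omega'$ the sum of the $k$ smallest of the numbers $U_i(\Omega)$ is at least the sum of the $k$ smallest of the numbers $U_i(\Omega')$. Full Revelation is the mapping rule with $\sigma_i=v_i$. The ranking scheme of a permutation $\pi$ of the agents is the selection rule for Full Revelation that selects the first agent in the order $\pi$ among those with the largest value (for $0/1$ values: the first agent with value $1$, if there is one). **Theorem 1.** One can assign to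 every $n\ge1$ and every $\mu=(\mu_1,\dots,\mu_n)\in[0,1]^n$ a probability distribution $\eta_\mu$ over the permutations of the agents such that the following hold. (a) When $D_i=\mathrm{Bernoulli}(\mu_i)$ (value $1$ with probability $\mu_i$ and $0$ otherwise), independently for all $i$, Full Revelation paired with the selection rule that randomizes over ranking schemes according to $\eta_\mu$ is $1$-majorized among all signaling policies. (b) The selection rule is computable in polynomial time: there is an algorithm that, given rational $\mu_1,\dots,\mu_n\in[0,1]$ as fractions in binary, outputs an explicit list of permutations with rational weights whose induced distribution is exactly $\eta_\mu$, in time polynomial in the bit length of the input (on a random access machine with logarithmic cost). -/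

import Mathlib

open MeasureTheory
open scoped ENNReal NNReal

noncomputable section

namespace FairSelection

/-! ### The selection model -/

/-- A selection rule for joint signals in `∀ i, Γ i`: to each joint signal it assigns the
distribution of the selected agent. -/
abbrev SelectionRule (n : ℕ) (Γ : Fin n → Type) : Type := (∀ i, Γ i) → PMF (Fin n)

/-- A mapping rule: agent `i` with value `v` independently sends a random signal in `Γ i`. -/
abbrev MappingRule (n : ℕ) (Γ : Fin n → Type) : Type := ∀ i, ℝ≥0 → PMF (Γ i)

section Model

variable {n : ℕ} {Γ : Fin n → Type}

/-- The probability that the receiver observes the joint signal `σ` when the values `v i ∼ D i`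
are independent. -/
def signalProb (D : Fin n → PMF ℝ≥0) (g : MappingRule n Γ) (σ : ∀ i, Γ i) : ℝ≥0∞ :=
  ∏ i, ((D i).bind (g i)) (σ i)

/-- The posterior mean of the value of agent `i` given her signal `s`, by Bayes' rule. It is only
meaningful for signals of positive probability. -/
def posteriorMean (D : Fin n → PMF ℝ≥0) (g : MappingRule n Γ) (i : Fin n) (s : Γ i) : ℝ≥0∞ :=
  ∑' v : ℝ≥0, (v : ℝ≥0∞) * (D i v * g i v s / ((D i).bind (g i)) s)

end Model

/-- An independent signaling scheme for the value distributions `D`: a mapping rule, together with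
a selection rule that, at every joint signal of positive probability, only selects agents
with the largest posterior mean. -/
structure Scheme {n : ℕ} (D : Fin n → PMF ℝ≥0) where
  /-- the signals of each agent -/
  Γ : Fin n → Type
  /-- the mapping rule -/
  mapping : MappingRule n Γ
  /-- the selection rule -/
  select : SelectionRule n Γ
  /-- the receiver maximizes the expected value -/
  optimal : ∀ σ : ∀ i, Γ i, signalProb D mapping σ ≠ 0 →
    ∀ i, select σ i ≠ 0 → ∀ j,
      posteriorMean D mapping j (σ j) ≤ posteriorMean D mapping i (σ i)

/-- The expected utility of agent `i` in an independent signaling scheme. -/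
def Scheme.utility {n : ℕ} {D : Fin n → PMF ℝ≥0} (ω : Scheme D) (i : Fin n) : ℝ≥0∞ :=
  ∑' σ : ∀ j, ω.Γ j,
    signalProb D ω.mapping σ * ω.select σ i * posteriorMean D ω.mapping i (σ i)

/-- A signaling policy: a random independent signaling scheme, drawn with the help of an arbitrary
probability space. -/
structure Policy {n : ℕ} (D : Fin n → PMF ℝ≥0) where
  /-- the source of randomness -/
  Θ : Type
  [mΘ : MeasurableSpace Θ]
  /-- its law -/
  law : Measure Θ
  [isProb : IsProbabilityMeasure law]
  /-- the scheme that is drawn -/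
  scheme : Θ → Scheme D
  aemeasurable_utility : ∀ i, AEMeasurable (fun θ => (scheme θ).utility i) law

/-- The expected utility of agent `i` from a signaling policy. -/
def Policy.utility {n : ℕ} {D : Fin n → PMF ℝ≥0} (Ω : Policy D) (i : Fin n) : ℝ≥0∞ :=
  letI := Ω.mΘ
  ∫⁻ θ, (Ω.scheme θ).utility i ∂Ω.law

/-- The signaling policy that always uses the scheme `ω`. -/
def Scheme.toPolicy {n : ℕ} {D : Fin n → PMF ℝ≥0} (ω : Scheme D) : Policy D where
  Θ := Unit
  law := Measure.dirac ()
  scheme := fun _ => ω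
  aemeasurable_utility := fun _ => aemeasurable_const

/-- The sum of the `k` smallest entries of `u`. -/
def sumSmallest {n : ℕ} (k : ℕ) (u : Fin n → ℝ≥0∞) : ℝ≥0∞ :=
  (((Finset.univ.val.map u).sort (· ≤ ·)).take k).sum

/-- `Ω` is `α`-majorized among all signaling policies. -/
def IsMajorized {n : ℕ} {D : Fin n → PMF ℝ≥0} (α : ℝ≥0) (Ω : Policy D) : Prop :=
  ∀ k ∈ Finset.Icc 1 n, ∀ Ω' : Policy D,
    (α : ℝ≥0∞)⁻¹ * sumSmallest k Ω'.utility ≤ sumSmallest k Ω.utility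

/-! ### Full Revelation and ranking schemes -/

/-- The mapping rule in which every agent reveals her value. -/
def fullRevelationMapping (n : ℕ) : MappingRule n (fun _ => ℝ≥0) := fun _ v => PMF.pure v

theorem posteriorMean_fullRevelation {n : ℕ} (D : Fin n → PMF ℝ≥0) (i : Fin n) (x : ℝ≥0)
    (hx : D i x ≠ 0) : posteriorMean D (fullRevelationMapping n) i x = x := by
  have hb : (D i).bind (fullRevelationMapping n i) = D i := (D i).bind_pure
  unfold posteriorMean
  rw [hb, tsum_eq_single x]
  · simp only [fullRevelationMapping, PMF.pure_apply, if_true, mul_one]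
    rw [ENNReal.div_self hx (PMF.apply_ne_top _ _), mul_one]
  · intro v hv
    simp [fullRevelationMapping, PMF.pure_apply, hv.symm]

/-- Full Revelation, paired with a selection rule that only selects agents of the largest value. -/
def fullRevelation {n : ℕ} (D : Fin n → PMF ℝ≥0) (w : SelectionRule n (fun _ => ℝ≥0))
    (hw : ∀ v i, w v i ≠ 0 → ∀ j, v j ≤ v i) : Scheme D where
  Γ := fun _ => ℝ≥0
  mapping := fullRevelationMapping n
  select := w
  optimal := by
    intro σ hσ i hi j
    have h : ∀ l, D l (σ l) ≠ 0 := by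
      intro l
      have := (Finset.prod_ne_zero_iff.mp hσ) l (Finset.mem_univ l)
      rwa [show (D l).bind (fullRevelationMapping n l) = D l from (D l).bind_pure] at this
    rw [posteriorMean_fullRevelation D j _ (h j), posteriorMean_fullRevelation D i _ (h i)]
    exact_mod_cast hw σ i hi j

/-- The positions `k` in the ranking `π` (where `π k` is the agent at position `k`) whose agent has
the largest value. -/
def topPositions {n : ℕ} (π : Equiv.Perm (Fin n)) (v : Fin n → ℝ≥0) : Finset (Fin n) :=
  Finset.univ.filter fun k => ∀ j, v j ≤ v (π k)

theorem topPositions_nonempty {n : ℕ} [NeZero n] (π : Equiv.Perm (Fin n)) (v : Fin n → ℝ≥0) :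
    (topPositions π v).Nonempty := by
  obtain ⟨i, hi⟩ := Finite.exists_max v
  exact ⟨π.symm i, by simpa [topPositions] using hi⟩

/-- The ranking scheme of `π`: select the first agent in the ranking `π` that has the largest value.
If all values are `0` or `1` and some value is `1`, this is the first agent with value `1`. -/
def rankingSelect {n : ℕ} [NeZero n] (π : Equiv.Perm (Fin n)) (v : Fin n → ℝ≥0) : Fin n :=
  π ((topPositions π v).min' (topPositions_nonempty π v))

/-- The randomization over ranking schemes in which the ranking is drawn from `η`. -/
def rankingLottery {n : ℕ} [NeZero n] (η : PMF (Equiv.Perm (Fin n))) :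
    SelectionRule n (fun _ => ℝ≥0) :=
  fun v => η.map fun π => rankingSelect π v

theorem rankingLottery_optimal {n : ℕ} [NeZero n] (η : PMF (Equiv.Perm (Fin n)))
    (v : Fin n → ℝ≥0) (i : Fin n) (hi : rankingLottery η v i ≠ 0) (j : Fin n) : v j ≤ v i := by
  obtain ⟨π, -, rfl⟩ := (PMF.mem_support_map_iff _ _ _).mp hi
  have := (topPositions π v).min'_mem (topPositions_nonempty π v)
  exact (Finset.mem_filter.mp this).2 j

/-- Full Revelation, paired with the randomization `η` over ranking schemes. -/
def fullRevelationRanking {n : ℕ} [NeZero n] (D : Fin n → PMF ℝ≥0)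
    (η : PMF (Equiv.Perm (Fin n))) : Scheme D :=
  fullRevelation D (rankingLottery η) (rankingLottery_optimal η)

/-- The Bernoulli distribution: value `1` with probability `p`, value `0` otherwise. -/
def bernoulliLaw (p : unitInterval) : PMF ℝ≥0 :=
  (PMF.ofFintype (fun b : Bool => if b then ENNReal.ofReal p else ENNReal.ofReal (1 - p)) (by
    rw [Fintype.sum_bool]
    simp only [if_true, Bool.false_eq_true, if_false]
    rw [← ENNReal.ofReal_add p.2.1 (sub_nonneg.mpr p.2.2)]
    simp)).map fun b => if b then 1 else 0

end FairSelection

end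

/-! ### Random access machines with logarithmic cost

Programs are structured programs over finitely many named arrays of natural numbers. Every
operation is charged the bit lengths of the numbers involved. -/

namespace LogRam

/-- Expressions; `get a i` is the entry of the array `a` at index `i`. Subtraction is truncated and
division is rounded down. -/
inductive Expr where
  | const (k : ℕ)
  | get (a : ℕ) (i : Expr)
  | add (e₁ e₂ : Expr)
  | sub (e₁ e₂ : Expr)
  | mul (e₁ e₂ : Expr)
  | div (e₁ e₂ : Expr)

/-- Programs. -/
inductive Prog where
  /-- do nothing -/
  | skip
  /-- store the value of `e` in the array `a` at index `i` -/
  | store (a : ℕ) (i e : Expr)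
  /-- append the value of `e` to the output -/
  | write (e : Expr)
  | seq (c₁ c₂ : Prog)
  /-- run `c₁` if the value of `e` is nonzero, and `c₂` otherwise -/
  | ite (e : Expr) (c₁ c₂ : Prog)
  /-- repeat `c` as long as the value of `e` is nonzero -/
  | loop (e : Expr) (c : Prog)

/-- A state of the machine: the arrays, and the output written so far. -/
structure State where
  mem : ℕ → ℕ → ℕ
  out : List ℕ

/-- The value of an expression. -/
def Expr.eval (s : State) : Expr → ℕ
  | const k => k
  | get a i => s.mem a (i.eval s)
  | add e₁ e₂ => e₁.eval s + e₂.eval s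
  | sub e₁ e₂ => e₁.eval s - e₂.eval s
  | mul e₁ e₂ => e₁.eval s * e₂.eval s
  | div e₁ e₂ => e₁.eval s / e₂.eval s

/-- The cost of the evaluation of an expression: for every subexpression, one plus the bit length
of its value. -/
def Expr.cost (s : State) : Expr → ℕ
  | const k => 1 + Nat.size k
  | get a i => i.cost s + (1 + Nat.size (s.mem a (i.eval s)))
  | add e₁ e₂ => e₁.cost s + e₂.cost s + (1 + Nat.size (e₁.eval s + e₂.eval s))
  | sub e₁ e₂ => e₁.cost s + e₂.cost s + (1 + Nat.size (e₁.eval s - e₂.eval s))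
  | mul e₁ e₂ => e₁.cost s + e₂.cost s + (1 + Nat.size (e₁.eval s * e₂.eval s))
  | div e₁ e₂ => e₁.cost s + e₂.cost s + (1 + Nat.size (e₁.eval s / e₂.eval s))

/-- The state with the entry of the array `a` at index `i` set to `x`. -/
def State.set (s : State) (a i x : ℕ) : State where
  mem := fun b j => if b = a ∧ j = i then x else s.mem b j
  out := s.out

/-- The state with `x` appended to the output. -/
def State.emit (s : State) (x : ℕ) : State where
  mem := s.mem
  out := s.out ++ [x]

/-- `Runs c s s' t`: started in `s`, the program `c` halts in `s'`, at total cost `t`. -/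
inductive Runs : Prog → State → State → ℕ → Prop where
  | skip (s : State) : Runs .skip s s 1
  | store (s : State) (a : ℕ) (i e : Expr) :
      Runs (.store a i e) s (s.set a (i.eval s) (e.eval s)) (1 + i.cost s + e.cost s)
  | write (s : State) (e : Expr) :
      Runs (.write e) s (s.emit (e.eval s)) (1 + e.cost s)
  | seq {c₁ c₂ : Prog} {s s' s'' : State} {t₁ t₂ : ℕ} :
      Runs c₁ s s' t₁ → Runs c₂ s' s'' t₂ → Runs (.seq c₁ c₂) s s'' (t₁ + t₂)
  | ite_true {e : Expr} {c₁ c₂ : Prog} {s s' : State} {t : ℕ} :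
      e.eval s ≠ 0 → Runs c₁ s s' t → Runs (.ite e c₁ c₂) s s' (1 + e.cost s + t)
  | ite_false {e : Expr} {c₁ c₂ : Prog} {s s' : State} {t : ℕ} :
      e.eval s = 0 → Runs c₂ s s' t → Runs (.ite e c₁ c₂) s s' (1 + e.cost s + t)
  | loop_stop {e : Expr} {c : Prog} {s : State} :
      e.eval s = 0 → Runs (.loop e c) s s (1 + e.cost s)
  | loop_step {e : Expr} {c : Prog} {s s' s'' : State} {t₁ t₂ : ℕ} :
      e.eval s ≠ 0 → Runs c s s' t₁ → Runs (.loop e c) s' s'' t₂ →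
        Runs (.loop e c) s s'' (1 + e.cost s + t₁ + t₂)

/-- The initial state on an input: array `0` holds its entries, array `1` holds its length at
index `0`, every other entry is `0`, and the output is empty. -/
def initial (input : List ℕ) : State where
  mem := fun a i =>
    if a = 0 then input.getD i 0 else if a = 1 ∧ i = 0 then input.length else 0
  out := []

/-- The bit length of an input. -/
def inputSize (input : List ℕ) : ℕ := (input.map fun x => 1 + Nat.size x).sum

/-- A search problem with instances `α`, encoded by `enc`, and solution relation `R` is solvable
in polynomial time: some program finds, on every instance, some solution, at a cost that is bounded
by a polynomial in the bit length of the instance. -/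
def PolyTimeSolvable {α : Type} (enc : α → List ℕ) (R : α → List ℕ → Prop) : Prop :=
  ∃ (c : Prog) (p : Polynomial ℕ), ∀ x : α, ∃ (s : State) (t : ℕ),
    Runs c (initial (enc x)) s t ∧ t ≤ p.eval (inputSize (enc x)) ∧ R x s.out

end LogRam

/-! ### Computing a randomization over ranking schemes -/

noncomputable section

namespace FairSelection

/-- Rational success probabilities of a positive number of agents. -/
structure RationalInstance where
  n : ℕ
  [pos : NeZero n]
  prob : Fin n → ℚ
  nonneg : ∀ i, 0 ≤ prob i
  le_one : ∀ i, prob i ≤ 1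

attribute [instance] RationalInstance.pos

/-- The success probabilities as real numbers. -/
def RationalInstance.toReal (x : RationalInstance) (i : Fin x.n) : unitInterval :=
  ⟨(x.prob i : ℝ), by exact_mod_cast x.nonneg i, by exact_mod_cast x.le_one i⟩

/-- The list of numerators and denominators of the success probabilities. -/
def RationalInstance.encode (x : RationalInstance) : List ℕ :=
  (List.ofFn x.prob).flatMap fun q => [q.num.natAbs, q.den]

/-- A ranking with a weight `num / den`. -/
structure WeightedRanking (n : ℕ) where
  num : ℕ
  den : ℕ
  den_pos : 0 < den
  ranking : Equiv.Perm (Fin n)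

/-- The weight of a weighted ranking. -/
def WeightedRanking.weight {n : ℕ} (r : WeightedRanking n) : ℝ≥0∞ := (r.num : ℝ≥0∞) / r.den

/-- Numerator and denominator of the weight, then the agents in the order of the ranking. -/
def WeightedRanking.encode {n : ℕ} (r : WeightedRanking n) : List ℕ :=
  r.num :: r.den :: List.ofFn fun k => (r.ranking k : ℕ)

/-- `out` is an explicit list of rankings with rational weights that describes the distribution `η`:
the probability of a ranking `π` is the total weight of `π` in the list. -/
def Describes {n : ℕ} (out : List ℕ) (η : PMF (Equiv.Perm (Fin n))) : Prop :=
  ∃ l : List (WeightedRanking n), out = l.flatMap WeightedRanking.encode ∧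
    ∀ π, η π = ((l.filter fun r => r.ranking = π).map WeightedRanking.weight).sum

end FairSelection

end

/-! Upper bound. The utility of agent `i` is the probability that `i` is selected and has value `1`.
For a set `S` of agents, the events "the selected agent lies in `S` and has value `1`" and "all of
`S` has value `0`" are disjoint. So every policy satisfies `∑ i ∈ S, U i ≤ 1 - ∏ i ∈ S, (1 - μ i)`
for all `S` (`Scheme.sum_utility_le`, `Policy.feasible_utility`). It suffices to find a lottery over
rankings whose utility vector beats every vector that satisfies these constraints (`Majorizes`,
`isMajorized_of_majorizes`).

Criterion. Let `x` be nondecreasing along some order of the agents, and constant between consecutive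
prefixes whose constraints are tight. For each `k`, the constraints of the two tight prefixes around
`k`, averaged so that their sizes average to `k`, bound the `k` smallest entries of any competitor
by those of `x` (`majorizes_of_tight`).

Construction. Sort the agents by increasing `μ` and cut this order into consecutive blocks; earlier
blocks always precede later ones, so every prefix of blocks is tight. Inside a block the order is
random, such that all its agents have the same utility. Starting from singletons, two adjacent
blocks are pooled whenever the first has the larger average utility. Because the agents are sorted,
the second block would have the larger average if it went first (`average_le_of_sorted`), so some
mixture of the two orders equalizes the averages (`merge_parameters`). Once no violation is left,
the criterion applies (`PavaInv.tight`).

Small support. Combining the lotteries of two pooled blocks independently would multiply their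
supports. Instead one seed in `[0, 1]` drives a block: it decides which part goes first, and it is
passed on to each part through a piecewise linear map whose speed is proportional to the factor by
which the utilities of that part are discounted (`childSeed`). This keeps the utilities inside each
part equal (`EqualizesBlock.merge`), and a merge adds only one breakpoint. All blocks can share the
same seed, since only expectations matter. At most `n - 1` breakpoints arise, hence at most `n`
rankings are output.

Complexity. Programs are verified in a weakest-precondition calculus whose budget is a polynomial in
a bound `b` on the bit length of the memory and a bound `H` on the repetitions of each loop (`WP`).
Each merge multiplies the denominators of the breakpoints by at most `2 ^ (4 * B + 1)`, where `2 ^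
B` bounds the product of the input denominators, so `b` stays polynomial. Rational inputs receive
the lottery that the program prints; the others are handled by compactness
(`exists_majorizing_of_rat`). -/

namespace FairSelection

/-! ### Sums over joint signals, and two-point laws. -/

theorem tsum_pi_prod {n : ℕ} {Γ : Fin n → Type} (a : ∀ i, Γ i → ℝ≥0∞) :
    ∑' σ : ∀ i, Γ i, ∏ i, a i (σ i) = ∏ i, ∑' s, a i s := by
  induction n with
  | zero => simp
  | succ n ih =>
    rw [← (Fin.consEquiv Γ).tsum_eq, ENNReal.tsum_prod', Fin.prod_univ_succ, ← ih,
      ← ENNReal.tsum_mul_right]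
    refine tsum_congr fun x => ?_
    rw [← ENNReal.tsum_mul_left]
    refine tsum_congr fun σ => ?_
    simp [Fin.prod_univ_succ, Fin.consEquiv]

theorem bernoulliLaw_apply (p : unitInterval) (s : ℝ≥0) :
    bernoulliLaw p s =
      if s = 1 then ENNReal.ofReal p else if s = 0 then ENNReal.ofReal (1 - p) else 0 := by
  rw [bernoulliLaw, PMF.map_apply, tsum_fintype, Fintype.sum_bool]
  by_cases h1 : s = 1
  · subst h1; simp [PMF.ofFintype_apply]
  · by_cases h0 : s = 0
    · subst h0; simp [PMF.ofFintype_apply]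
    · simp [h1, h0]

theorem tsum_bernoulliLaw_mul (p : unitInterval) (φ : ℝ≥0 → ℝ≥0∞) :
    ∑' s, bernoulliLaw p s * φ s =
      ENNReal.ofReal p * φ 1 + ENNReal.ofReal (1 - p) * φ 0 := by
  rw [tsum_eq_sum (s := ({1, 0} : Finset ℝ≥0))]
  · rw [Finset.sum_pair one_ne_zero]
    simp [bernoulliLaw_apply]
  · intro s hs
    simp only [Finset.mem_insert, Finset.mem_singleton, not_or] at hs
    simp [bernoulliLaw_apply, hs.1, hs.2]

theorem ofReal_add_ofReal_one_sub (p : unitInterval) :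
    ENNReal.ofReal p + ENNReal.ofReal (1 - p) = 1 := by
  rw [← ENNReal.ofReal_add p.2.1 (sub_nonneg.mpr p.2.2)]
  simp

/-! ### The polymatroid upper bound on utilities. -/

section Upper

variable {n : ℕ}

theorem bind_bernoulliLaw_apply {Γ : Type} (p : unitInterval) (g : ℝ≥0 → PMF Γ) (s : Γ) :
    ((bernoulliLaw p).bind g) s =
      ENNReal.ofReal p * g 1 s + ENNReal.ofReal (1 - p) * g 0 s := by
  rw [PMF.bind_apply, tsum_bernoulliLaw_mul p fun v => g v s]

theorem posteriorMean_bernoulliLaw {Γ : Fin n → Type} (μ : Fin n → unitInterval)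
    (g : MappingRule n Γ) (i : Fin n) (s : Γ i) :
    posteriorMean (fun i => bernoulliLaw (μ i)) g i s =
      ENNReal.ofReal (μ i) * g i 1 s / ((bernoulliLaw (μ i)).bind (g i)) s := by
  unfold posteriorMean
  have h := tsum_bernoulliLaw_mul (μ i)
    fun v => (v : ℝ≥0∞) * (g i v s / ((bernoulliLaw (μ i)).bind (g i)) s)
  simp only [ENNReal.coe_one, one_mul, ENNReal.coe_zero, zero_mul, mul_zero, add_zero] at h
  rw [mul_div_assoc, ← h]
  refine tsum_congr fun v => ?_
  rw [mul_div_assoc, mul_left_comm]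

/-- A convex combination: the selected agents in `S` carry mass `s ≤ 1`, on which `h` applies, and
the remaining mass `1 - s` is covered by `X ≤ P`. -/
theorem sum_select_le {ι : Type*} (S : Finset ι) (w m : ι → ℝ≥0∞) (P X : ℝ≥0∞)
    (hw : ∑ i ∈ S, w i ≤ 1) (hX : X ≤ P) (h : ∀ i ∈ S, P * m i + X ≤ P) :
    ∑ i ∈ S, P * w i * m i + X ≤ P := by
  set s := ∑ i ∈ S, w i with hs
  have h1 : ∑ i ∈ S, P * w i * m i + s * X ≤ s * P := by
    rw [hs, Finset.sum_mul, Finset.sum_mul, ← Finset.sum_add_distrib]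
    refine Finset.sum_le_sum fun i hi => ?_
    calc P * w i * m i + w i * X = w i * (P * m i + X) := by ring
      _ ≤ w i * P := by gcongr; exact h i hi
  have h2 : s + (1 - s) = 1 := add_tsub_cancel_of_le hw
  calc ∑ i ∈ S, P * w i * m i + X
      = (∑ i ∈ S, P * w i * m i + s * X) + (1 - s) * X := by
        rw [add_assoc, ← add_mul, h2, one_mul]
    _ ≤ s * P + (1 - s) * P := by gcongr
    _ = P := by rw [← add_mul, h2, one_mul]

/-- Proved signal by signal. Whichever agent of `S` is selected, the probability that she has value
`1` and the probability that all of `S` has value `0` add up to at most the probability of the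
signal. The optimality of the selection plays no role. -/
theorem Scheme.sum_utility_le (μ : Fin n → unitInterval)
    (ω : Scheme fun i => bernoulliLaw (μ i)) (S : Finset (Fin n)) :
    ∑ i ∈ S, ω.utility i + ∏ i ∈ S, ENNReal.ofReal (1 - μ i) ≤ 1 := by
  classical
  set p : ∀ i, ω.Γ i → ℝ≥0∞ := fun i => ((bernoulliLaw (μ i)).bind (ω.mapping i)) with hp
  set b : ∀ i, ω.Γ i → ℝ≥0∞ := fun i s => ENNReal.ofReal (1 - μ i) * ω.mapping i 0 s with hb
  -- `∏ i, x i (σ i)` is the probability that `σ` is sent while all agents in `S` have value `0`.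
  set x : ∀ i, ω.Γ i → ℝ≥0∞ := fun i => if i ∈ S then b i else p i with hx
  have hpsum : ∀ i, ∑' s, p i s = 1 := fun i => PMF.tsum_coe _
  have hbp : ∀ i s, b i s ≤ p i s := fun i s => by
    simp only [hp, hb, bind_bernoulliLaw_apply]; exact le_add_self
  have hxp : ∀ i s, x i s ≤ p i s := fun i s => by
    simp only [hx]; split_ifs
    · exact hbp i s
    · exact le_rfl
  have hX : ∑' σ : ∀ i, ω.Γ i, ∏ i, x i (σ i) = ∏ i ∈ S, ENNReal.ofReal (1 - μ i) := by
    rw [tsum_pi_prod, ← Finset.prod_subset (Finset.subset_univ S)]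
    · refine Finset.prod_congr rfl fun i hi => ?_
      simp only [hx, if_pos hi, hb]
      rw [ENNReal.tsum_mul_left, PMF.tsum_coe, mul_one]
    · intro i _ hi
      simp only [hx, if_neg hi, hpsum]
  have hP : ∑' σ : ∀ i, ω.Γ i, ∏ i, p i (σ i) = 1 := by
    rw [tsum_pi_prod]; simp [hpsum]
  simp only [Scheme.utility]
  rw [← Summable.tsum_finsetSum fun _ _ => ENNReal.summable, ← hX,
    ← ENNReal.tsum_add, ← hP]
  refine ENNReal.tsum_le_tsum fun σ => ?_
  refine sum_select_le S (fun i => ω.select σ i) _ _ _ ?_ ?_ ?_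
  · calc ∑ i ∈ S, ω.select σ i ≤ ∑ i, ω.select σ i :=
          Finset.sum_le_sum_of_subset (Finset.subset_univ S)
      _ = 1 := by rw [← tsum_fintype (L := .unconditional _), PMF.tsum_coe]
  · exact Finset.prod_le_prod' fun i _ => hxp i _
  · intro i hi
    rw [posteriorMean_bernoulliLaw]
    change (∏ j, p j (σ j)) * (_ / p i (σ i)) + _ ≤ ∏ j, p j (σ j)
    rw [← Finset.mul_prod_erase _ _ (Finset.mem_univ i),
      ← Finset.mul_prod_erase _ (fun j => x j (σ j)) (Finset.mem_univ i)]
    have h1 : ∏ j ∈ Finset.univ.erase i, x j (σ j) ≤ ∏ j ∈ Finset.univ.erase i, p j (σ j) :=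
      Finset.prod_le_prod' fun j _ => hxp j _
    set Q := ∏ j ∈ Finset.univ.erase i, p j (σ j)
    have hxi : x i (σ i) = ENNReal.ofReal (1 - μ i) * ω.mapping i 0 (σ i) := by
      simp only [hx, if_pos hi, hb]
    -- Value `0` is kept only for the selected agent `i`; for the others it is relaxed to the
    -- probability of the signal. The two values of `i` then add up to `p i (σ i)`.
    calc p i (σ i) * Q * (ENNReal.ofReal (μ i) * ω.mapping i 1 (σ i) / p i (σ i)) +
          x i (σ i) * ∏ j ∈ Finset.univ.erase i, x j (σ j)
        ≤ p i (σ i) * (ENNReal.ofReal (μ i) * ω.mapping i 1 (σ i) / p i (σ i)) * Q +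
          x i (σ i) * Q := by
          rw [mul_right_comm]; gcongr
      _ ≤ ENNReal.ofReal (μ i) * ω.mapping i 1 (σ i) * Q + x i (σ i) * Q := by
          exact add_le_add_left (mul_le_mul_left ENNReal.mul_div_le _) _
      _ = p i (σ i) * Q := by
          rw [hxi, ← add_mul]
          simp only [hp, bind_bernoulliLaw_apply]

theorem Policy.sum_utility_le (μ : Fin n → unitInterval)
    (Ω : Policy fun i => bernoulliLaw (μ i)) (S : Finset (Fin n)) :
    ∑ i ∈ S, Ω.utility i + ∏ i ∈ S, ENNReal.ofReal (1 - μ i) ≤ 1 := by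
  let := Ω.mΘ
  have := Ω.isProb
  simp only [Policy.utility]
  rw [← lintegral_finsetSum' S fun i _ => Ω.aemeasurable_utility i]
  have h1 : ∏ i ∈ S, ENNReal.ofReal (1 - μ i) =
      ∫⁻ _, ∏ i ∈ S, ENNReal.ofReal (1 - μ i) ∂Ω.law := by simp
  rw [h1, ← lintegral_add_right _ measurable_const]
  calc _ ≤ ∫⁻ _, 1 ∂Ω.law := lintegral_mono fun θ => (Ω.scheme θ).sum_utility_le μ S
    _ = 1 := by simp

end Upper

/-! ### Utilities of ranking schemes. -/

/-- The utility of agent `i` when the first agent of value `1` in the ranking `π` is selected. -/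
def rankUtil {n : ℕ} (μ : Fin n → ℝ) (π : Equiv.Perm (Fin n)) (i : Fin n) : ℝ :=
  μ i * ∏ j with π.symm j < π.symm i, (1 - μ j)

/-- The expectation of `rankUtil` for weights `η` on the rankings. -/
def expUtil {n : ℕ} (μ : Fin n → ℝ) (η : Equiv.Perm (Fin n) → ℝ) (i : Fin n) : ℝ :=
  ∑ π, η π * rankUtil μ π i

theorem rankUtil_nonneg {n : ℕ} (μ : Fin n → unitInterval) (π : Equiv.Perm (Fin n)) (i : Fin n) :
    0 ≤ rankUtil (fun i => (μ i : ℝ)) π i :=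
  mul_nonneg (μ i).2.1 (Finset.prod_nonneg fun j _ => sub_nonneg.mpr (μ j).2.2)

theorem rankingSelect_eq_of_first {n : ℕ} [NeZero n] (π : Equiv.Perm (Fin n)) (v : Fin n → ℝ≥0)
    (i : Fin n) (hi : ∀ j, v j ≤ v i) (h : ∀ j, π.symm j < π.symm i → v j < v i) :
    rankingSelect π v = i := by
  unfold rankingSelect
  rw [← Equiv.eq_symm_apply]
  apply le_antisymm
  · apply Finset.min'_le
    simpa [topPositions] using hi
  · apply Finset.le_min'
    intro k hk
    by_contra hlt
    have h1 := h (π k) (by simpa using hlt)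
    have h2 := (Finset.mem_filter.mp hk).2 i
    exact absurd h1 (not_lt.mpr h2)

/-- Restrict the sum to the profiles in which `i` has value `1` and everybody ranked before her has
value `0`. An inequality suffices, since ranking schemes only need a lower bound. -/
theorem ofReal_rankUtil_le {n : ℕ} [NeZero n] (μ : Fin n → unitInterval)
    (π : Equiv.Perm (Fin n)) (i : Fin n) :
    ENNReal.ofReal (rankUtil (fun i => (μ i : ℝ)) π i) ≤
      ∑' σ : Fin n → ℝ≥0, (∏ j, bernoulliLaw (μ j) (σ j)) *
        (if rankingSelect π σ = i then 1 else 0) * (σ i : ℝ≥0∞) := by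
  -- The indicator of that event factorizes over the agents, so its probability is a product of
  -- one-dimensional sums.
  set φ : Fin n → ℝ≥0 → ℝ≥0∞ := fun j s =>
    if j = i then (if s = 1 then 1 else 0)
    else if π.symm j < π.symm i then (if s = 0 then 1 else 0) else 1 with hφ
  have key : ∑' σ : Fin n → ℝ≥0, ∏ j, (bernoulliLaw (μ j) (σ j) * φ j (σ j)) =
      ENNReal.ofReal (rankUtil (fun i => (μ i : ℝ)) π i) := by
    rw [tsum_pi_prod (fun j s => bernoulliLaw (μ j) s * φ j s)]
    simp only [tsum_bernoulliLaw_mul]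
    rw [rankUtil, ENNReal.ofReal_mul (μ i).2.1, ENNReal.ofReal_prod_of_nonneg
      (fun j _ => sub_nonneg.mpr (μ j).2.2), Finset.prod_filter,
      ← Finset.mul_prod_erase _ _ (Finset.mem_univ i),
      ← Finset.mul_prod_erase _ (fun j => if π.symm j < π.symm i then ENNReal.ofReal (1 - μ j) else 1)
        (Finset.mem_univ i)]
    congr 1
    · simp [hφ]
    · rw [if_neg (lt_irrefl _), one_mul]
      refine Finset.prod_congr rfl fun j hj => ?_
      have hji := Finset.ne_of_mem_erase hj
      simp only [hφ, if_neg hji]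
      by_cases hlt : π.symm j < π.symm i
      · simp [hlt]
      · rw [if_neg hlt, if_neg hlt, if_neg hlt, mul_one, mul_one, ofReal_add_ofReal_one_sub]
  rw [← key]
  refine ENNReal.tsum_le_tsum fun σ => ?_
  rw [Finset.prod_mul_distrib, mul_assoc]
  by_cases hP : ∏ j, bernoulliLaw (μ j) (σ j) = 0
  · simp [hP]
  refine mul_le_mul_right ?_ _
  by_cases hF : ∏ j, φ j (σ j) = 0
  · rw [hF]; exact zero_le
  have hσ : ∀ j, σ j = 1 ∨ σ j = 0 := fun j => by
    have := (Finset.prod_ne_zero_iff.mp hP) j (Finset.mem_univ j)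
    rw [bernoulliLaw_apply] at this
    by_contra! hc
    simp [hc.1, hc.2] at this
  have hf := fun j => (Finset.prod_ne_zero_iff.mp hF) j (Finset.mem_univ j)
  have hi : σ i = 1 := by
    have := hf i
    simp only [hφ, if_true] at this
    by_contra hc
    simp [hc] at this
  have hb : ∀ j, π.symm j < π.symm i → σ j = 0 := fun j hj => by
    have := hf j
    have hne : j ≠ i := by rintro rfl; exact lt_irrefl _ hj
    simp only [hφ, if_neg hne, if_pos hj] at this
    by_contra hc
    simp [hc] at this
  have hsel : rankingSelect π σ = i := by
    apply rankingSelect_eq_of_first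
    · intro j; rcases hσ j with h | h <;> simp [h, hi]
    · intro j hj; simp [hb j hj, hi]
  rw [if_pos hsel, hi]
  simp only [ENNReal.coe_one, one_mul]
  refine Finset.prod_le_one' fun j _ => ?_
  simp only [hφ]
  split_ifs <;> simp

theorem Scheme.toPolicy_utility {n : ℕ} {D : Fin n → PMF ℝ≥0} (ω : Scheme D) (i : Fin n) :
    ω.toPolicy.utility i = ω.utility i := by
  change ∫⁻ _ : Unit, ω.utility i ∂(Measure.dirac ()) = _
  simp

theorem ofReal_expUtil_le {n : ℕ} [NeZero n] (μ : Fin n → unitInterval)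
    (η : PMF (Equiv.Perm (Fin n))) (i : Fin n) :
    ENNReal.ofReal (expUtil (fun i => (μ i : ℝ)) (fun π => (η π).toReal) i) ≤
      (fullRevelationRanking (fun i => bernoulliLaw (μ i)) η).toPolicy.utility i := by
  have h1 : (fullRevelationRanking (fun i => bernoulliLaw (μ i)) η).toPolicy.utility i =
      ∑' σ : Fin n → ℝ≥0, (∏ j, bernoulliLaw (μ j) (σ j)) *
        (∑ π, η π * if rankingSelect π σ = i then 1 else 0) * (σ i : ℝ≥0∞) := by
    rw [Scheme.toPolicy_utility]
    refine tsum_congr fun σ => ?_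
    change signalProb (fun i => bernoulliLaw (μ i)) (fullRevelationMapping n) σ *
      rankingLottery η σ i *
      posteriorMean (fun i => bernoulliLaw (μ i)) (fullRevelationMapping n) i (σ i) = _
    have h2 : signalProb (fun i => bernoulliLaw (μ i)) (fullRevelationMapping n) σ =
        ∏ j, bernoulliLaw (μ j) (σ j) := by
      refine Finset.prod_congr rfl fun j _ => ?_
      rw [show (bernoulliLaw (μ j)).bind (fullRevelationMapping n j) = bernoulliLaw (μ j) from
        PMF.bind_pure _]
    have h3 : rankingLottery η σ i = ∑ π, η π * if rankingSelect π σ = i then 1 else 0 := by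
      change (η.map fun π => rankingSelect π σ) i = _
      rw [PMF.map_apply, tsum_fintype]
      refine Finset.sum_congr rfl fun π _ => ?_
      rw [mul_ite, mul_one, mul_zero]
      by_cases h : i = rankingSelect π σ
      · rw [if_pos h, if_pos h.symm]
      · rw [if_neg h, if_neg (Ne.symm h)]
    rw [h2, h3]
    -- The posterior mean is meaningful only at profiles of positive probability; elsewhere the
    -- first factor removes the term.
    by_cases h0 : ∏ j, bernoulliLaw (μ j) (σ j) = 0
    · rw [h0]; simp
    · rw [posteriorMean_fullRevelation (fun i => bernoulliLaw (μ i)) i _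
        ((Finset.prod_ne_zero_iff.mp h0) i (Finset.mem_univ i))]
  rw [h1, expUtil, ENNReal.ofReal_sum_of_nonneg
    fun π _ => mul_nonneg ENNReal.toReal_nonneg (rankUtil_nonneg μ π i)]
  calc _ ≤ ∑ π, η π * ∑' σ : Fin n → ℝ≥0, (∏ j, bernoulliLaw (μ j) (σ j)) *
        (if rankingSelect π σ = i then 1 else 0) * (σ i : ℝ≥0∞) := by
        refine Finset.sum_le_sum fun π _ => ?_
        rw [ENNReal.ofReal_mul ENNReal.toReal_nonneg, ENNReal.ofReal_toReal (η.apply_ne_top π)]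
        exact mul_le_mul_right (ofReal_rankUtil_le μ π i) _
    _ = _ := by
        simp only [← ENNReal.tsum_mul_left]
        rw [← Summable.tsum_finsetSum fun _ _ => ENNReal.summable]
        refine tsum_congr fun σ => ?_
        rw [Finset.mul_sum, Finset.sum_mul]
        exact Finset.sum_congr rfl fun π _ => by ring

end FairSelection

/-! ### Reduction to majorization over the polymatroid. -/

namespace FairSelection

/-- Replaces the sorted list by a set of agents with smallest utilities; the set comes from the
first `k` places of a sorting permutation. -/
theorem sumSmallest_eq {n : ℕ} (k : ℕ) (hk : k ≤ n) (u : Fin n → ℝ≥0∞) :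
    ∃ T : Finset (Fin n), T.card = k ∧ sumSmallest k u = ∑ i ∈ T, u i ∧
      ∀ i ∈ T, ∀ j ∉ T, u i ≤ u j := by
  set e := Tuple.sort u with he
  have hmono : Monotone (u ∘ e) := Tuple.monotone_sort u
  have hsort : (Finset.univ.val.map u).sort (· ≤ ·) = List.ofFn (u ∘ e) := by
    refine List.Perm.eq_of_pairwise' (r := (· ≤ ·)) (Multiset.pairwise_sort _ _)
      hmono.sortedLE_ofFn.pairwise ?_
    rw [← Multiset.coe_eq_coe, Multiset.sort_eq, List.ofFn_eq_map, ← Multiset.map_coe]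
    change Finset.univ.val.map u = Multiset.map (u ∘ e) Finset.univ.val
    rw [← Multiset.map_map, Multiset.map_univ_val_equiv]
  refine ⟨Finset.univ.filter fun i => (e.symm i : ℕ) < k, ?_, ?_, ?_⟩
  · rw [← Finset.card_map e.symm.toEmbedding]
    have : (Finset.univ.filter fun i => (e.symm i : ℕ) < k).map e.symm.toEmbedding =
        Finset.univ.filter fun i : Fin n => (i : ℕ) < k := by
      ext i; simp [Finset.mem_map_equiv]
    rw [this, Fin.card_filter_val_lt, min_eq_right hk]
  · rw [sumSmallest, hsort, List.sum_take_ofFn]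
    refine Finset.sum_equiv e (fun i => by simp) fun i _ => rfl
  · intro i hi j hj
    simp only [Finset.mem_filter, Finset.mem_univ, true_and, not_lt] at hi hj
    have := hmono (show e.symm i ≤ e.symm j from (Fin.lt_def.mpr (hi.trans_le hj)).le)
    simpa using this

/-- The utility vectors that satisfy the polymatroid constraints of the success probabilities. -/
def Feasible {n : ℕ} (μ y : Fin n → ℝ) : Prop :=
  ∀ S : Finset (Fin n), ∑ i ∈ S, y i ≤ 1 - ∏ i ∈ S, (1 - μ i)

/-- For every `k`, the sums of `k` entries of `x` are at least the sum of the `k` smallest entries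
of any feasible vector. -/
def Majorizes {n : ℕ} (μ x : Fin n → ℝ) : Prop :=
  ∀ y, Feasible μ y → ∀ T T' : Finset (Fin n), T.card = T'.card →
    (∀ i ∈ T', ∀ j ∉ T', y i ≤ y j) → ∑ i ∈ T', y i ≤ ∑ i ∈ T, x i

theorem Policy.utility_ne_top {n : ℕ} (μ : Fin n → unitInterval)
    (Ω : Policy fun i => bernoulliLaw (μ i)) (i : Fin n) : Ω.utility i ≠ ⊤ := by
  have h := Ω.sum_utility_le μ {i}
  rw [Finset.sum_singleton] at h
  exact ((le_self_add.trans h).trans_lt ENNReal.one_lt_top).ne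

theorem Policy.feasible_utility {n : ℕ} (μ : Fin n → unitInterval)
    (Ω : Policy fun i => bernoulliLaw (μ i)) :
    Feasible (fun i => (μ i : ℝ)) fun i => (Ω.utility i).toReal := by
  intro S
  have h := Ω.sum_utility_le μ S
  rw [← ENNReal.ofReal_prod_of_nonneg (fun i _ => sub_nonneg.mpr (μ i).2.2)] at h
  have h2 := ENNReal.toReal_mono ENNReal.one_ne_top h
  rw [ENNReal.toReal_add (ENNReal.sum_ne_top.mpr fun i _ => Ω.utility_ne_top μ i)
    ENNReal.ofReal_ne_top, ENNReal.toReal_sum fun i _ => Ω.utility_ne_top μ i,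
    ENNReal.toReal_ofReal (Finset.prod_nonneg fun i _ => sub_nonneg.mpr (μ i).2.2),
    ENNReal.toReal_one] at h2
  linarith

/-- Competitors enter only through feasibility, and Full Revelation only through the lower bound
`ofReal_expUtil_le`. -/
theorem isMajorized_of_majorizes {n : ℕ} [NeZero n] (μ : Fin n → unitInterval)
    (η : PMF (Equiv.Perm (Fin n)))
    (h : Majorizes (fun i => (μ i : ℝ))
      (expUtil (fun i => (μ i : ℝ)) fun π => (η π).toReal)) :
    IsMajorized 1 (fullRevelationRanking (fun i => bernoulliLaw (μ i)) η).toPolicy := by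
  intro k hk Ω'
  rw [ENNReal.coe_one, inv_one, one_mul]
  have hkn := (Finset.mem_Icc.mp hk).2
  obtain ⟨T', hT', hs', hlow⟩ := sumSmallest_eq k hkn Ω'.utility
  obtain ⟨T, hT, hs, -⟩ := sumSmallest_eq k hkn
    (fullRevelationRanking (fun i => bernoulliLaw (μ i)) η).toPolicy.utility
  have h1 := h _ (Ω'.feasible_utility μ) T T' (hT.trans hT'.symm) fun i hi j hj =>
    ENNReal.toReal_mono (Ω'.utility_ne_top μ j) (hlow i hi j hj)
  rw [hs, hs']
  calc ∑ i ∈ T', Ω'.utility i = ENNReal.ofReal (∑ i ∈ T', (Ω'.utility i).toReal) := by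
        rw [ENNReal.ofReal_sum_of_nonneg fun _ _ => ENNReal.toReal_nonneg]
        exact Finset.sum_congr rfl fun i _ => (ENNReal.ofReal_toReal (Ω'.utility_ne_top μ i)).symm
    _ ≤ ENNReal.ofReal (∑ i ∈ T, expUtil (fun i => (μ i : ℝ)) (fun π => (η π).toReal) i) :=
        ENNReal.ofReal_le_ofReal h1
    _ = ∑ i ∈ T, ENNReal.ofReal (expUtil (fun i => (μ i : ℝ)) (fun π => (η π).toReal) i) :=
        ENNReal.ofReal_sum_of_nonneg fun i _ => Finset.sum_nonneg fun π _ =>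
          mul_nonneg ENNReal.toReal_nonneg (rankUtil_nonneg μ π i)
    _ ≤ _ := Finset.sum_le_sum fun i _ => ofReal_expUtil_le μ η i

/-! ### From rational to real success probabilities. -/

section Extension

variable {n : ℕ}

/-- Larger success probabilities relax every constraint. This is why real numbers are approximated
from above: a competitor stays feasible along the approximation. -/
theorem Feasible.mono {μ ν y : Fin n → ℝ} (h : Feasible μ y) (hμν : ∀ i, μ i ≤ ν i)
    (hν : ∀ i, ν i ≤ 1) : Feasible ν y := fun S =>
  (h S).trans <| sub_le_sub_left (Finset.prod_le_prod (fun i _ => sub_nonneg.mpr (hν i))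
    fun i _ => sub_le_sub_left (hμν i) 1) 1

theorem exists_rat_seq (x : unitInterval) :
    ∃ q : ℕ → ℚ, (∀ j, (x : ℝ) ≤ q j ∧ (q j : ℝ) ≤ 1) ∧
      Filter.Tendsto (fun j => (q j : ℝ)) Filter.atTop (nhds x) := by
  have h : ∀ j : ℕ, ∃ q : ℚ, (x : ℝ) ≤ q ∧ (q : ℝ) ≤ 1 ∧ (q : ℝ) ≤ x + 1 / ((j : ℝ) + 1) := by
    intro j
    have hj : (0 : ℝ) < 1 / ((j : ℝ) + 1) := by positivity
    rcases x.2.2.lt_or_eq with hx | hx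
    · obtain ⟨q, h1, h2⟩ := exists_rat_btwn (lt_min hx (lt_add_of_pos_right (x : ℝ) hj))
      exact ⟨q, h1.le, (h2.trans_le (min_le_left _ _)).le, (h2.trans_le (min_le_right _ _)).le⟩
    · exact ⟨1, by simp [hx], by simp, by simp only [hx, Rat.cast_one]; linarith⟩
  choose q h1 h2 h3 using h
  refine ⟨q, fun j => ⟨h1 j, h2 j⟩, ?_⟩
  refine tendsto_of_tendsto_of_tendsto_of_le_of_le tendsto_const_nhds ?_ h1 h3
  simpa using (tendsto_const_nhds (x := (x : ℝ))).add tendsto_one_div_add_atTop_nhds_zero_nat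

theorem continuous_expUtil (i : Fin n) :
    Continuous fun p : (Fin n → ℝ) × (Equiv.Perm (Fin n) → ℝ) => expUtil p.1 p.2 i := by
  unfold expUtil rankUtil
  fun_prop

/-- The lotteries live in a compact simplex and the utilities are jointly continuous in the success
probabilities and the lottery. A limit point of lotteries for rational approximations therefore
inherits the inequalities. -/
theorem exists_majorizing_of_rat
    (h : ∀ q : Fin n → ℚ, (∀ i, 0 ≤ q i ∧ q i ≤ 1) → ∃ η : PMF (Equiv.Perm (Fin n)),
      Majorizes (fun i => (q i : ℝ)) (expUtil (fun i => (q i : ℝ)) fun π => (η π).toReal))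
    (μ : Fin n → unitInterval) : ∃ η : PMF (Equiv.Perm (Fin n)),
      Majorizes (fun i => (μ i : ℝ)) (expUtil (fun i => (μ i : ℝ)) fun π => (η π).toReal) := by
  choose q hq hlim using fun i => exists_rat_seq (μ i)
  have hq0 : ∀ j i, 0 ≤ q i j ∧ q i j ≤ 1 := fun j i =>
    ⟨by exact_mod_cast (μ i).2.1.trans (hq i j).1, by exact_mod_cast (hq i j).2⟩
  choose η hη using fun j => h (fun i => q i j) (hq0 j)
  have hmem : ∀ j, (fun π => (η j π).toReal) ∈ stdSimplex ℝ (Equiv.Perm (Fin n)) := by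
    refine fun j => ⟨fun π => ENNReal.toReal_nonneg, ?_⟩
    rw [← ENNReal.toReal_sum fun π _ => (η j).apply_ne_top π, ← tsum_fintype (L := .unconditional _),
      PMF.tsum_coe, ENNReal.toReal_one]
  obtain ⟨w, hw, φ, hφ, hconv⟩ := (isCompact_stdSimplex ℝ (Equiv.Perm (Fin n))).tendsto_subseq hmem
  let η' : PMF (Equiv.Perm (Fin n)) := PMF.ofFintype (fun π => ENNReal.ofReal (w π)) (by
    rw [← ENNReal.ofReal_sum_of_nonneg fun π _ => hw.1 π, hw.2, ENNReal.ofReal_one])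
  have hη' : (fun π => (η' π).toReal) = w := by
    funext π
    exact ENNReal.toReal_ofReal (hw.1 π)
  refine ⟨η', ?_⟩
  rw [hη']
  intro y hy T T' hT hlow
  have hμ : Filter.Tendsto (fun j => (fun i => (q i (φ j) : ℝ))) Filter.atTop
      (nhds fun i => (μ i : ℝ)) :=
    tendsto_pi_nhds.mpr fun i => (hlim i).comp hφ.tendsto_atTop
  have hsum : Filter.Tendsto (fun j => ∑ i ∈ T, expUtil (fun i => (q i (φ j) : ℝ))
      (fun π => (η (φ j) π).toReal) i) Filter.atTop
      (nhds (∑ i ∈ T, expUtil (fun i => (μ i : ℝ)) w i)) :=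
    tendsto_finsetSum _ fun i _ =>
      ((continuous_expUtil i).tendsto _).comp (hμ.prodMk_nhds hconv)
  refine ge_of_tendsto' hsum fun j => ?_
  -- The competitor `y` is fixed; it is feasible for every approximation since these lie above `μ`.
  exact hη (φ j) y (hy.mono (fun i => (hq i _).1) fun i => (hq i _).2) T T' hT hlow

end Extension

/-! ### A tightness criterion for majorization. -/

section Tight

theorem sum_indicator_sub_mul {ι : Type*} [Fintype ι] [DecidableEq ι] (y w : ι → ℝ)
    (T : Finset ι) (c : ℝ) : ∑ i, ((if i ∈ T then 1 else 0) - w i) * (y i - c) =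
      ∑ i ∈ T, y i - ∑ i, w i * y i - c * (T.card - ∑ i, w i) := by
  simp only [sub_mul, mul_sub, Finset.sum_sub_distrib, ite_mul, one_mul, zero_mul,
    Finset.sum_ite_mem, Finset.univ_inter, Finset.sum_const, nsmul_eq_mul]
  rw [← Finset.sum_mul]
  ring

/-- Fractional selection of total mass `T.card` cannot beat taking the smallest entries: compare
each entry with the largest one in `T`. -/
theorem sum_lowest_le {ι : Type*} [Fintype ι] [DecidableEq ι] (y w : ι → ℝ) (T : Finset ι)
    (hT : ∀ i ∈ T, ∀ j ∉ T, y i ≤ y j) (hw0 : ∀ i, 0 ≤ w i) (hw1 : ∀ i, w i ≤ 1)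
    (hw : ∑ i, w i = T.card) : ∑ i ∈ T, y i ≤ ∑ i, w i * y i := by
  rcases T.eq_empty_or_nonempty with rfl | hne
  · simp only [Finset.card_empty, Nat.cast_zero] at hw
    rw [Finset.sum_eq_zero_iff_of_nonneg fun i _ => hw0 i] at hw
    simp [hw]
  obtain ⟨m, hm, hmax⟩ := Finset.exists_max_image T y hne
  have h1 : ∑ i, ((if i ∈ T then 1 else 0) - w i) * (y i - y m) ≤ 0 := by
    refine Finset.sum_nonpos fun i _ => ?_
    split_ifs with hi
    · exact mul_nonpos_of_nonneg_of_nonpos (by linarith [hw1 i]) (by linarith [hmax i hi])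
    · exact mul_nonpos_of_nonpos_of_nonneg (by linarith [hw0 i]) (by linarith [hT m hm i hi])
  rw [sum_indicator_sub_mul, hw] at h1
  linarith

/-- The converse comparison: a fractional selection that takes everything below a threshold and
nothing above it is optimal, so no set of the same size has a smaller sum. -/
theorem le_sum_of_threshold {ι : Type*} [Fintype ι] [DecidableEq ι] (x w : ι → ℝ) (T : Finset ι)
    (c : ℝ) (hlt : ∀ i, x i < c → w i = 1) (hgt : ∀ i, c < x i → w i = 0)
    (hw : ∑ i, w i = T.card) : ∑ i, w i * x i ≤ ∑ i ∈ T, x i := by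
  have h1 : 0 ≤ ∑ i, ((if i ∈ T then 1 else 0) - w i) * (x i - c) := by
    refine Finset.sum_nonneg fun i _ => ?_
    rcases lt_trichotomy (x i) c with h | h | h
    · rw [hlt i h]
      refine mul_nonneg_of_nonpos_of_nonpos ?_ (by linarith)
      split_ifs <;> norm_num
    · simp [h]
    · rw [hgt i h]
      refine mul_nonneg ?_ (by linarith)
      split_ifs <;> norm_num
  rw [sum_indicator_sub_mul, hw] at h1
  linarith

/-- Linear programming duality with an explicit certificate. A prefix of length `i + 1` lies between
two tight prefixes with `X` constant in between; the fractional selection `w` that mixes these two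
prefixes has mass `i + 1`, is bounded by the two constraints for `y`, and is a threshold selection
for `x`. -/
theorem majorizes_of_tight {n : ℕ} (μ x : Fin n → ℝ) (a : Equiv.Perm (Fin n)) (X : ℕ → ℝ)
    (hx : ∀ i, x (a i) = X i) (hmono : ∀ i, i + 1 < n → X i ≤ X (i + 1))
    (htight : ∀ i, i < n → (i + 1 < n ∧ X i = X (i + 1)) ∨
      ∑ j with ((j : Fin n) : ℕ) < i + 1, X j = 1 - ∏ j with ((j : Fin n) : ℕ) < i + 1, (1 - μ (a j))) :
    Majorizes μ x := by
  intro y hy T T' hT hlow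
  obtain ⟨k, hk⟩ : ∃ k, T'.card = k := ⟨_, rfl⟩
  rcases k with _ | i
  · rw [hk] at hT
    simp [Finset.card_eq_zero.mp hT, Finset.card_eq_zero.mp hk]
  have hin : i < n := by
    have := T'.card_le_univ
    simp only [Fintype.card_fin] at this
    omega
  set F : ℕ → ℝ := fun k => 1 - ∏ j with ((j : Fin n) : ℕ) < k, (1 - μ (a j)) with hF
  set SX : ℕ → ℝ := fun k => ∑ j with ((j : Fin n) : ℕ) < k, X j with hSX
  -- The nearest tight prefix to the right, reached through equal entries; the last prefix cannot
  -- take the first alternative of `htight`, so the search ends.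
  have hup : ∀ d i, n - i = d → i < n → ∃ h, i ≤ h ∧ h < n ∧ SX (h + 1) = F (h + 1) ∧
      ∀ j, i ≤ j → j ≤ h → X j = X i := by
    intro d
    induction d with
    | zero => intro i hd hi; omega
    | succ d ih =>
      intro i hd hi
      rcases htight i hi with ⟨h1, h2⟩ | h1
      · obtain ⟨h, hih, hhn, hh, hc⟩ := ih (i + 1) (by omega) h1
        refine ⟨h, by omega, hhn, hh, fun j hj1 hj2 => ?_⟩
        rcases hj1.eq_or_lt with rfl | hj
        · rfl
        · rw [hc j hj hj2, h2]
      · exact ⟨i, le_rfl, hi, h1, fun j h1 h2 => by rw [le_antisymm h2 h1]⟩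
  -- The nearest tight prefix to the left; the empty prefix is tight.
  have hdown : ∀ i, i < n → ∃ l, l ≤ i ∧ SX l = F l ∧ ∀ j, l ≤ j → j ≤ i → X j = X i := by
    intro i
    induction i with
    | zero => exact fun _ => ⟨0, le_rfl, by simp [hSX, hF], fun j _ h2 => by
        rw [Nat.le_zero.mp h2]⟩
    | succ i ih =>
      intro hi
      rcases htight i (by omega) with ⟨h1, h2⟩ | h1
      · obtain ⟨l, hli, hl, hc⟩ := ih (by omega)
        refine ⟨l, by omega, hl, fun j hj1 hj2 => ?_⟩
        rcases hj2.eq_or_lt with rfl | hj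
        · rfl
        · rw [hc j hj1 (by omega), h2]
      · exact ⟨i + 1, le_rfl, h1, fun j h1 h2 => by rw [le_antisymm h2 h1]⟩
  obtain ⟨h, hih, hhn, hhF, hhc⟩ := hup _ i rfl hin
  obtain ⟨l, hli, hlF, hlc⟩ := hdown i hin
  have hmono' : ∀ j k, j ≤ k → k < n → X j ≤ X k := by
    intro j k hjk
    induction k, hjk using Nat.le_induction with
    | base => exact fun _ => le_rfl
    | succ k _ ih => exact fun hk => (ih (by omega)).trans (hmono k hk)
  -- The weight of the longer prefix, chosen such that the mixed length `(1 - θ) * l + θ * (h + 1)`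
  -- is `i + 1`.
  set θ : ℝ := ((i + 1 : ℕ) - l : ℝ) / ((h + 1 : ℕ) - l : ℝ) with hθ
  have hden : (0 : ℝ) < ((h + 1 : ℕ) - l : ℝ) := by
    rw [sub_pos]; exact_mod_cast (by omega : l < h + 1)
  have hθ0 : 0 ≤ θ := div_nonneg (by rw [sub_nonneg]; exact_mod_cast (by omega : l ≤ i + 1)) hden.le
  have hθ1 : θ ≤ 1 := by
    rw [hθ, div_le_one hden]
    have : ((i + 1 : ℕ) : ℝ) ≤ (h + 1 : ℕ) := by exact_mod_cast (by omega : i + 1 ≤ h + 1)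
    linarith
  have hθm : (l : ℝ) + θ * ((h + 1 : ℕ) - l) = (i + 1 : ℕ) := by
    rw [hθ, div_mul_cancel₀ _ hden.ne']; ring
  set w : Fin n → ℝ := fun v => (1 - θ) * (if (a.symm v : ℕ) < l then 1 else 0) +
    θ * (if (a.symm v : ℕ) < h + 1 then 1 else 0) with hw
  have hwsum : ∀ z : Fin n → ℝ, ∑ v, w v * z v =
      (1 - θ) * ∑ j with ((j : Fin n) : ℕ) < l, z (a j) +
        θ * ∑ j with ((j : Fin n) : ℕ) < h + 1, z (a j) := by
    intro z
    rw [Finset.sum_filter, Finset.sum_filter, Finset.mul_sum, Finset.mul_sum,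
      ← Finset.sum_add_distrib, ← Equiv.sum_comp a]
    refine Finset.sum_congr rfl fun j _ => ?_
    simp only [hw, Equiv.symm_apply_apply]
    split_ifs <;> ring
  have hwcard : ∑ v, w v = (i + 1 : ℕ) := by
    have h1 := hwsum fun _ => 1
    simp only [mul_one, Finset.sum_const, Fin.card_filter_val_lt, nsmul_eq_mul] at h1
    rw [h1, min_eq_right (by omega : l ≤ n), min_eq_right (by omega : h + 1 ≤ n), ← hθm]
    ring
  have himg : ∀ (z : Fin n → ℝ) k, ∑ j with ((j : Fin n) : ℕ) < k, z (a j) =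
      ∑ v ∈ (Finset.univ.filter fun j : Fin n => (j : ℕ) < k).map a.toEmbedding, z v := by
    intro z k; rw [Finset.sum_map]; rfl
  have hyF : ∀ k, ∑ j with ((j : Fin n) : ℕ) < k, y (a j) ≤ F k := by
    intro k
    rw [himg]
    refine (hy _).trans_eq ?_
    rw [Finset.prod_map]; rfl
  have hxF : ∀ k, ∑ j with ((j : Fin n) : ℕ) < k, x (a j) = SX k := fun k =>
    Finset.sum_congr rfl fun j _ => hx j
  calc ∑ v ∈ T', y v ≤ ∑ v, w v * y v := by
        refine sum_lowest_le y w T' hlow (fun v => ?_) (fun v => ?_) (by rw [hwcard, hk])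
        · have : 0 ≤ 1 - θ := sub_nonneg.mpr hθ1
          simp only [hw]; positivity
        · simp only [hw]; split_ifs <;> linarith
    _ ≤ ∑ v, w v * x v := by
        rw [hwsum, hwsum, hxF, hxF, hlF, hhF]
        have h1 := mul_le_mul_of_nonneg_left (hyF l) (sub_nonneg.mpr hθ1)
        have h2 := mul_le_mul_of_nonneg_left (hyF (h + 1)) hθ0
        linarith
    _ ≤ ∑ v ∈ T, x v := by
        refine le_sum_of_threshold x w T (X i) (fun v hv => ?_) (fun v hv => ?_)
          (by rw [hwcard, hT, hk])
        · have hv' : X (a.symm v) < X i := by rwa [← hx, Equiv.apply_symm_apply]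
          have h1 : (a.symm v : ℕ) < l := by
            by_contra hc
            rcases le_total (a.symm v : ℕ) i with h2 | h2
            · exact absurd (hlc _ (not_lt.mp hc) h2) hv'.ne
            · exact absurd (hmono' _ _ h2 (a.symm v).2) (not_le.mpr hv')
          have h2 : (a.symm v : ℕ) < h + 1 := by omega
          simp only [hw, if_pos h1, if_pos h2]; ring
        · have hv' : X i < X (a.symm v) := by rwa [← hx, Equiv.apply_symm_apply]
          have h1 : ¬ (a.symm v : ℕ) < h + 1 := by
            intro hc
            rcases le_total i (a.symm v : ℕ) with h2 | h2
            · exact absurd (hhc _ h2 (by omega)) hv'.ne'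
            · exact absurd (hmono' _ _ h2 hin) (not_le.mpr hv')
          have h2 : ¬ (a.symm v : ℕ) < l := by omega
          simp only [hw, if_neg h1, if_neg h2]; ring

end Tight

end FairSelection

/-! ### A weakest-precondition calculus for running time. -/

namespace LogRam

/-- A constant that bounds the bit lengths of the values of `e` relative to those of the memory. -/
def Expr.width : Expr → ℕ
  | const k => Nat.size k
  | get _ _ => 1
  | add e₁ e₂ => e₁.width + e₂.width + 1
  | sub e₁ _ => e₁.width
  | mul e₁ e₂ => e₁.width + e₂.width
  | div e₁ _ => e₁.width

/-- A constant that bounds the cost of `e` relative to the bit lengths of the memory. -/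
def Expr.weight : Expr → ℕ
  | const k => 1 + Nat.size k
  | get _ i => i.weight + 2
  | add e₁ e₂ => e₁.weight + e₂.weight + (e₁.width + e₂.width + 2)
  | sub e₁ e₂ => e₁.weight + e₂.weight + (e₁.width + 1)
  | mul e₁ e₂ => e₁.weight + e₂.weight + (e₁.width + e₂.width + 1)
  | div e₁ e₂ => e₁.weight + e₂.weight + (e₁.width + 1)

/-- A constant that bounds the cost of the operations in `c`, without repetitions. -/
def Prog.weight : Prog → ℕ
  | skip => 1
  | store _ i e => 1 + i.weight + e.weight
  | write e => 1 + e.weight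
  | seq c₁ c₂ => c₁.weight + c₂.weight
  | ite e c₁ c₂ => 1 + e.weight + c₁.weight + c₂.weight
  | loop e c => 1 + e.weight + c.weight

/-- The nesting depth of the loops. -/
def Prog.depth : Prog → ℕ
  | skip => 0
  | store _ _ _ => 0
  | write _ => 0
  | seq c₁ c₂ => max c₁.depth c₂.depth
  | ite _ c₁ c₂ => max c₁.depth c₂.depth
  | loop _ c => c.depth + 1

/-- Every memory entry has at most `b` bits. -/
def MemBdd (b : ℕ) (s : State) : Prop := ∀ a i, s.mem a i < 2 ^ b

/-- Only sums and products lengthen numbers, and a fetched entry is short again. The width is a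
constant of the expression, so one evaluation multiplies bit lengths by a constant at most. -/
theorem Expr.eval_lt {b : ℕ} {s : State} (h : MemBdd b s) (e : Expr) :
    e.eval s < 2 ^ (e.width * (b + 1)) := by
  induction e with
  | const k =>
    refine (Nat.lt_size_self k).trans_le (Nat.pow_le_pow_right two_pos ?_)
    exact Nat.le_mul_of_pos_right _ b.succ_pos
  | get a i _ =>
    exact (h _ _).trans_le (Nat.pow_le_pow_right two_pos (by simp [width]))
  | add e₁ e₂ h₁ h₂ =>
    simp only [eval, width]
    have h3 : 2 ^ (e₁.width * (b + 1)) ≤ 2 ^ (e₁.width * (b + 1) + e₂.width * (b + 1)) :=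
      Nat.pow_le_pow_right two_pos (by omega)
    have h4 : 2 ^ (e₂.width * (b + 1)) ≤ 2 ^ (e₁.width * (b + 1) + e₂.width * (b + 1)) :=
      Nat.pow_le_pow_right two_pos (by omega)
    calc _ < 2 ^ (e₁.width * (b + 1) + e₂.width * (b + 1) + 1) := by rw [pow_succ]; omega
      _ ≤ _ := Nat.pow_le_pow_right two_pos (by nlinarith)
  | sub e₁ e₂ h₁ h₂ => exact (Nat.sub_le _ _).trans_lt h₁
  | mul e₁ e₂ h₁ h₂ =>
    simp only [eval, width]
    rw [add_mul, pow_add]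
    exact Nat.mul_lt_mul'' h₁ h₂
  | div e₁ e₂ h₁ h₂ => exact (Nat.div_le_self _ _).trans_lt h₁

theorem Expr.size_eval_le {b : ℕ} {s : State} (h : MemBdd b s) (e : Expr) :
    Nat.size (e.eval s) ≤ e.width * (b + 1) :=
  Nat.size_le.mpr (e.eval_lt h)

theorem Expr.cost_le {b : ℕ} {s : State} (h : MemBdd b s) (e : Expr) :
    e.cost s ≤ e.weight * (b + 1) := by
  induction e with
  | const k => simp only [cost, weight]; nlinarith
  | get a i hi =>
    have := Nat.size_le.mpr (h a (i.eval s))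
    simp only [cost, weight]; nlinarith
  | add e₁ e₂ h₁ h₂ =>
    have := Expr.size_eval_le h (add e₁ e₂)
    simp only [cost, weight, width, eval] at this ⊢; nlinarith
  | sub e₁ e₂ h₁ h₂ =>
    have := Expr.size_eval_le h (sub e₁ e₂)
    simp only [cost, weight, width, eval] at this ⊢; nlinarith
  | mul e₁ e₂ h₁ h₂ =>
    have := Expr.size_eval_le h (mul e₁ e₂)
    simp only [cost, weight, width, eval] at this ⊢; nlinarith
  | div e₁ e₂ h₁ h₂ =>
    have := Expr.size_eval_le h (div e₁ e₂)
    simp only [cost, weight, width, eval] at this ⊢; nlinarith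

/-- The cost allowed to a program whose loops are repeated at most `H` times each, while all memory
entries have at most `b` bits. -/
def Prog.budget (b H : ℕ) (c : Prog) : ℕ := c.weight * (b + 1) * (H + 1) ^ c.depth

/-- Started in `s`, the program halts within its budget in a state that satisfies `Q`. -/
def WP (b H : ℕ) (c : Prog) (Q : State → Prop) (s : State) : Prop :=
  MemBdd b s → ∃ s' t, Runs c s s' t ∧ t ≤ c.budget b H ∧ MemBdd b s' ∧ Q s'

theorem le_budget {b H w d t : ℕ} (h : t ≤ w * (b + 1)) : t ≤ w * (b + 1) * (H + 1) ^ d :=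
  h.trans (Nat.le_mul_of_pos_right _ (pow_pos H.succ_pos _))

variable {b H : ℕ} {Q Q' : State → Prop} {s : State}

theorem WP.mono {c : Prog} (h : WP b H c Q s) (hQ : ∀ s', Q s' → Q' s') : WP b H c Q' s := by
  intro hb
  obtain ⟨s', t, h1, h2, h3, h4⟩ := h hb
  exact ⟨s', t, h1, h2, h3, hQ _ h4⟩

theorem WP.skip (h : Q s) : WP b H .skip Q s := fun hb =>
  ⟨s, 1, .skip s, le_budget (by simp [Prog.weight]), hb, h⟩

/-- The only rule that changes the memory, hence the only place where the bound `b` on the bit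
lengths has to be re-established. -/
theorem WP.store {a : ℕ} {i e : Expr} (hv : e.eval s < 2 ^ b)
    (h : Q (s.set a (i.eval s) (e.eval s))) : WP b H (.store a i e) Q s := by
  intro hb
  refine ⟨_, _, .store s a i e, le_budget ?_, ?_, h⟩
  · have := i.cost_le hb
    have := e.cost_le hb
    simp only [Prog.weight]; nlinarith
  · intro a' j
    simp only [State.set]
    split_ifs
    · exact hv
    · exact hb a' j

theorem WP.write {e : Expr} (h : Q (s.emit (e.eval s))) : WP b H (.write e) Q s := by
  intro hb
  refine ⟨_, _, .write s e, le_budget ?_, hb, h⟩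
  have := e.cost_le hb
  simp only [Prog.weight]; nlinarith

theorem WP.seq {c₁ c₂ : Prog} (h : WP b H c₁ (WP b H c₂ Q) s) : WP b H (.seq c₁ c₂) Q s := by
  intro hb
  obtain ⟨s', t, h1, h2, h3, h4⟩ := h hb
  obtain ⟨s'', t', h1', h2', h3', h4'⟩ := h4 h3
  refine ⟨s'', _, .seq h1 h1', ?_, h3', h4'⟩
  unfold Prog.budget at *
  have e1 : (H + 1) ^ c₁.depth ≤ (H + 1) ^ (Prog.seq c₁ c₂).depth :=
    Nat.pow_le_pow_right H.succ_pos (le_max_left _ _)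
  have e2 : (H + 1) ^ c₂.depth ≤ (H + 1) ^ (Prog.seq c₁ c₂).depth :=
    Nat.pow_le_pow_right H.succ_pos (le_max_right _ _)
  have e3 := Nat.mul_le_mul_left (c₁.weight * (b + 1)) e1
  have e4 := Nat.mul_le_mul_left (c₂.weight * (b + 1)) e2
  have e5 : (Prog.seq c₁ c₂).weight = c₁.weight + c₂.weight := rfl
  rw [e5, add_mul, add_mul]
  omega

theorem WP.ite {e : Expr} {c₁ c₂ : Prog} (h₁ : e.eval s ≠ 0 → WP b H c₁ Q s)
    (h₂ : e.eval s = 0 → WP b H c₂ Q s) : WP b H (.ite e c₁ c₂) Q s := by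
  intro hb
  have hc := e.cost_le hb
  have e0 : 1 + e.cost s ≤ (1 + e.weight) * (b + 1) * (H + 1) ^ (Prog.ite e c₁ c₂).depth :=
    le_budget (by nlinarith)
  have e1 : (H + 1) ^ c₁.depth ≤ (H + 1) ^ (Prog.ite e c₁ c₂).depth :=
    Nat.pow_le_pow_right H.succ_pos (le_max_left _ _)
  have e2 : (H + 1) ^ c₂.depth ≤ (H + 1) ^ (Prog.ite e c₁ c₂).depth :=
    Nat.pow_le_pow_right H.succ_pos (le_max_right _ _)
  have e3 := Nat.mul_le_mul_left (c₁.weight * (b + 1)) e1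
  have e4 := Nat.mul_le_mul_left (c₂.weight * (b + 1)) e2
  have e5 : (Prog.ite e c₁ c₂).weight = 1 + e.weight + c₁.weight + c₂.weight := rfl
  by_cases he : e.eval s = 0
  · obtain ⟨s', t, h1, h2, h3, h4⟩ := h₂ he hb
    refine ⟨s', _, .ite_false he h1, ?_, h3, h4⟩
    unfold Prog.budget at *
    rw [e5, add_mul, add_mul, add_mul, add_mul]
    omega
  · obtain ⟨s', t, h1, h2, h3, h4⟩ := h₁ he hb
    refine ⟨s', _, .ite_true he h1, ?_, h3, h4⟩
    unfold Prog.budget at *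
    rw [e5, add_mul, add_mul, add_mul, add_mul]
    omega

/-- A loop that is repeated `n` times, with the invariant `I i` after `i` repetitions. -/
theorem WP.loop {e : Expr} {c : Prog} (n : ℕ) (hn : n ≤ H) (I : ℕ → State → Prop)
    (h0 : I 0 s) (hstep : ∀ i < n, ∀ s, I i s → e.eval s ≠ 0 ∧ WP b H c (I (i + 1)) s)
    (hend : ∀ s, I n s → e.eval s = 0 ∧ Q s) : WP b H (.loop e c) Q s := by
  -- The exact count comes first, linear in the number `d` of remaining repetitions; the factor `H +
  -- 1` for the extra nesting level absorbs it afterwards.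
  have key : ∀ d i s, i + d = n → I i s → MemBdd b s → ∃ s' t, Runs (.loop e c) s s' t ∧
      t ≤ (1 + e.weight) * (b + 1) + d * ((1 + e.weight) * (b + 1) + c.budget b H) ∧
      MemBdd b s' ∧ Q s' := by
    intro d
    induction d with
    | zero =>
      intro i s hi hI hb
      have : i = n := by omega
      subst this
      have hc := e.cost_le hb
      exact ⟨s, _, Runs.loop_stop (hend s hI).1, by nlinarith, hb, (hend s hI).2⟩
    | succ d ih =>
      intro i s hi hI hb
      obtain ⟨h1, h2⟩ := hstep i (by omega) s hI
      obtain ⟨s', t, r1, r2, r3, r4⟩ := h2 hb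
      obtain ⟨s'', t', r1', r2', r3', r4'⟩ := ih (i + 1) s' (by omega) r4 r3
      refine ⟨s'', _, .loop_step h1 r1 r1', ?_, r3', r4'⟩
      have hc := e.cost_le hb
      nlinarith
  intro hb
  obtain ⟨s', t, h1, h2, h3, h4⟩ := key n 0 s (by omega) h0 hb
  refine ⟨s', t, h1, h2.trans ?_, h3, h4⟩
  have e1 : n * ((1 + e.weight) * (b + 1) + c.budget b H) ≤
      H * ((1 + e.weight) * (b + 1) + c.budget b H) := Nat.mul_le_mul_right _ hn
  unfold Prog.budget at *
  simp only [Prog.weight, Prog.depth, pow_succ]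
  have e2 : 1 ≤ (H + 1) ^ c.depth := Nat.one_le_pow _ _ H.succ_pos
  generalize (H + 1) ^ c.depth = G at *
  have e3 : (1 + e.weight) * (b + 1) ≤ (1 + e.weight) * (b + 1) * G := Nat.le_mul_of_pos_right _ e2
  calc _ ≤ (1 + e.weight) * (b + 1) * G +
        H * ((1 + e.weight) * (b + 1) * G + c.weight * (b + 1) * G) := by nlinarith
    _ ≤ _ := by nlinarith [Nat.zero_le (c.weight * (b + 1) * G)]

/-- The entry of the array `a` at index `0`, used as a scalar variable. -/
abbrev Expr.var (a : ℕ) : Expr := .get a (.const 0)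

/-- Assignment to a scalar variable. -/
abbrev Prog.assign (a : ℕ) (e : Expr) : Prog := .store a (.const 0) e

/-- Run `c` for the values `0, 1, …, N - 1` of the scalar variable `v`. -/
def Prog.forRange (v : ℕ) (N : Expr) (c : Prog) : Prog :=
  .seq (.assign v (.const 0))
    (.loop (.sub N (.var v)) (.seq c (.assign v (.add (.var v) (.const 1)))))

/-- The invariant is stated after the loop variable has been updated, so the body has to preserve
this variable and may not change the bound. -/
theorem WP.forRange {v : ℕ} {N : Expr} {c : Prog} (n : ℕ) (hn : n ≤ H) (hb : n < 2 ^ b)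
    (I : ℕ → State → Prop) (h0 : I 0 (s.set v 0 0))
    (hN : ∀ i ≤ n, ∀ s, I i s → s.mem v 0 = i ∧ N.eval s = n)
    (hstep : ∀ i < n, ∀ s, I i s →
      WP b H c (fun s' => s'.mem v 0 = i ∧ I (i + 1) (s'.set v 0 (i + 1))) s)
    (hend : ∀ s, I n s → Q s) : WP b H (.forRange v N c) Q s := by
  refine .seq (.store (by simp [Expr.eval]) ?_)
  refine .loop n hn I h0 (fun i hi s hI => ⟨?_, ?_⟩) fun s hI => ⟨?_, hend s hI⟩
  · obtain ⟨h1, h2⟩ := hN i hi.le s hI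
    simp only [Expr.eval, h1, h2]; omega
  · refine .seq ((hstep i hi s hI).mono fun s' hs' => .store ?_ ?_)
    · simp only [Expr.eval, hs'.1]; omega
    · simpa only [Expr.eval, hs'.1] using hs'.2
  · obtain ⟨h1, h2⟩ := hN n le_rfl s hI
    simp only [Expr.eval, h1, h2]; omega

end LogRam

/-! ### Seeds and their reparametrization. -/

namespace FairSelection

/-- The seed that is passed on to a part of a merged block: it runs through `[0, 1]` with speeds
proportional to `x` before `lam` and to `y` after `lam`. -/
noncomputable def childSeed (lam x y s : ℝ) : ℝ :=
  if s < lam then s * x / (lam * x + (1 - lam) * y)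
  else 1 - (1 - s) * y / (lam * x + (1 - lam) * y)

/-- A right inverse of `childSeed`. -/
noncomputable def parentSeed (lam x y s : ℝ) : ℝ :=
  if s * (lam * x + (1 - lam) * y) < lam * x then s * (lam * x + (1 - lam) * y) / x
  else 1 - (1 - s) * (lam * x + (1 - lam) * y) / y

section Seeds

variable {lam x y : ℝ}

theorem childSeed_of_le (hT : 0 < lam * x + (1 - lam) * y) {s : ℝ} (h : s ≤ lam) :
    childSeed lam x y s = s * x / (lam * x + (1 - lam) * y) := by
  rcases h.lt_or_eq with h | rfl
  · rw [childSeed, if_pos h]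
  · rw [childSeed, if_neg (lt_irrefl _)]
    field_simp
    ring

theorem childSeed_of_ge {s : ℝ} (h : lam ≤ s) :
    childSeed lam x y s = 1 - (1 - s) * y / (lam * x + (1 - lam) * y) := by
  rw [childSeed, if_neg h.not_gt]

theorem childSeed_zero (hT : 0 < lam * x + (1 - lam) * y) (h0 : 0 ≤ lam) :
    childSeed lam x y 0 = 0 := by
  rw [childSeed_of_le hT h0]; simp

theorem childSeed_one (h1 : lam ≤ 1) : childSeed lam x y 1 = 1 := by
  rw [childSeed_of_ge h1]; simp

theorem childSeed_mono (hT : 0 < lam * x + (1 - lam) * y) (hx : 0 ≤ x) (hy : 0 ≤ y) :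
    Monotone (childSeed lam x y) := by
  have h1 : ∀ s t, s ≤ t → t ≤ lam → childSeed lam x y s ≤ childSeed lam x y t := by
    intro s t hst ht
    rw [childSeed_of_le hT ht, childSeed_of_le hT (hst.trans ht)]
    gcongr
  have h2 : ∀ s t, lam ≤ s → s ≤ t → childSeed lam x y s ≤ childSeed lam x y t := by
    intro s t hs hst
    rw [childSeed_of_ge hs, childSeed_of_ge (hs.trans hst)]
    gcongr
  intro s t hst
  rcases le_total t lam with ht | ht
  · exact h1 s t hst ht
  rcases le_total lam s with hs | hs
  · exact h2 s t hs hst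
  · exact (h1 s lam hs le_rfl).trans (h2 lam t le_rfl ht)

/-- Shows that every breakpoint of a part comes from a breakpoint of the merged block. A speed may
vanish, so `childSeed` need not be injective; `parentSeed` never divides by a vanishing speed
because the case distinction rules it out for `s < 1`. -/
theorem childSeed_parentSeed (hT : 0 < lam * x + (1 - lam) * y) (h0 : 0 ≤ lam) (h1 : lam ≤ 1)
    (hx : 0 ≤ x) (hy : 0 ≤ y) {s : ℝ} (hs0 : 0 ≤ s) (hs1 : s < 1) :
    childSeed lam x y (parentSeed lam x y s) = s ∧ 0 ≤ parentSeed lam x y s ∧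
      parentSeed lam x y s < 1 := by
  set T := lam * x + (1 - lam) * y with hTdef
  by_cases h : s * T < lam * x
  · have hxpos : 0 < x := by
      rcases hx.lt_or_eq with h' | h'
      · exact h'
      · rw [← h', mul_zero] at h
        exact absurd h (not_lt.mpr (by positivity))
    have hp : parentSeed lam x y s = s * T / x := by rw [parentSeed, if_pos h]
    have hlt : s * T / x < lam := by rwa [div_lt_iff₀ hxpos]
    rw [hp]
    refine ⟨?_, by positivity, hlt.trans_le h1⟩
    rw [childSeed, if_pos hlt, ← hTdef]
    field_simp
  · have h2 : (1 - s) * T ≤ (1 - lam) * y := by linarith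
    have h3 : 0 < (1 - s) * T := mul_pos (sub_pos.mpr hs1) hT
    have hypos : 0 < y := by
      rcases hy.lt_or_eq with h' | h'
      · exact h'
      · rw [← h', mul_zero] at h2; linarith
    have hp : parentSeed lam x y s = 1 - (1 - s) * T / y := by rw [parentSeed, if_neg h]
    have hle : (1 - s) * T / y ≤ 1 - lam := by rwa [div_le_iff₀ hypos]
    rw [hp]
    refine ⟨?_, by linarith, by have := div_pos h3 hypos; linarith⟩
    rw [childSeed_of_ge (by linarith), ← hTdef]
    field_simp
    ring

/-- The change of variables for Riemann sums: on a cell that does not straddle `lam`, discounting by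
the speed amounts to measuring the cell with the seed of the part. -/
theorem childSeed_step (hT : 0 < lam * x + (1 - lam) * y) {s t : ℝ} (hst : s < lam → t ≤ lam)
    (hle : s ≤ t) : (lam * x + (1 - lam) * y) * (childSeed lam x y t - childSeed lam x y s) =
      (t - s) * if s < lam then x else y := by
  split_ifs with h
  · rw [childSeed_of_le hT (hst h), childSeed_of_le hT h.le]
    field_simp
  · rw [childSeed_of_ge (not_lt.mp h), childSeed_of_ge ((not_lt.mp h).trans hle)]
    field_simp
    ring

end Seeds

/-! ### Blocks with equal utilities, and their merges. -/

/-- The probability that no position in `[l, l + w)` has value `1`. -/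
def noneProb (z : ℕ → ℝ) (l w : ℕ) : ℝ := ∏ j ∈ Finset.range w, (1 - z (l + j))

/-- The utility of the position `l + i` when the positions `[l, l + w)` compete in the order given
by `R`. -/
def blockUtil (z : ℕ → ℝ) (l w : ℕ) (R : ℕ → ℕ) (i : ℕ) : ℝ :=
  z (l + i) * ∏ j ∈ Finset.range w, if R j < R i then 1 - z (l + j) else 1

theorem noneProb_add (z : ℕ → ℝ) (l v w : ℕ) :
    noneProb z l (v + w) = noneProb z l v * noneProb z (l + v) w := by
  simp only [noneProb, Finset.prod_range_add, add_assoc]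

/-- `R` maps seeds to orders of the block `[l, l + w)`, such that all agents of the block have equal
utilities on average over the seeds in `[0, 1]`. The average is taken over the cells of any grid that
contains `X`. -/
structure EqualizesBlock (z : ℕ → ℝ) (l w : ℕ) (R : ℝ → ℕ → ℕ) (X : Set ℝ) : Prop where
  lt : ∀ s i, i < w → R s i < w
  inj : ∀ s i j, i < w → j < w → R s i = R s j → i = j
  util : ∀ (K : ℕ) (b : ℕ → ℝ), b 0 = 0 → b K = 1 → (∀ j < K, b j ≤ b (j + 1)) →
    (∀ x ∈ X, ∀ j < K, b j < x → b (j + 1) ≤ x) → ∀ i < w,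
      w * ∑ j ∈ Finset.range K, (b (j + 1) - b j) * blockUtil z l w (R (b j)) i =
        1 - noneProb z l w

theorem equalizesBlock_singleton (z : ℕ → ℝ) (l : ℕ) :
    EqualizesBlock z l 1 (fun _ i => i) ∅ where
  lt _ _ h := h
  inj _ _ _ _ _ h := h
  util K b h0 hK _ _ i hi := by
    obtain rfl : i = 0 := by omega
    rw [← Finset.sum_mul, Finset.sum_range_sub, h0, hK]
    simp [blockUtil, noneProb]

/-- The order of a merged block: `[0, v)` precedes `[v, v + w)` for seeds less than `lam`. -/
noncomputable def mergeOrder (lam P Q : ℝ) (v w : ℕ) (RA RB : ℝ → ℕ → ℕ) (s : ℝ) (i : ℕ) : ℕ :=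
  if i < v then (if s < lam then 0 else w) + RA (childSeed lam 1 Q s) i
  else (if s < lam then v else 0) + RB (childSeed lam P 1 s) (i - v)

/-- An agent of the first part keeps her utility inside the part when that part goes first, and it
is multiplied by `Q` otherwise; the speeds `1` and `Q` of her seed turn this discount into the
Lebesgue measure on the seeds of the part. Symmetrically for the second part with speeds `P` and
`1`. The identities `hcA` and `hcB` say that the averages of both parts agree with that of the
union. -/
theorem EqualizesBlock.merge {z : ℕ → ℝ} {l v w : ℕ} {RA RB : ℝ → ℕ → ℕ} {XA XB X : Set ℝ}
    (hA : EqualizesBlock z l v RA XA) (hB : EqualizesBlock z (l + v) w RB XB)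
    {P Q lam : ℝ} (hP : P = noneProb z l v) (hQ : Q = noneProb z (l + v) w)
    (hv : 0 < v) (hw : 0 < w) (hP0 : 0 ≤ P) (hQ0 : 0 ≤ Q)
    (h0 : 0 ≤ lam) (h1 : lam ≤ 1)
    (hTA : 0 < lam * 1 + (1 - lam) * Q) (hTB : 0 < lam * P + (1 - lam) * 1)
    (hcA : (v + w) * ((lam * 1 + (1 - lam) * Q) * (1 - P)) = v * (1 - P * Q))
    (hcB : (v + w) * ((lam * P + (1 - lam) * 1) * (1 - Q)) = w * (1 - P * Q))
    (hX : lam ∈ X) (hXA : ∀ x ∈ XA, ∃ y ∈ X, childSeed lam 1 Q y = x)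
    (hXB : ∀ x ∈ XB, ∃ y ∈ X, childSeed lam P 1 y = x) :
    EqualizesBlock z l (v + w) (mergeOrder lam P Q v w RA RB) X where
  lt s i hi := by
    unfold mergeOrder
    split_ifs with h1 h2 h2
    · have := hA.lt (childSeed lam 1 Q s) i h1; omega
    · have := hA.lt (childSeed lam 1 Q s) i h1; omega
    · have := hB.lt (childSeed lam P 1 s) (i - v) (by omega); omega
    · have := hB.lt (childSeed lam P 1 s) (i - v) (by omega); omega
  inj s i j hi hj h := by
    unfold mergeOrder at h
    have a1 := hA.lt (childSeed lam 1 Q s)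
    have b1 := hB.lt (childSeed lam P 1 s)
    have a2 := hA.inj (childSeed lam 1 Q s) i j
    have b2 := hB.inj (childSeed lam P 1 s) (i - v) (j - v)
    by_cases hi' : i < v <;> by_cases hj' : j < v
    · simp only [if_pos hi', if_pos hj'] at h
      exact a2 hi' hj' (by omega)
    · simp only [if_pos hi', if_neg hj'] at h
      have := a1 i hi'
      have := b1 (j - v) (by omega)
      split_ifs at h <;> omega
    · simp only [if_neg hi', if_pos hj'] at h
      have := a1 j hj'
      have := b1 (i - v) (by omega)
      split_ifs at h <;> omega
    · simp only [if_neg hi', if_neg hj'] at h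
      have := b2 (by omega) (by omega) (by omega)
      omega
  util K b hb0 hbK hmono hgrid i hi := by
    have hvw : (0 : ℝ) < v + w := by positivity
    rw [noneProb_add, ← hP, ← hQ]
    by_cases hiv : i < v
    · set e := childSeed lam 1 Q with he
      have hu := hA.util K (fun j => e (b j)) (by rw [hb0]; exact childSeed_zero hTA h0)
        (by rw [hbK]; exact childSeed_one h1)
        (fun j hj => childSeed_mono hTA zero_le_one hQ0 (hmono j hj))
        -- The image of the grid is a grid for the part: a breakpoint of the part is the image of a
        -- breakpoint `y` of the union, and the map is monotone.
        (fun x hx j hj hlt => by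
          obtain ⟨y, hy, rfl⟩ := hXA x hx
          exact childSeed_mono hTA zero_le_one hQ0
            (hgrid y hy j hj ((childSeed_mono hTA zero_le_one hQ0).reflect_lt hlt))) i hiv
      have hterm : ∀ j ∈ Finset.range K, (b (j + 1) - b j) *
          blockUtil z l (v + w) (mergeOrder lam P Q v w RA RB (b j)) i =
          (lam * 1 + (1 - lam) * Q) * ((e (b (j + 1)) - e (b j)) *
            blockUtil z l v (RA (e (b j))) i) := by
        intro j hj
        rw [Finset.mem_range] at hj
        rw [← mul_assoc, childSeed_step hTA (hgrid lam hX j hj) (hmono j hj), mul_assoc]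
        congr 1
        -- The competitors inside the part contribute the utility in the part, and those of the
        -- other part contribute all or nothing, depending on which part goes first.
        have hz : blockUtil z l (v + w) (mergeOrder lam P Q v w RA RB (b j)) i =
            blockUtil z l v (RA (e (b j))) i *
              ∏ k ∈ Finset.range w, if b j < lam then 1 else 1 - z (l + v + k) := by
          unfold blockUtil
          rw [Finset.prod_range_add, mul_assoc]
          congr 2
          · refine Finset.prod_congr rfl fun k hk => ?_
            rw [Finset.mem_range] at hk
            simp only [mergeOrder, if_pos hiv, if_pos hk, add_lt_add_iff_left, he]
          · refine Finset.prod_congr rfl fun k hk => ?_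
            rw [Finset.mem_range] at hk
            have r1 := hA.lt (e (b j)) i hiv
            have r2 := hB.lt (childSeed lam P 1 (b j)) k hk
            simp only [mergeOrder, if_pos hiv, if_neg (by omega : ¬ v + k < v),
              Nat.add_sub_cancel_left, ← he, add_assoc]
            split_ifs <;> first | rfl | omega
        rw [hz, mul_comm]
        congr 1
        split_ifs
        · simp
        · exact hQ.symm
      rw [Finset.sum_congr rfl hterm, ← Finset.mul_sum]
      have hv' : (v : ℝ) ≠ 0 := by positivity
      rw [← hP] at hu
      apply mul_left_cancel₀ hv'
      push_cast
      rw [← hcA, ← hu]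
      ring
    · set e := childSeed lam P 1 with he
      have hu := hB.util K (fun j => e (b j)) (by rw [hb0]; exact childSeed_zero hTB h0)
        (by rw [hbK]; exact childSeed_one h1)
        (fun j hj => childSeed_mono hTB hP0 zero_le_one (hmono j hj))
        (fun x hx j hj hlt => by
          obtain ⟨y, hy, rfl⟩ := hXB x hx
          exact childSeed_mono hTB hP0 zero_le_one
            (hgrid y hy j hj ((childSeed_mono hTB hP0 zero_le_one).reflect_lt hlt)))
        (i - v) (by omega)
      have hterm : ∀ j ∈ Finset.range K, (b (j + 1) - b j) *
          blockUtil z l (v + w) (mergeOrder lam P Q v w RA RB (b j)) i =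
          (lam * P + (1 - lam) * 1) * ((e (b (j + 1)) - e (b j)) *
            blockUtil z (l + v) w (RB (e (b j))) (i - v)) := by
        intro j hj
        rw [Finset.mem_range] at hj
        rw [← mul_assoc, childSeed_step hTB (hgrid lam hX j hj) (hmono j hj), mul_assoc]
        congr 1
        have hz : blockUtil z l (v + w) (mergeOrder lam P Q v w RA RB (b j)) i =
            (∏ k ∈ Finset.range v, if b j < lam then 1 - z (l + k) else 1) *
              blockUtil z (l + v) w (RB (e (b j))) (i - v) := by
          unfold blockUtil
          rw [Finset.prod_range_add, mul_left_comm, (by omega : l + v + (i - v) = l + i)]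
          congr 1
          · refine Finset.prod_congr rfl fun k hk => ?_
            rw [Finset.mem_range] at hk
            have r1 := hA.lt (childSeed lam 1 Q (b j)) k hk
            have r2 := hB.lt (e (b j)) (i - v) (by omega)
            simp only [mergeOrder, if_neg hiv, if_pos hk, ← he]
            split_ifs <;> first | rfl | omega
          · congr 1
            refine Finset.prod_congr rfl fun k hk => ?_
            simp only [mergeOrder, if_neg hiv, if_neg (by omega : ¬ v + k < v),
              Nat.add_sub_cancel_left, add_lt_add_iff_left, ← he, ← add_assoc]
        rw [hz]
        congr 1
        split_ifs
        · exact hP.symm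
        · simp
      rw [Finset.sum_congr rfl hterm, ← Finset.mul_sum]
      have hw' : (w : ℝ) ≠ 0 := by positivity
      rw [← hQ] at hu
      apply mul_left_cancel₀ hw'
      push_cast
      rw [← hcB, ← hu]
      ring

/-! ### Sortedness makes an equalizing mixture possible. -/

section Sorted

variable {z : ℕ → ℝ}

/-- The union bound. -/
theorem one_sub_noneProb_le {l w : ℕ} {θ : ℝ} (h0 : ∀ j < w, 0 ≤ z (l + j))
    (h1 : ∀ j < w, z (l + j) ≤ 1) (hθ : ∀ j < w, z (l + j) ≤ θ) :
    1 - noneProb z l w ≤ w * θ := by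
  induction w with
  | zero => simp [noneProb]
  | succ w ih =>
    have ih := ih (fun j hj => h0 j (by omega)) (fun j hj => h1 j (by omega))
      fun j hj => hθ j (by omega)
    have hp : noneProb z l (w + 1) = noneProb z l w * (1 - z (l + w)) :=
      Finset.prod_range_succ _ _
    have hle : noneProb z l w ≤ 1 := Finset.prod_le_one
      (fun j hj => by have := h1 j (by have := Finset.mem_range.mp hj; omega); linarith)
      (fun j hj => by have := h0 j (by have := Finset.mem_range.mp hj; omega); linarith)
    rw [hp]
    push_cast
    nlinarith [h0 w (by omega), hθ w (by omega)]

/-- Induction on `(1 - θ) * (1 + (w + 1) * θ) ≤ 1 + w * θ`, a product form of the estimate `(1 - θ)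
^ w * (1 + w * θ) ≤ 1`. -/
theorem noneProb_mul_le {l w : ℕ} {θ : ℝ} (h0 : 0 ≤ θ) (h1 : ∀ j < w, z (l + j) ≤ 1)
    (hθ : ∀ j < w, θ ≤ z (l + j)) : noneProb z l w * (1 + w * θ) ≤ 1 := by
  induction w with
  | zero => simp [noneProb]
  | succ w ih =>
    have ih := ih (fun j hj => h1 j (by omega)) fun j hj => hθ j (by omega)
    have hp : noneProb z l (w + 1) = noneProb z l w * (1 - z (l + w)) :=
      Finset.prod_range_succ _ _
    have hnn : 0 ≤ noneProb z l w := Finset.prod_nonneg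
      (fun j hj => by have := h1 j (by have := Finset.mem_range.mp hj; omega); linarith)
    have h2 : (1 - z (l + w)) * (1 + (w + 1) * θ) ≤ 1 + w * θ := by
      have := hθ w (by omega)
      have h3 : (1 - z (l + w)) * (1 + (w + 1) * θ) ≤ (1 - θ) * (1 + (w + 1) * θ) :=
        mul_le_mul_of_nonneg_right (by linarith) (by positivity)
      nlinarith [mul_nonneg (by positivity : (0 : ℝ) ≤ (w + 1)) (mul_nonneg h0 h0)]
    rw [hp]
    push_cast
    calc _ = noneProb z l w * ((1 - z (l + w)) * (1 + (w + 1) * θ)) := by ring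
      _ ≤ noneProb z l w * (1 + w * θ) := by gcongr
      _ ≤ 1 := ih

/-- A later block that goes first has a larger average utility than an earlier block that goes
second. -/
theorem average_le_of_sorted {l v w : ℕ} (hv : 0 < v) (h0 : ∀ j < v + w, 0 ≤ z (l + j))
    (h1 : ∀ j < v + w, z (l + j) ≤ 1)
    (hs : ∀ i j, i ≤ j → j < v + w → z (l + i) ≤ z (l + j)) :
    w * noneProb z (l + v) w * (1 - noneProb z l v) ≤ v * (1 - noneProb z (l + v) w) := by
  -- The last entry of the earlier block separates the two blocks: it is an upper bound for the
  -- earlier one and a lower bound for the later one.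
  set θ := z (l + (v - 1)) with hθ
  have hθ0 : 0 ≤ θ := h0 (v - 1) (by omega)
  have e1 := one_sub_noneProb_le (l := l) (w := v) (θ := θ) (fun j hj => h0 j (by omega))
    (fun j hj => h1 j (by omega)) fun j hj => hs _ _ (by omega) (by omega)
  have e2 := noneProb_mul_le (z := z) (l := l + v) (w := w) hθ0
    (fun j hj => by rw [add_assoc]; exact h1 _ (by omega))
    (fun j hj => by rw [add_assoc]; exact hs _ _ (by omega) (by omega))
  have hnn : 0 ≤ noneProb z (l + v) w := Finset.prod_nonneg fun j hj => by
    have := h1 (v + j) (by have := Finset.mem_range.mp hj; omega)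
    rw [← add_assoc] at this
    linarith
  calc _ ≤ w * noneProb z (l + v) w * (v * θ) := by gcongr
    _ = v * (noneProb z (l + v) w * (1 + w * θ) - noneProb z (l + v) w) := by ring
    _ ≤ v * (1 - noneProb z (l + v) w) := by gcongr

end Sorted

/-- Blocks with equal utilities inside, in increasing order of their utilities, are tight. -/
theorem tight_of_blocks {z X : ℕ → ℝ} {n sp : ℕ} {st : ℕ → ℕ} (h0 : st 0 = 0) (hn : st sp = n)
    (hst : ∀ t < sp, st t < st (t + 1)) (h1 : ∀ j < n, z j ≤ 1)
    (hX : ∀ t < sp, ∀ i, st t ≤ i → i < st (t + 1) → ((st (t + 1) - st t : ℕ) : ℝ) * X i =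
      noneProb z 0 (st t) * (1 - noneProb z (st t) (st (t + 1) - st t)))
    (hc : ∀ t, t + 1 < sp →
      (1 - noneProb z (st t) (st (t + 1) - st t)) * ((st (t + 2) - st (t + 1) : ℕ) : ℝ) ≤
      noneProb z (st t) (st (t + 1) - st t) *
        (1 - noneProb z (st (t + 1)) (st (t + 2) - st (t + 1))) * ((st (t + 1) - st t : ℕ) : ℝ)) :
    (∀ i, i + 1 < n → X i ≤ X (i + 1)) ∧ ∀ i < n, (i + 1 < n ∧ X i = X (i + 1)) ∨
      ∑ j ∈ Finset.range (i + 1), X j = 1 - noneProb z 0 (i + 1) := by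
  have hmono : ∀ t t', t ≤ t' → t' ≤ sp → st t ≤ st t' := by
    intro t t' h
    induction t', h using Nat.le_induction with
    | base => exact fun _ => le_rfl
    | succ k _ ih => exact fun hk => (ih (by omega)).trans (hst k (by omega)).le
  have hsum : ∀ t ≤ sp, ∑ j ∈ Finset.range (st t), X j = 1 - noneProb z 0 (st t) := by
    intro t
    induction t with
    | zero => intro _; simp [h0, noneProb]
    | succ t ih =>
      intro ht
      have hlt := hst t (by omega)
      obtain ⟨w, hw⟩ := Nat.exists_eq_add_of_lt hlt
      have hX' := hX t (by omega)
      have hw' : st (t + 1) = st t + (w + 1) := by omega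
      rw [hw', Finset.sum_range_add, ih (by omega), noneProb_add, zero_add]
      -- Equal entries sum to the utility of the whole block, and the block utilities telescope.
      have hconst : ∀ i ∈ Finset.range (w + 1), X (st t + i) = X (st t) := by
        intro i hi
        rw [Finset.mem_range] at hi
        have e1 := hX' (st t + i) (by omega) (by omega)
        have e2 := hX' (st t) le_rfl hlt
        have hne : ((st (t + 1) - st t : ℕ) : ℝ) ≠ 0 := by
          rw [hw', Nat.add_sub_cancel_left]; positivity
        exact mul_left_cancel₀ hne (e1.trans e2.symm)
      rw [Finset.sum_congr rfl hconst, Finset.sum_const, Finset.card_range, nsmul_eq_mul]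
      have e2 := hX' (st t) le_rfl hlt
      rw [hw', Nat.add_sub_cancel_left] at e2
      rw [e2]
      ring
  have hblock : ∀ i < n, ∃ t < sp, st t ≤ i ∧ i < st (t + 1) := by
    intro i hi
    have : ∀ t ≤ sp, i < st t → ∃ t < sp, st t ≤ i ∧ i < st (t + 1) := by
      intro t
      induction t with
      | zero => intro _ h; omega
      | succ t ih =>
        intro ht h
        by_cases h' : i < st t
        · exact ih (by omega) h'
        · exact ⟨t, by omega, not_lt.mp h', h⟩
    exact this sp le_rfl (by omega)
  have hsame : ∀ t < sp, ∀ i j, st t ≤ i → i < st (t + 1) → st t ≤ j → j < st (t + 1) →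
      X i = X j := by
    intro t ht i j h1 h2 h3 h4
    have hne : ((st (t + 1) - st t : ℕ) : ℝ) ≠ 0 := by
      have := hst t ht
      exact_mod_cast (by omega : st (t + 1) - st t ≠ 0)
    exact mul_left_cancel₀ hne ((hX t ht i h1 h2).trans (hX t ht j h3 h4).symm)
  refine ⟨fun i hi => ?_, fun i hi => ?_⟩
  · obtain ⟨t, ht, h2, h3⟩ := hblock i (by omega)
    by_cases h4 : i + 1 < st (t + 1)
    · exact (hsame t ht _ _ h2 h3 (by omega) h4).le
    have h5 : i + 1 = st (t + 1) := by omega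
    have h6 : t + 1 < sp := by
      by_contra h
      have : t + 1 = sp := by omega
      rw [this, hn] at h5
      omega
    have e1 := hX t ht i h2 h3
    have e2 := hX (t + 1) h6 (i + 1) (by omega) (by have := hst (t + 1) h6; omega)
    have hvpos : (0 : ℝ) < ((st (t + 1) - st t : ℕ) : ℝ) := by
      exact_mod_cast (by omega : 0 < st (t + 1) - st t)
    have hwpos : (0 : ℝ) < ((st (t + 2) - st (t + 1) : ℕ) : ℝ) := by
      have : st (t + 1) < st (t + 2) := hst (t + 1) h6
      exact_mod_cast (by omega : 0 < st (t + 2) - st (t + 1))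
    have hsplit : noneProb z 0 (st (t + 1)) =
        noneProb z 0 (st t) * noneProb z (st t) (st (t + 1) - st t) := by
      have h7 := noneProb_add z 0 (st t) (st (t + 1) - st t)
      rwa [Nat.add_sub_cancel' (hst t ht).le, zero_add] at h7
    have hpre : 0 ≤ noneProb z 0 (st t) := Finset.prod_nonneg fun j hj => by
      have := Finset.mem_range.mp hj
      have := h1 (0 + j) (by omega)
      linarith
    rw [hsplit] at e2
    -- Here `i` is the last index of its block, so the averages of two adjacent blocks are compared,
    -- after clearing both widths.
    refine le_of_mul_le_mul_left ?_ (mul_pos hvpos hwpos)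
    have e3 := mul_le_mul_of_nonneg_left (hc t h6) hpre
    have e2' : ((st (t + 2) - st (t + 1) : ℕ) : ℝ) * X (i + 1) = _ := e2
    calc _ = ((st (t + 2) - st (t + 1) : ℕ) : ℝ) *
          (((st (t + 1) - st t : ℕ) : ℝ) * X i) := by ring
      _ ≤ ((st (t + 1) - st t : ℕ) : ℝ) *
          (((st (t + 2) - st (t + 1) : ℕ) : ℝ) * X (i + 1)) := by
          rw [e1, e2']; linarith
      _ = _ := by ring
  · obtain ⟨t, ht, h2, h3⟩ := hblock i hi
    by_cases h4 : i + 1 < st (t + 1)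
    · have := hmono (t + 1) sp (by omega) le_rfl
      exact .inl ⟨by omega, hsame t ht _ _ h2 h3 (by omega) h4⟩
    · have h5 : i + 1 = st (t + 1) := by omega
      right
      rw [h5]
      exact hsum (t + 1) (by omega)

end FairSelection

/-! ### Integer arithmetic of merges. -/

namespace FairSelection

/-- The fraction that the program computes for the seed of a part. The inequality keeps the new seed
in `[0, 1]`, and the truncated subtractions in the formula are exact. -/
theorem childSeed_natCast {L M x y u v : ℕ} (hN : 0 < L + M) (hW : 0 < L * x + M * y)
    (hv : 0 < v) (huv : u ≤ v) :
    childSeed ((L : ℝ) / (L + M)) x y ((u : ℝ) / v) =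
      ((if u * (L + M) < L * v then u * (L + M) * x
        else v * (L * x + M * y) - (v - u) * (L + M) * y : ℕ) : ℝ) /
        ((v * (L * x + M * y) : ℕ) : ℝ) ∧
    (if u * (L + M) < L * v then u * (L + M) * x
        else v * (L * x + M * y) - (v - u) * (L + M) * y) ≤ v * (L * x + M * y) := by
  have hNr : (0 : ℝ) < L + M := by exact_mod_cast hN
  have hvr : (0 : ℝ) < v := by exact_mod_cast hv
  have hWr : (0 : ℝ) < L * x + M * y := by exact_mod_cast hW
  have hiff : (u : ℝ) / v < (L : ℝ) / (L + M) ↔ u * (L + M) < L * v := by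
    rw [div_lt_div_iff₀ hvr hNr]; exact_mod_cast Iff.rfl
  have hT : (L : ℝ) / (L + M) * x + (1 - (L : ℝ) / (L + M)) * y = (L * x + M * y) / (L + M) := by
    field_simp; ring
  unfold childSeed
  rw [hT]
  by_cases h : u * (L + M) < L * v
  · rw [if_pos h, if_pos (hiff.mpr h)]
    refine ⟨?_, ?_⟩
    · push_cast; field_simp
    · calc u * (L + M) * x ≤ L * v * x := Nat.mul_le_mul_right _ h.le
        _ ≤ v * (L * x + M * y) := by rw [mul_add]; nlinarith [Nat.zero_le (v * (M * y))]
  · rw [if_neg h, if_neg (fun h' => h (hiff.mp h'))]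
    have h1 : (v - u) * (L + M) * y ≤ v * (L * x + M * y) := by
      obtain ⟨c, rfl⟩ := Nat.exists_eq_add_of_le huv
      rw [Nat.add_sub_cancel_left]
      have h2 : c * (L + M) ≤ (u + c) * M := by nlinarith
      calc c * (L + M) * y ≤ (u + c) * M * y := Nat.mul_le_mul_right _ h2
        _ ≤ _ := by rw [mul_add, ← mul_assoc (u + c) M y]; exact Nat.le_add_left _ _
    refine ⟨?_, Nat.sub_le _ _⟩
    rw [Nat.cast_sub h1]
    push_cast [Nat.cast_sub huv]
    generalize (L : ℝ) * x + M * y = W at hWr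
    field_simp

/-- The fraction that the program computes when it moves a breakpoint to the merged block.
Strictness keeps all breakpoints below `1` and the new denominator positive. -/
theorem parentSeed_natCast {L M x y u v : ℕ} (hN : 0 < L + M) (hW : 0 < L * x + M * y)
    (huv : u < v) :
    parentSeed ((L : ℝ) / (L + M)) x y ((u : ℝ) / v) =
      ((if u * (L * x + M * y) < v * (L * x) then u * (L * x + M * y)
        else v * ((L + M) * y) - (v - u) * (L * x + M * y) : ℕ) : ℝ) /
      ((if u * (L * x + M * y) < v * (L * x) then v * ((L + M) * x)
        else v * ((L + M) * y) : ℕ) : ℝ) ∧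
    (if u * (L * x + M * y) < v * (L * x) then u * (L * x + M * y)
        else v * ((L + M) * y) - (v - u) * (L * x + M * y)) <
      if u * (L * x + M * y) < v * (L * x) then v * ((L + M) * x) else v * ((L + M) * y) := by
  have hNr : (0 : ℝ) < L + M := by exact_mod_cast hN
  have hv : 0 < v := by omega
  have hvr : (0 : ℝ) < v := by exact_mod_cast hv
  have hWr : (0 : ℝ) < L * x + M * y := by exact_mod_cast hW
  have hT : (L : ℝ) / (L + M) * x + (1 - (L : ℝ) / (L + M)) * y = (L * x + M * y) / (L + M) := by
    field_simp; ring
  have hiff : (u : ℝ) / v * ((L * x + M * y) / (L + M)) < (L : ℝ) / (L + M) * x ↔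
      u * (L * x + M * y) < v * (L * x) := by
    rw [div_mul_div_comm, div_mul_eq_mul_div, div_lt_div_iff₀ (by positivity) hNr,
      show (L : ℝ) * x * (v * (L + M)) = v * (L * x) * (L + M) by ring,
      mul_lt_mul_iff_of_pos_right hNr]
    exact_mod_cast Iff.rfl
  unfold parentSeed
  rw [hT]
  by_cases h : u * (L * x + M * y) < v * (L * x)
  · simp only [if_pos h]
    rw [if_pos (hiff.mpr h)]
    refine ⟨?_, h.trans_le ?_⟩
    · push_cast; field_simp
    · exact Nat.mul_le_mul_left _ (Nat.mul_le_mul_right _ (Nat.le_add_right _ _))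
  · simp only [if_neg h]
    rw [if_neg (fun h' => h (hiff.mp h'))]
    obtain ⟨c, rfl⟩ := Nat.exists_eq_add_of_lt huv
    have e0 : u + c + 1 - u = c + 1 := by omega
    rw [e0]
    have h1 : (c + 1) * (L * x + M * y) ≤ (u + c + 1) * (M * y) := by nlinarith
    have h2 : (u + c + 1) * (M * y) ≤ (u + c + 1) * ((L + M) * y) :=
      Nat.mul_le_mul_left _ (Nat.mul_le_mul_right _ (Nat.le_add_left _ _))
    have h3 : 0 < (c + 1) * (L * x + M * y) := Nat.mul_pos c.succ_pos hW
    have h4 : 0 < (u + c + 1) * ((L + M) * y) := by omega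
    refine ⟨?_, by omega⟩
    rw [Nat.cast_sub (h1.trans h2)]
    have hy : (y : ℝ) ≠ 0 := by
      rintro hy
      rw [Nat.cast_eq_zero] at hy
      subst hy
      simp at h4
    push_cast at hvr ⊢
    field_simp
    ring

/-- Only the ratio of the speeds matters, so the program can use the integers `e`, `q` instead of
`1`, `q / e`. -/
theorem childSeed_mul {c : ℝ} (hc : c ≠ 0) (lam x y s : ℝ) :
    childSeed lam (c * x) (c * y) s = childSeed lam x y s := by
  have h : lam * (c * x) + (1 - lam) * (c * y) = c * (lam * x + (1 - lam) * y) := by ring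
  unfold childSeed
  rw [h, mul_left_comm s, mul_left_comm (1 - s), mul_div_mul_left _ _ hc, mul_div_mul_left _ _ hc]

/-- The parameters of a merge of the blocks `[l, mid)` and `[mid, hi)`: the first block precedes the
second one for seeds less than `L / (L + M)`. The probabilities that all values are `0` are `p / d`
in the first and `q / e` in the second block. -/
structure MergeRec where
  (L M p d q e l mid hi : ℕ)

namespace MergeRec

/-- The seed at which the order of the two blocks changes. -/
noncomputable def lam (r : MergeRec) : ℝ := (r.L : ℝ) / (r.L + r.M)

/-- The seeds after the split of a merged block. -/
noncomputable def splitSeed (r : MergeRec) (S : ℕ → ℝ) (i : ℕ) : ℝ :=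
  if i = r.mid then childSeed r.lam r.p r.d (S r.l)
  else if i = r.l then childSeed r.lam r.e r.q (S r.l) else S i

/-- The positions of the first agents of the blocks after the split of a merged block. -/
noncomputable def splitPos (r : MergeRec) (S : ℕ → ℝ) (O : ℕ → ℕ) (i : ℕ) : ℕ :=
  if S r.l < r.lam then (if i = r.mid then O r.l + (r.mid - r.l) else O i)
  else if i = r.mid then O r.l else if i = r.l then O r.l + (r.hi - r.mid) else O i

/-- The conditions under which the seeds of a merge are well defined, and bounds. -/
structure Good (n B : ℕ) (r : MergeRec) : Prop where
  LM_pos : 0 < r.L + r.M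
  left_pos : 0 < r.L * r.e + r.M * r.q
  right_pos : 0 < r.L * r.p + r.M * r.d
  LM_le : r.L + r.M ≤ 2 ^ (3 * B + 1)
  p_le : r.p ≤ 2 ^ B
  d_le : r.d ≤ 2 ^ B
  q_le : r.q ≤ 2 ^ B
  e_le : r.e ≤ 2 ^ B
  l_lt : r.l < r.mid
  mid_lt : r.mid < r.hi
  hi_le : r.hi ≤ n

end MergeRec

/-- The positions of all agents after the merges `m - 1, …, 0` have been split. -/
noncomputable def evalPos (r : ℕ → MergeRec) : ℕ → (ℕ → ℝ) → (ℕ → ℕ) → ℕ → ℕ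
  | 0, _, O => O
  | m + 1, S, O => evalPos r m ((r m).splitSeed S) ((r m).splitPos S O)

theorem evalPos_congr {r r' : ℕ → MergeRec} {m : ℕ} (h : ∀ j < m, r j = r' j) (S : ℕ → ℝ)
    (O : ℕ → ℕ) : evalPos r m S O = evalPos r' m S O := by
  induction m generalizing S O with
  | zero => rfl
  | succ m ih =>
    simp only [evalPos]
    rw [h m (by omega), ih fun j hj => h j (by omega)]

/-- The state of the algorithm that merges blocks: a stack of `sp` blocks that cover the first `k`
positions, `cnt` recorded merges, and the breakpoints `xn / xd` of the blocks that start at `xr`. -/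
structure PavaView where
  (sp k cnt : ℕ)
  (st bp bd xn xd xr : ℕ → ℕ)
  (recs : ℕ → MergeRec)

/-- The merge of the blocks `t` and `t + 1` of the stack. -/
def PavaView.recAt (v : PavaView) (t : ℕ) : MergeRec where
  L := v.bd t * (v.st (t + 1) - v.st t) * (v.bd (t + 1) - v.bp (t + 1)) -
    (v.st (t + 2) - v.st (t + 1)) * v.bp (t + 1) * (v.bd t - v.bp t)
  M := v.bd (t + 1) * (v.st (t + 2) - v.st (t + 1)) * (v.bd t - v.bp t) -
    (v.st (t + 1) - v.st t) * v.bp t * (v.bd (t + 1) - v.bp (t + 1))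
  p := v.bp t
  d := v.bd t
  q := v.bp (t + 1)
  e := v.bd (t + 1)
  l := v.st t
  mid := v.st (t + 1)
  hi := v.st (t + 2)

/-- Success probabilities `z`, in increasing order, such that `1 - z j = pn j / pd j`. -/
structure SortedData (z : ℕ → ℝ) (n B : ℕ) (pn pd : ℕ → ℕ) : Prop where
  pos : ∀ j < n, 0 < pd j
  le : ∀ j < n, pn j ≤ pd j
  eq : ∀ j < n, 1 - z j = (pn j : ℝ) / pd j
  mono : ∀ i j, i ≤ j → j < n → z i ≤ z j
  prod_le : ∏ j ∈ Finset.range n, pd j ≤ 2 ^ B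
  n_le : n ≤ 2 ^ B

/-- The breakpoints of the block that starts at `l`. -/
def PavaView.breakpoints (v : PavaView) (l : ℕ) : Set ℝ :=
  {x | ∃ j < v.cnt, v.xr j = l ∧ x = (v.xn j : ℝ) / v.xd j}

/-- The invariant of the algorithm that merges blocks. -/
structure PavaInv (z : ℕ → ℝ) (n B : ℕ) (pn pd : ℕ → ℕ) (v : PavaView) : Prop where
  k_le : v.k ≤ n
  cnt : v.cnt + v.sp = v.k
  st_zero : v.st 0 = 0
  st_sp : v.st v.sp = v.k
  st_lt : ∀ t < v.sp, v.st t < v.st (t + 1)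
  bp : ∀ t < v.sp, v.bp t = ∏ j ∈ Finset.range (v.st (t + 1) - v.st t), pn (v.st t + j)
  bd : ∀ t < v.sp, v.bd t = ∏ j ∈ Finset.range (v.st (t + 1) - v.st t), pd (v.st t + j)
  noMerge : ∀ t, t + 2 < v.sp → (v.recAt t).M = 0
  xr : ∀ j < v.cnt, ∃ t < v.sp, v.xr j = v.st t
  xlt : ∀ j < v.cnt, v.xn j < v.xd j
  xle : ∀ j < v.cnt, v.xd j ≤ 2 ^ ((4 * B + 1) * v.cnt)
  good : ∀ j < v.cnt, (v.recs j).Good n B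
  recs_hi : ∀ j < v.cnt, (v.recs j).hi ≤ v.k
  blocks : ∃ R : ℕ → ℝ → ℕ → ℕ, ∀ t < v.sp,
    EqualizesBlock z (v.st t) (v.st (t + 1) - v.st t) (R t) (v.breakpoints (v.st t)) ∧
    ∀ S O, ∀ i < v.st (t + 1) - v.st t,
      evalPos v.recs v.cnt S O (v.st t + i) = O (v.st t) + R t (S (v.st t)) i

theorem EqualizesBlock.mono {z : ℕ → ℝ} {l w : ℕ} {R : ℝ → ℕ → ℕ} {X X' : Set ℝ}
    (h : EqualizesBlock z l w R X) (hX : X ⊆ X') : EqualizesBlock z l w R X' :=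
  ⟨h.lt, h.inj, fun K b h0 hK hm hg => h.util K b h0 hK hm fun x hx => hg x (hX hx)⟩

/-! ### The invariant of the pooling algorithm. -/

section Inv

variable {z : ℕ → ℝ} {n B : ℕ} {pn pd : ℕ → ℕ} {v v' : PavaView}

theorem SortedData.z_le_one (hd : SortedData z n B pn pd) {j : ℕ} (hj : j < n) : z j ≤ 1 := by
  have := hd.eq j hj
  have h2 : (0 : ℝ) ≤ (pn j : ℝ) / pd j := by positivity
  linarith

theorem SortedData.z_nonneg (hd : SortedData z n B pn pd) {j : ℕ} (hj : j < n) : 0 ≤ z j := by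
  have := hd.eq j hj
  have h2 : (pn j : ℝ) / pd j ≤ 1 :=
    div_le_one_of_le₀ (by exact_mod_cast hd.le j hj) (by positivity)
  linarith

theorem SortedData.prod_pos (hd : SortedData z n B pn pd) {l w : ℕ} (h : l + w ≤ n) :
    0 < ∏ j ∈ Finset.range w, pd (l + j) :=
  Finset.prod_pos fun j hj => hd.pos _ (by have := Finset.mem_range.mp hj; omega)

theorem SortedData.prod_le_prod (hd : SortedData z n B pn pd) {l w : ℕ} (h : l + w ≤ n) :
    ∏ j ∈ Finset.range w, pn (l + j) ≤ ∏ j ∈ Finset.range w, pd (l + j) :=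
  Finset.prod_le_prod' fun j hj => hd.le _ (by have := Finset.mem_range.mp hj; omega)

theorem SortedData.prod_le_pow (hd : SortedData z n B pn pd) {l w : ℕ} (h : l + w ≤ n) :
    ∏ j ∈ Finset.range w, pd (l + j) ≤ 2 ^ B := by
  refine le_trans ?_ hd.prod_le
  obtain ⟨c, rfl⟩ := Nat.exists_eq_add_of_le h
  rw [Finset.prod_range_add, Finset.prod_range_add, mul_right_comm]
  refine Nat.le_mul_of_pos_left _ (Nat.mul_pos ?_ ?_)
  · exact Finset.prod_pos fun j hj => hd.pos _ (by have := Finset.mem_range.mp hj; omega)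
  · exact Finset.prod_pos fun j hj => hd.pos _ (by have := Finset.mem_range.mp hj; omega)

theorem SortedData.noneProb_eq (hd : SortedData z n B pn pd) {l w : ℕ} (h : l + w ≤ n) :
    noneProb z l w = ((∏ j ∈ Finset.range w, pn (l + j) : ℕ) : ℝ) /
      ((∏ j ∈ Finset.range w, pd (l + j) : ℕ) : ℝ) := by
  push_cast
  rw [noneProb, ← Finset.prod_div_distrib]
  exact Finset.prod_congr rfl fun j hj => hd.eq _ (by have := Finset.mem_range.mp hj; omega)

theorem PavaInv.st_le (h : PavaInv z n B pn pd v) {t t' : ℕ} (htt : t ≤ t') (ht : t' ≤ v.sp) :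
    v.st t ≤ v.st t' := by
  induction t', htt using Nat.le_induction with
  | base => exact le_rfl
  | succ k _ ih => exact (ih (by omega)).trans (h.st_lt k (by omega)).le

theorem PavaInv.st_strict (h : PavaInv z n B pn pd v) {t t' : ℕ} (htt : t < t') (ht : t' ≤ v.sp) :
    v.st t < v.st t' :=
  (h.st_lt t (by omega)).trans_le (h.st_le htt ht)

theorem PavaInv.st_le_n (h : PavaInv z n B pn pd v) {t : ℕ} (ht : t ≤ v.sp) : v.st t ≤ n :=
  (h.st_le ht le_rfl).trans (h.st_sp.trans_le h.k_le)

theorem pavaInv_init (hs : v.sp = 0) (hk : v.k = 0) (hc : v.cnt = 0) (hst : v.st 0 = 0) :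
    PavaInv z n B pn pd v where
  k_le := by omega
  cnt := by omega
  st_zero := hst
  st_sp := by rw [hs, hk, hst]
  st_lt t ht := by omega
  bp t ht := by omega
  bd t ht := by omega
  noMerge t ht := by omega
  xr j hj := by omega
  xlt j hj := by omega
  xle j hj := by omega
  good j hj := by omega
  recs_hi j hj := by omega
  blocks := ⟨fun _ _ i => i, fun t ht => by omega⟩

theorem recAt_congr {t : ℕ} (h1 : ∀ i ≤ t + 2, v'.st i = v.st i)
    (h2 : ∀ i ≤ t + 1, v'.bp i = v.bp i) (h3 : ∀ i ≤ t + 1, v'.bd i = v.bd i) :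
    v'.recAt t = v.recAt t := by
  simp only [PavaView.recAt, h1 t (by omega), h1 (t + 1) (by omega), h1 (t + 2) (by omega),
    h2 t (by omega), h2 (t + 1) (by omega), h3 t (by omega), h3 (t + 1) (by omega)]

/-- The pair that was topmost becomes an inner pair of the stack, so `hM` is needed for `noMerge`.
The new singleton has no breakpoints, and no recorded merge reaches beyond the positions covered so
far. -/
theorem PavaInv.push (h : PavaInv z n B pn pd v) (hk : v.k < n)
    (hM : 2 ≤ v.sp → (v.recAt (v.sp - 2)).M = 0)
    (e_sp : v'.sp = v.sp + 1) (e_k : v'.k = v.k + 1) (e_cnt : v'.cnt = v.cnt)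
    (e_st : v'.st = Function.update v.st (v.sp + 1) (v.k + 1))
    (e_bp : v'.bp = Function.update v.bp v.sp (pn v.k))
    (e_bd : v'.bd = Function.update v.bd v.sp (pd v.k))
    (e_xn : v'.xn = v.xn) (e_xd : v'.xd = v.xd) (e_xr : v'.xr = v.xr)
    (e_recs : ∀ j < v.cnt, v'.recs j = v.recs j) : PavaInv z n B pn pd v' := by
  have hst : ∀ t ≤ v.sp, v'.st t = v.st t := fun t ht => by
    rw [e_st, Function.update_of_ne (by omega)]
  have hst' : v'.st (v.sp + 1) = v.k + 1 := by rw [e_st, Function.update_self]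
  have hbp : ∀ t < v.sp, v'.bp t = v.bp t := fun t ht => by
    rw [e_bp, Function.update_of_ne (by omega)]
  have hbd : ∀ t < v.sp, v'.bd t = v.bd t := fun t ht => by
    rw [e_bd, Function.update_of_ne (by omega)]
  have hcase : ∀ t < v'.sp, t < v.sp ∨ t = v.sp := fun t ht => by omega
  have hbr : ∀ l, v'.breakpoints l = v.breakpoints l := fun l => by
    simp only [PavaView.breakpoints, e_cnt, e_xn, e_xd, e_xr]
  constructor
  · omega
  · have := h.cnt; omega
  · rw [hst 0 (by omega), h.st_zero]
  · rw [e_sp, hst', e_k]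
  · intro t ht
    rcases hcase t ht with ht | rfl
    · rw [hst t (by omega), hst (t + 1) (by omega)]; exact h.st_lt t ht
    · rw [hst _ le_rfl, hst', h.st_sp]; omega
  · intro t ht
    rcases hcase t ht with ht | rfl
    · rw [hst t (by omega), hst (t + 1) (by omega), hbp t ht]; exact h.bp t ht
    · rw [hst _ le_rfl, hst', h.st_sp, e_bp, Function.update_self]; simp
  · intro t ht
    rcases hcase t ht with ht | rfl
    · rw [hst t (by omega), hst (t + 1) (by omega), hbd t ht]; exact h.bd t ht
    · rw [hst _ le_rfl, hst', h.st_sp, e_bd, Function.update_self]; simp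
  · intro t ht
    rw [recAt_congr (v := v) (fun i hi => hst i (by omega)) (fun i hi => hbp i (by omega))
      fun i hi => hbd i (by omega)]
    rcases Nat.lt_or_ge (t + 2) v.sp with h1 | h1
    · exact h.noMerge t h1
    · obtain rfl : t = v.sp - 2 := by omega
      exact hM (by omega)
  · intro j hj
    rw [e_cnt] at hj
    obtain ⟨t, ht, h1⟩ := h.xr j hj
    exact ⟨t, by omega, by rw [e_xr, h1, hst t ht.le]⟩
  · rw [e_cnt, e_xn, e_xd]; exact h.xlt
  · rw [e_cnt, e_xd]; exact h.xle
  · intro j hj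
    rw [e_cnt] at hj
    rw [e_recs j hj]; exact h.good j hj
  · intro j hj
    rw [e_cnt] at hj
    rw [e_recs j hj, e_k]; exact (h.recs_hi j hj).trans (Nat.le_succ _)
  · obtain ⟨R, hR⟩ := h.blocks
    refine ⟨Function.update R v.sp fun _ i => i, fun t ht => ?_⟩
    have hev : ∀ S O, evalPos v'.recs v'.cnt S O = evalPos v.recs v.cnt S O := fun S O => by
      rw [e_cnt]; exact evalPos_congr e_recs S O
    rcases hcase t ht with ht | rfl
    · rw [hst t ht.le, hst (t + 1) (by omega), Function.update_of_ne ht.ne, hbr]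
      refine ⟨(hR t ht).1, fun S O i hi => ?_⟩
      rw [hev]; exact (hR t ht).2 S O i hi
    · rw [hst _ le_rfl, hst', h.st_sp, Function.update_self, Nat.add_sub_cancel_left]
      refine ⟨(equalizesBlock_singleton z v.k).mono (Set.empty_subset _), fun S O i hi => ?_⟩
      obtain rfl : i = 0 := by omega
      rw [hev]
      -- Recorded merges end at or before `v.k`, so undoing them does not move the agent at `v.k`.
      have key : ∀ m ≤ v.cnt, ∀ S O, evalPos v.recs m S O v.k = O v.k := by
        intro m
        induction m with
        | zero => intro _ S O; rfl
        | succ m ih =>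
          intro hm S O
          rw [evalPos, ih (by omega)]
          have hg := h.good m hm
          have h1 := hg.l_lt
          have h2 := hg.mid_lt
          have h3 := h.recs_hi m hm
          have h4 : v.k ≠ (v.recs m).mid := by omega
          have h5 : v.k ≠ (v.recs m).l := by omega
          simp only [MergeRec.splitPos, if_neg h4, if_neg h5, ite_self]
      rw [add_zero, add_zero, key _ le_rfl]

/-- The record with index `cnt` serves as scratch space for a tentative merge; the invariant ignores
it. -/
theorem PavaInv.congr_recs (h : PavaInv z n B pn pd v) {recs : ℕ → MergeRec}
    (hr : ∀ j < v.cnt, recs j = v.recs j) : PavaInv z n B pn pd { v with recs := recs } where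
  k_le := h.k_le
  cnt := h.cnt
  st_zero := h.st_zero
  st_sp := h.st_sp
  st_lt := h.st_lt
  bp := h.bp
  bd := h.bd
  noMerge := h.noMerge
  xr := h.xr
  xlt := h.xlt
  xle := h.xle
  good j hj := by
    change MergeRec.Good n B (recs j)
    rw [hr j hj]
    exact h.good j hj
  recs_hi j hj := (congrArg MergeRec.hi (hr j hj)).trans_le (h.recs_hi j hj)
  blocks := by
    obtain ⟨R, hR⟩ := h.blocks
    refine ⟨R, fun t ht => ⟨(hR t ht).1, fun S O i hi => ?_⟩⟩
    rw [← (hR t ht).2 S O i hi, evalPos_congr hr]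

/-- The subtraction in `L` is exact because the agents are sorted. The one in `M` is exact or
truncates to `0`, and it vanishes if the averages of the two blocks are in the right order; so `M`
also serves as the test for a merge. -/
theorem PavaInv.recAt_spec (hd : SortedData z n B pn pd) (h : PavaInv z n B pn pd v) {t : ℕ}
    (ht : t + 2 ≤ v.sp) {r : MergeRec} (hr : r = v.recAt t) :
    (r.l < r.mid ∧ r.mid < r.hi ∧ r.hi ≤ n) ∧ (r.p ≤ r.d ∧ 0 < r.d ∧ r.d ≤ 2 ^ B) ∧
      (r.q ≤ r.e ∧ 0 < r.e ∧ r.e ≤ 2 ^ B) ∧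
      noneProb z r.l (r.mid - r.l) = (r.p : ℝ) / r.d ∧
      noneProb z r.mid (r.hi - r.mid) = (r.q : ℝ) / r.e ∧
      ((r.M : ℝ) = r.e * (r.hi - r.mid) * (r.d - r.p) - (r.mid - r.l) * r.p * (r.e - r.q) ∨
        r.M = 0 ∧
          (r.e : ℝ) * (r.hi - r.mid) * (r.d - r.p) ≤ (r.mid - r.l) * r.p * (r.e - r.q)) ∧
      (r.L : ℝ) = r.d * (r.mid - r.l) * (r.e - r.q) - (r.hi - r.mid) * r.q * (r.d - r.p) := by
  have e0 := h.st_lt t (by omega)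
  have e1 : v.st (t + 1) < v.st (t + 2) := h.st_lt (t + 1) (by omega)
  have e2 := h.st_le_n ht
  have wA : v.st t + (v.st (t + 1) - v.st t) ≤ n := by omega
  have wB : v.st (t + 1) + (v.st (t + 2) - v.st (t + 1)) ≤ n := by omega
  have hbp0 := h.bp t (by omega)
  have hbd0 := h.bd t (by omega)
  have hbp1 : v.bp (t + 1) = ∏ j ∈ Finset.range (v.st (t + 2) - v.st (t + 1)),
    pn (v.st (t + 1) + j) := h.bp (t + 1) (by omega)
  have hbd1 : v.bd (t + 1) = ∏ j ∈ Finset.range (v.st (t + 2) - v.st (t + 1)),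
    pd (v.st (t + 1) + j) := h.bd (t + 1) (by omega)
  have n0 := hd.noneProb_eq wA
  have n1 := hd.noneProb_eq wB
  have l0 := hd.prod_le_prod wA
  have l1 := hd.prod_le_prod wB
  have p0 := hd.prod_pos wA
  have p1 := hd.prod_pos wB
  have b0 := hd.prod_le_pow wA
  have b1 := hd.prod_le_pow wB
  rw [← hbp0, ← hbd0] at n0 l0
  rw [← hbp1, ← hbd1] at n1 l1
  rw [← hbd0] at p0 b0
  rw [← hbd1] at p1 b1
  subst hr
  refine ⟨⟨e0, e1, e2⟩, ⟨l0, p0, b0⟩, ⟨l1, p1, b1⟩, n0, n1, ?_, ?_⟩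
  · simp only [PavaView.recAt]
    rcases le_total (v.bd (t + 1) * (v.st (t + 2) - v.st (t + 1)) * (v.bd t - v.bp t))
      ((v.st (t + 1) - v.st t) * v.bp t * (v.bd (t + 1) - v.bp (t + 1))) with hle | hle
    · right
      refine ⟨Nat.sub_eq_zero_of_le hle, ?_⟩
      have := (Nat.cast_le (α := ℝ)).mpr hle
      push_cast [Nat.cast_sub l0, Nat.cast_sub l1, Nat.cast_sub e0.le, Nat.cast_sub e1.le] at this
      exact this
    · left
      rw [Nat.cast_sub hle]
      push_cast [Nat.cast_sub l0, Nat.cast_sub l1, Nat.cast_sub e0.le, Nat.cast_sub e1.le]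
      ring
  · simp only [PavaView.recAt]
    -- After clearing denominators, this says that the subtrahend in `L` does not exceed the
    -- minuend.
    have hav := average_le_of_sorted (z := z) (l := v.st t) (v := v.st (t + 1) - v.st t)
      (w := v.st (t + 2) - v.st (t + 1)) (by omega)
      (fun j hj => hd.z_nonneg (by omega)) (fun j hj => hd.z_le_one (by omega))
      (fun i j hij hj => hd.mono _ _ (by omega) (by omega))
    rw [Nat.add_sub_cancel' e0.le, n0, n1] at hav
    have q0 : (0 : ℝ) < v.bd t := by exact_mod_cast p0
    have q1 : (0 : ℝ) < v.bd (t + 1) := by exact_mod_cast p1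
    push_cast [Nat.cast_sub e0.le, Nat.cast_sub e1.le] at hav
    have hav2 := mul_le_mul_of_nonneg_right hav (mul_pos q0 q1).le
    have hle : (v.st (t + 2) - v.st (t + 1)) * v.bp (t + 1) * (v.bd t - v.bp t) ≤
        v.bd t * (v.st (t + 1) - v.st t) * (v.bd (t + 1) - v.bp (t + 1)) := by
      rw [← Nat.cast_le (α := ℝ)]
      push_cast [Nat.cast_sub l0, Nat.cast_sub l1, Nat.cast_sub e0.le, Nat.cast_sub e1.le]
      field_simp at hav2
      linarith
    rw [Nat.cast_sub hle]
    push_cast [Nat.cast_sub l0, Nat.cast_sub l1, Nat.cast_sub e0.le, Nat.cast_sub e1.le]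
    ring

/-- Both numbers are bounded by a product of a block denominator, a block width and a block
denominator, each at most `2 ^ B`. -/
theorem PavaInv.recAt_le (hd : SortedData z n B pn pd) (h : PavaInv z n B pn pd v) {t : ℕ}
    (ht : t + 2 ≤ v.sp) {r : MergeRec} (hr : r = v.recAt t) :
    r.L ≤ 2 ^ (3 * B) ∧ r.M ≤ 2 ^ (3 * B) := by
  obtain ⟨⟨l1, l2, l3⟩, ⟨pd1, dpos, dB⟩, ⟨qe1, epos, eB⟩, -⟩ := h.recAt_spec hd ht hr
  have hnB := hd.n_le
  have e : 2 ^ B * 2 ^ B * 2 ^ B = 2 ^ (3 * B) := by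
    rw [← pow_add, ← pow_add]; congr 1; omega
  rw [← e]
  subst hr
  constructor
  · refine (Nat.sub_le _ _).trans (Nat.mul_le_mul (Nat.mul_le_mul dB ?_) ?_)
    · exact (Nat.sub_le _ _).trans ((l2.le.trans l3).trans hnB)
    · exact (Nat.sub_le _ _).trans eB
  · refine (Nat.sub_le _ _).trans (Nat.mul_le_mul (Nat.mul_le_mul eB ?_) ?_)
    · exact (Nat.sub_le _ _).trans (l3.trans hnB)
    · exact (Nat.sub_le _ _).trans dB

/-- The parameters of a merge satisfy the assumptions of `EqualizesBlock.merge`. -/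
theorem merge_parameters {p d q e α β L M : ℝ} (hp : 0 ≤ p) (hpd : p ≤ d) (hd : 0 < d)
    (hq : 0 ≤ q) (hqe : q ≤ e) (he : 0 < e) (hα : 0 < α) (hβ : 0 < β)
    (hL : L = d * α * (e - q) - β * q * (d - p)) (hM : M = e * β * (d - p) - α * p * (e - q))
    (hL0 : 0 ≤ L) (hM0 : 0 < M) :
    0 < L * e + M * q ∧ 0 < L * p + M * d ∧
      0 < L / (L + M) * 1 + (1 - L / (L + M)) * (q / e) ∧
      0 < L / (L + M) * (p / d) + (1 - L / (L + M)) * 1 ∧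
      (α + β) * ((L / (L + M) * 1 + (1 - L / (L + M)) * (q / e)) * (1 - p / d)) =
        α * (1 - p / d * (q / e)) ∧
      (α + β) * ((L / (L + M) * (p / d) + (1 - L / (L + M)) * 1) * (1 - q / e)) =
        β * (1 - p / d * (q / e)) := by
  -- The three factorizations `hN`, `hWA`, `hWB` carry the lemma; positivity of `M` then forces `p <
  -- d` and `q < e`.
  have hN : L + M = (α + β) * ((d - p) * (e - q)) := by rw [hL, hM]; ring
  have hNpos : 0 < L + M := by linarith
  have hgh : 0 < (d - p) * (e - q) := by
    rw [hN] at hNpos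
    exact (mul_pos_iff_of_pos_left (by linarith)).mp hNpos
  have hg : 0 < d - p := by
    rcases (sub_nonneg.mpr hpd).lt_or_eq with h | h
    · exact h
    · rw [← h, zero_mul] at hgh; exact absurd hgh (lt_irrefl _)
  have hh : 0 < e - q := (mul_pos_iff_of_pos_left hg).mp hgh
  have hc : 0 < d * e - p * q := by nlinarith
  have hWA : L * e + M * q = α * (e - q) * (d * e - p * q) := by rw [hL, hM]; ring
  have hWB : L * p + M * d = β * (d - p) * (d * e - p * q) := by rw [hL, hM]; ring
  have hA : 0 < L * e + M * q := by rw [hWA]; positivity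
  have hB : 0 < L * p + M * d := by rw [hWB]; positivity
  have hTA : L / (L + M) * 1 + (1 - L / (L + M)) * (q / e) = (L * e + M * q) / ((L + M) * e) := by
    field_simp; ring
  have hTB : L / (L + M) * (p / d) + (1 - L / (L + M)) * 1 = (L * p + M * d) / ((L + M) * d) := by
    field_simp; ring
  refine ⟨hA, hB, ?_, ?_, ?_, ?_⟩
  · rw [hTA]; positivity
  · rw [hTB]; positivity
  · rw [hTA, hWA, hN]; field_simp
  · rw [hTB, hWB, hN]; field_simp

-- Pooling the two topmost blocks preserves the invariant. Their breakpoints are pulled back through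
-- `parentSeed`, the switching point `lam` is added, and the merge is recorded last, so that it is
-- the first to be undone.
set_option maxHeartbeats 1000000 in
theorem PavaInv.merge (hd : SortedData z n B pn pd) (h : PavaInv z n B pn pd v) (hsp : 2 ≤ v.sp)
    {r : MergeRec} (hr : r = v.recAt (v.sp - 2)) (hM : 0 < r.M)
    (e_sp : v'.sp = v.sp - 1) (e_k : v'.k = v.k) (e_cnt : v'.cnt = v.cnt + 1)
    (e_st : v'.st = Function.update v.st (v.sp - 1) v.k)
    (e_bp : v'.bp = Function.update v.bp (v.sp - 2) (r.p * r.q))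
    (e_bd : v'.bd = Function.update v.bd (v.sp - 2) (r.d * r.e))
    (e_new : v'.xn v.cnt = r.L ∧ v'.xd v.cnt = r.L + r.M ∧ v'.xr v.cnt = r.l)
    (e_left : ∀ j < v.cnt, v.xr j = r.l → v'.xr j = r.l ∧
      v'.xn j = (if v.xn j * (r.L * r.e + r.M * r.q) < v.xd j * (r.L * r.e)
        then v.xn j * (r.L * r.e + r.M * r.q)
        else v.xd j * ((r.L + r.M) * r.q) - (v.xd j - v.xn j) * (r.L * r.e + r.M * r.q)) ∧
      v'.xd j = if v.xn j * (r.L * r.e + r.M * r.q) < v.xd j * (r.L * r.e)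
        then v.xd j * ((r.L + r.M) * r.e) else v.xd j * ((r.L + r.M) * r.q))
    (e_right : ∀ j < v.cnt, v.xr j = r.mid → v'.xr j = r.l ∧
      v'.xn j = (if v.xn j * (r.L * r.p + r.M * r.d) < v.xd j * (r.L * r.p)
        then v.xn j * (r.L * r.p + r.M * r.d)
        else v.xd j * ((r.L + r.M) * r.d) - (v.xd j - v.xn j) * (r.L * r.p + r.M * r.d)) ∧
      v'.xd j = if v.xn j * (r.L * r.p + r.M * r.d) < v.xd j * (r.L * r.p)
        then v.xd j * ((r.L + r.M) * r.p) else v.xd j * ((r.L + r.M) * r.d))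
    (e_other : ∀ j < v.cnt, v.xr j ≠ r.l → v.xr j ≠ r.mid →
      v'.xr j = v.xr j ∧ v'.xn j = v.xn j ∧ v'.xd j = v.xd j)
    (e_recs : ∀ j < v.cnt, v'.recs j = v.recs j) (e_rec : v'.recs v.cnt = r) :
    PavaInv z n B pn pd v' := by
  obtain ⟨s, hs⟩ : ∃ s, v.sp = s + 2 := ⟨v.sp - 2, by omega⟩
  have hs2 : v.sp - 2 = s := by omega
  have hs1 : v.sp - 1 = s + 1 := by omega
  rw [hs2] at hr e_bp e_bd
  rw [hs1] at e_sp e_st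
  obtain ⟨⟨l1, l2, l3⟩, ⟨pd1, dpos, dB⟩, ⟨qe1, epos, eB⟩, hP, hQ, hMr, hLr⟩ :=
    h.recAt_spec hd (t := s) (by omega) hr
  -- Since `M` is positive, its defining subtraction did not truncate.
  have hMr := hMr.resolve_right fun h' => by omega
  have rl : r.l = v.st s := by rw [hr]; rfl
  have rmid : r.mid = v.st (s + 1) := by rw [hr]; rfl
  have rhi : r.hi = v.st (s + 2) := by rw [hr]; rfl
  have rp : r.p = v.bp s := by rw [hr]; rfl
  have rd : r.d = v.bd s := by rw [hr]; rfl
  have rq : r.q = v.bp (s + 1) := by rw [hr]; rfl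
  have re : r.e = v.bd (s + 1) := by rw [hr]; rfl
  have hik : r.hi = v.k := by rw [rhi, ← hs, h.st_sp]
  have hα : (0 : ℝ) < (r.mid : ℝ) - r.l := by rw [sub_pos]; exact_mod_cast l1
  have hβ : (0 : ℝ) < (r.hi : ℝ) - r.mid := by rw [sub_pos]; exact_mod_cast l2
  obtain ⟨WA, WB, TA, TB, cA, cB⟩ := merge_parameters (p := r.p) (d := r.d) (q := r.q) (e := r.e)
    (α := (r.mid : ℝ) - r.l) (β := (r.hi : ℝ) - r.mid) (L := r.L) (M := r.M)
    (by positivity) (by exact_mod_cast pd1) (by exact_mod_cast dpos) (by positivity)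
    (by exact_mod_cast qe1) (by exact_mod_cast epos) hα hβ hLr hMr (by positivity)
    (by exact_mod_cast hM)
  have WA' : 0 < r.L * r.e + r.M * r.q := by exact_mod_cast WA
  have WB' : 0 < r.L * r.p + r.M * r.d := by exact_mod_cast WB
  have dposr : (0 : ℝ) < r.d := by exact_mod_cast dpos
  have eposr : (0 : ℝ) < r.e := by exact_mod_cast epos
  have hnB := hd.n_le
  have hpB : r.p ≤ 2 ^ B := pd1.trans dB
  have hqB : r.q ≤ 2 ^ B := qe1.trans eB
  obtain ⟨hLle, hMle⟩ := h.recAt_le hd (t := s) (by omega) hr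
  have hLM : r.L + r.M ≤ 2 ^ (3 * B + 1) := by rw [pow_succ]; omega
  have hgood : r.Good n B :=
    ⟨by omega, WA', WB', hLM, hpB, dB, hqB, eB, l1, l2, l3⟩
  have hlam : r.lam = (r.L : ℝ) / (r.L + r.M) := rfl
  have hLMr : (0 : ℝ) < (r.L : ℝ) + r.M := by exact_mod_cast hgood.LM_pos
  have lam0 : 0 ≤ r.lam := by rw [hlam]; positivity
  have lam1 : r.lam < 1 := by
    rw [hlam, div_lt_one hLMr]
    have : (0 : ℝ) < r.M := by exact_mod_cast hM
    linarith
  have hst : ∀ t ≤ s, v'.st t = v.st t := fun t ht => by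
    rw [e_st, Function.update_of_ne (by omega)]
  have hst' : v'.st (s + 1) = v.k := by rw [e_st, Function.update_self]
  have hbp : ∀ t < s, v'.bp t = v.bp t := fun t ht => by
    rw [e_bp, Function.update_of_ne (by omega)]
  have hbd : ∀ t < s, v'.bd t = v.bd t := fun t ht => by
    rw [e_bd, Function.update_of_ne (by omega)]
  have hcase : ∀ t < v'.sp, t < s ∨ t = s := fun t ht => by omega
  have hjcase : ∀ j < v'.cnt, j < v.cnt ∨ j = v.cnt := fun j hj => by omega
  have hstr : ∀ t t', t < t' → t' ≤ s + 2 → v.st t < v.st t' := fun t t' h1 h2 =>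
    h.st_strict h1 (by omega)
  have hxcases : ∀ j < v.cnt, v.xr j = r.l ∨ v.xr j = r.mid ∨
      v.xr j ≠ r.l ∧ v.xr j ≠ r.mid := fun j _ => by omega
  have pow_mono : (2 : ℕ) ^ ((4 * B + 1) * v.cnt) * 2 ^ (4 * B + 1) =
      2 ^ ((4 * B + 1) * v'.cnt) := by rw [← pow_add, e_cnt]; congr 1
  -- A moved denominator gains the factor `(L + M) * y` with `y` one of `p`, `d`, `q`, `e`: at most
  -- `3 * B + 1` plus `B` bits.
  have hmul : ∀ y ≤ 2 ^ B, ∀ x ≤ 2 ^ ((4 * B + 1) * v.cnt),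
      x * ((r.L + r.M) * y) ≤ 2 ^ ((4 * B + 1) * v'.cnt) := fun y hy x hx => by
    rw [← pow_mono]
    refine Nat.mul_le_mul hx ?_
    calc (r.L + r.M) * y ≤ 2 ^ (3 * B + 1) * 2 ^ B := Nat.mul_le_mul hLM hy
      _ = 2 ^ (4 * B + 1) := by rw [← pow_add]; congr 1; omega
  have hone : 1 ≤ 2 ^ (4 * B + 1) := Nat.one_le_two_pow
  have hsum : v.st (s + 2) - v.st s = (v.st (s + 1) - v.st s) + (v.st (s + 2) - v.st (s + 1)) := by
    omega
  have hmid' : v.st s + (v.st (s + 1) - v.st s) = v.st (s + 1) := by omega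
  have hprod : ∀ f : ℕ → ℕ, ∏ j ∈ Finset.range (v.st (s + 2) - v.st s), f (v.st s + j) =
      (∏ j ∈ Finset.range (v.st (s + 1) - v.st s), f (v.st s + j)) *
        ∏ j ∈ Finset.range (v.st (s + 2) - v.st (s + 1)), f (v.st (s + 1) + j) := fun f => by
    rw [hsum, Finset.prod_range_add]
    simp only [← add_assoc, hmid']
  have hkst : v.k = v.st (s + 2) := by rw [← hik, rhi]
  constructor
  · rw [e_k]; exact h.k_le
  · have := h.cnt; omega
  · rw [hst 0 (by omega), h.st_zero]
  · rw [e_sp, hst', e_k]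
  · intro t ht
    rcases hcase t ht with ht | rfl
    · rw [hst t (by omega), hst (t + 1) (by omega)]; exact h.st_lt t (by omega)
    · rw [hst _ le_rfl, hst']; omega
  · intro t ht
    rcases hcase t ht with ht | rfl
    · rw [hst t (by omega), hst (t + 1) (by omega), hbp t ht]; exact h.bp t (by omega)
    · rw [hst _ le_rfl, hst', e_bp, Function.update_self, hkst, hprod, rp, rq,
        h.bp t (by omega), h.bp (t + 1) (by omega)]
  · intro t ht
    rcases hcase t ht with ht | rfl
    · rw [hst t (by omega), hst (t + 1) (by omega), hbd t ht]; exact h.bd t (by omega)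
    · rw [hst _ le_rfl, hst', e_bd, Function.update_self, hkst, hprod, rd, re,
        h.bd t (by omega), h.bd (t + 1) (by omega)]
  · intro t ht
    rw [recAt_congr (v := v) (fun i hi => hst i (by omega)) (fun i hi => hbp i (by omega))
      fun i hi => hbd i (by omega)]
    exact h.noMerge t (by omega)
  · intro j hj
    rcases hjcase j hj with hj | rfl
    · rcases hxcases j hj with h1 | h1 | ⟨h1, h2⟩
      · exact ⟨s, by omega, by rw [(e_left j hj h1).1, hst s le_rfl, rl]⟩
      · exact ⟨s, by omega, by rw [(e_right j hj h1).1, hst s le_rfl, rl]⟩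
      · obtain ⟨t, ht, h3⟩ := h.xr j hj
        have h4 : t ≠ s := by rintro rfl; exact h1 (h3.trans rl.symm)
        have h5 : t ≠ s + 1 := by rintro rfl; exact h2 (h3.trans rmid.symm)
        exact ⟨t, by omega, by rw [(e_other j hj h1 h2).1, h3, hst t (by omega)]⟩
    · exact ⟨s, by omega, by rw [e_new.2.2, hst s le_rfl, rl]⟩
  · intro j hj
    rcases hjcase j hj with hj | rfl
    · rcases hxcases j hj with h1 | h1 | ⟨h1, h2⟩
      · rw [(e_left j hj h1).2.1, (e_left j hj h1).2.2]
        exact (parentSeed_natCast hgood.LM_pos WA' (h.xlt j hj)).2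
      · rw [(e_right j hj h1).2.1, (e_right j hj h1).2.2]
        exact (parentSeed_natCast hgood.LM_pos WB' (h.xlt j hj)).2
      · rw [(e_other j hj h1 h2).2.1, (e_other j hj h1 h2).2.2]
        exact h.xlt j hj
    · rw [e_new.1, e_new.2.1]; omega
  · intro j hj
    rcases hjcase j hj with hj | rfl
    · have hx := h.xle j hj
      rcases hxcases j hj with h1 | h1 | ⟨h1, h2⟩
      · rw [(e_left j hj h1).2.2]
        split_ifs
        · exact hmul _ eB _ hx
        · exact hmul _ hqB _ hx
      · rw [(e_right j hj h1).2.2]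
        split_ifs
        · exact hmul _ hpB _ hx
        · exact hmul _ dB _ hx
      · rw [(e_other j hj h1 h2).2.2, ← pow_mono]
        exact hx.trans (Nat.le_mul_of_pos_right _ (by omega))
    · rw [e_new.2.1]
      refine hLM.trans (Nat.pow_le_pow_right two_pos ?_)
      rw [e_cnt]
      exact le_trans (by omega : 3 * B + 1 ≤ 4 * B + 1) (Nat.le_mul_of_pos_right _ (Nat.succ_pos _))
  · intro j hj
    rcases hjcase j hj with hj | rfl
    · rw [e_recs j hj]; exact h.good j hj
    · rw [e_rec]; exact hgood
  · intro j hj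
    rcases hjcase j hj with hj | rfl
    · rw [e_recs j hj, e_k]; exact h.recs_hi j hj
    · rw [e_rec, e_k, hik]
  · obtain ⟨R, hR⟩ := h.blocks
    refine ⟨Function.update R s (mergeOrder r.lam ((r.p : ℝ) / r.d) ((r.q : ℝ) / r.e)
      (r.mid - r.l) (r.hi - r.mid) (R s) (R (s + 1))), fun t ht => ?_⟩
    -- The new record is split first, and the older records then act on the parts.
    have hev : ∀ S O, evalPos v'.recs v'.cnt S O =
        evalPos v.recs v.cnt (r.splitSeed S) (r.splitPos S O) := fun S O => by
      rw [e_cnt, evalPos, e_rec, evalPos_congr e_recs]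
    rcases hcase t ht with ht | rfl
    · rw [hst t ht.le, hst (t + 1) (by omega), Function.update_of_ne ht.ne]
      have h1 := hstr t s ht (by omega)
      have h2 := hstr t (s + 1) (by omega) (by omega)
      refine ⟨(hR t (by omega)).1.mono ?_, fun S O i hi => ?_⟩
      · rintro x ⟨j, hj, hj1, hj2⟩
        obtain ⟨o1, o2, o3⟩ := e_other j hj (by omega) (by omega)
        exact ⟨j, by omega, by rw [o1, hj1], by rw [o2, o3, hj2]⟩
      · rw [hev, (hR t (by omega)).2 _ _ i hi]
        have h3 : v.st t ≠ r.mid := by omega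
        have h4 : v.st t ≠ r.l := by omega
        simp only [MergeRec.splitPos, MergeRec.splitSeed, if_neg h3, if_neg h4, ite_self]
    · have hcA : childSeed r.lam 1 ((r.q : ℝ) / r.e) = childSeed r.lam r.e r.q := by
        funext x
        rw [← childSeed_mul eposr.ne', mul_one, mul_div_cancel₀ _ eposr.ne']
      have hcB : childSeed r.lam ((r.p : ℝ) / r.d) 1 = childSeed r.lam r.p r.d := by
        funext x
        rw [← childSeed_mul dposr.ne', mul_one, mul_div_cancel₀ _ dposr.ne']
      have hTA' : 0 < r.lam * r.e + (1 - r.lam) * r.q := by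
        have : r.lam * r.e + (1 - r.lam) * r.q = (r.L * r.e + r.M * r.q) / (r.L + r.M) := by
          rw [hlam]; field_simp; ring
        rw [this]; positivity
      have hTB' : 0 < r.lam * r.p + (1 - r.lam) * r.d := by
        have : r.lam * r.p + (1 - r.lam) * r.d = (r.L * r.p + r.M * r.d) / (r.L + r.M) := by
          rw [hlam]; field_simp; ring
        rw [this]; positivity
      have hA := (hR t (by omega)).1
      have hB := (hR (t + 1) (by omega)).1
      rw [← rl, ← rmid] at hA
      rw [← rmid, show v.st (t + 1 + 1) = r.hi from rhi.symm] at hB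
      have hB' := hB
      rw [show r.mid = r.l + (r.mid - r.l) by omega] at hB'
      rw [show r.hi - (r.l + (r.mid - r.l)) = r.hi - r.mid by omega] at hB'
      rw [hst _ le_rfl, hst', ← hik, ← rl, Function.update_self,
        show r.hi - r.l = (r.mid - r.l) + (r.hi - r.mid) by omega]
      refine ⟨hA.merge hB' hP.symm ?_ (by omega) (by omega) (by positivity) (by positivity)
        lam0 lam1.le TA TB ?_ ?_ ?_ ?_ ?_, fun S O i hi => ?_⟩
      · rw [show r.l + (r.mid - r.l) = r.mid by omega]; exact hQ.symm
      · push_cast [Nat.cast_sub l1.le, Nat.cast_sub l2.le]; exact cA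
      · push_cast [Nat.cast_sub l1.le, Nat.cast_sub l2.le]; exact cB
      · refine ⟨v.cnt, by omega, e_new.2.2, ?_⟩
        rw [e_new.1, e_new.2.1, hlam]; push_cast; rfl
      · rintro x ⟨j, hj, hj1, rfl⟩
        obtain ⟨o1, o2, o3⟩ := e_left j hj hj1
        have hx := h.xlt j hj
        have hxd : (0 : ℝ) < v.xd j := by exact_mod_cast (by omega : 0 < v.xd j)
        refine ⟨_, ⟨j, by omega, o1, rfl⟩, ?_⟩
        rw [o2, o3, ← (parentSeed_natCast hgood.LM_pos WA' hx).1, hcA]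
        exact (childSeed_parentSeed hTA' lam0 lam1.le (by positivity) (by positivity)
          (by positivity) (by rw [div_lt_one hxd]; exact_mod_cast hx)).1
      · rintro x ⟨j, hj, hj1, rfl⟩
        rw [show r.l + (r.mid - r.l) = r.mid by omega] at hj1
        obtain ⟨o1, o2, o3⟩ := e_right j hj hj1
        have hx := h.xlt j hj
        have hxd : (0 : ℝ) < v.xd j := by exact_mod_cast (by omega : 0 < v.xd j)
        refine ⟨_, ⟨j, by omega, o1, rfl⟩, ?_⟩
        rw [o2, o3, ← (parentSeed_natCast hgood.LM_pos WB' hx).1, hcB]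
        exact (childSeed_parentSeed hTB' lam0 lam1.le (by positivity) (by positivity)
          (by positivity) (by rw [div_lt_one hxd]; exact_mod_cast hx)).1
      · rw [hev, mergeOrder, hcA, hcB]
        have hne : r.l ≠ r.mid := by omega
        by_cases hi' : i < r.mid - r.l
        · have h5 := (hR t (by omega)).2 (r.splitSeed S) (r.splitPos S O) i (by omega)
          rw [← rl] at h5
          rw [h5, if_pos hi']
          simp only [MergeRec.splitPos, MergeRec.splitSeed, if_neg hne, if_true]
          split_ifs <;> omega
        · have h5 := (hR (t + 1) (by omega)).2 (r.splitSeed S) (r.splitPos S O)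
            (i - (r.mid - r.l)) (by
              rw [show v.st (t + 1 + 1) = r.hi from rhi.symm, ← rmid]; omega)
          rw [← rmid, show r.mid + (i - (r.mid - r.l)) = r.l + i by omega] at h5
          rw [h5, if_neg hi']
          simp only [MergeRec.splitPos, MergeRec.splitSeed, if_true]
          split_ifs <;> omega

theorem PavaInv.exists_block (h : PavaInv z n B pn pd v) {i : ℕ} (hi : i < v.k) :
    ∃ t < v.sp, v.st t ≤ i ∧ i < v.st (t + 1) := by
  have : ∀ t ≤ v.sp, i < v.st t → ∃ t < v.sp, v.st t ≤ i ∧ i < v.st (t + 1) := by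
    intro t
    induction t with
    | zero => intro _ h'; rw [h.st_zero] at h'; omega
    | succ t ih =>
      intro ht h'
      by_cases h2 : i < v.st t
      · exact ih (by omega) h2
      · exact ⟨t, by omega, not_lt.mp h2, h'⟩
  exact this v.sp le_rfl (by rw [h.st_sp]; exact hi)

/-- The order of the agents at the seed `s`. -/
noncomputable def PavaView.order (v : PavaView) (s : ℝ) : ℕ → ℕ :=
  evalPos v.recs v.cnt (fun _ => s) fun i => i

/-- Undoing the merges permutes each block of the final stack within itself, because initially every
block starts at its own index. -/
theorem PavaInv.order_block (h : PavaInv z n B pn pd v) (s : ℝ) {t : ℕ} (ht : t < v.sp) {i : ℕ}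
    (h1 : v.st t ≤ i) (h2 : i < v.st (t + 1)) :
    v.st t ≤ v.order s i ∧ v.order s i < v.st (t + 1) := by
  obtain ⟨R, hR⟩ := h.blocks
  have e := (hR t ht).2 (fun _ => s) (fun i => i) (i - v.st t) (by omega)
  have e2 := (hR t ht).1.lt s (i - v.st t) (by omega)
  rw [Nat.add_sub_cancel' h1] at e
  unfold PavaView.order
  omega

theorem PavaInv.order_lt (h : PavaInv z n B pn pd v) (s : ℝ) {i : ℕ} (hi : i < v.k) :
    v.order s i < v.k := by
  obtain ⟨t, ht, h1, h2⟩ := h.exists_block hi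
  have := h.st_le (show t + 1 ≤ v.sp from ht) le_rfl
  have := h.st_sp
  have := h.order_block s ht h1 h2
  omega

theorem PavaInv.order_inj (h : PavaInv z n B pn pd v) (s : ℝ) {i j : ℕ} (hi : i < v.k)
    (hj : j < v.k) (hij : v.order s i = v.order s j) : i = j := by
  obtain ⟨t, ht, h1, h2⟩ := h.exists_block hi
  obtain ⟨t', ht', h1', h2'⟩ := h.exists_block hj
  have b := h.order_block s ht h1 h2
  have b' := h.order_block s ht' h1' h2'
  rcases lt_trichotomy t t' with hlt | rfl | hlt
  · have := h.st_le (show t + 1 ≤ t' from hlt) ht'.le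
    omega
  · obtain ⟨R, hR⟩ := h.blocks
    have e := (hR t ht).2 (fun _ => s) (fun i => i) (i - v.st t) (by omega)
    have e' := (hR t ht).2 (fun _ => s) (fun i => i) (j - v.st t) (by omega)
    rw [Nat.add_sub_cancel' h1] at e
    rw [Nat.add_sub_cancel' h1'] at e'
    have := (hR t ht).1.inj s (i - v.st t) (j - v.st t) (by omega) (by omega) (by
      unfold PavaView.order at hij; omega)
    omega
  · have := h.st_le (show t' + 1 ≤ t from hlt) ht.le
    omega

/-- All blocks use the same seed. The blocks before an agent contribute the constant factor
`noneProb z 0 (st t)`, those after her contribute nothing, and the average over her own block is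
known from `EqualizesBlock`. -/
theorem PavaInv.tight (hd : SortedData z n B pn pd) (h : PavaInv z n B pn pd v) (hk : v.k = n)
    (hM : 2 ≤ v.sp → (v.recAt (v.sp - 2)).M = 0) {K : ℕ} {b : ℕ → ℝ} (hb0 : b 0 = 0)
    (hbK : b K = 1) (hb : ∀ j < K, b j ≤ b (j + 1))
    (hgrid : ∀ i < v.cnt, ∀ j < K, b j < (v.xn i : ℝ) / v.xd i → b (j + 1) ≤ (v.xn i : ℝ) / v.xd i)
    {X : ℕ → ℝ} (hX : ∀ i < n, X i =
      ∑ j ∈ Finset.range K, (b (j + 1) - b j) * blockUtil z 0 n (v.order (b j)) i) :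
    (∀ i, i + 1 < n → X i ≤ X (i + 1)) ∧ ∀ i < n, (i + 1 < n ∧ X i = X (i + 1)) ∨
      ∑ j ∈ Finset.range (i + 1), X j = 1 - noneProb z 0 (i + 1) := by
  obtain ⟨R, hR⟩ := h.blocks
  refine tight_of_blocks (sp := v.sp) h.st_zero (h.st_sp.trans hk) h.st_lt
    (fun j hj => hd.z_le_one hj) (fun t ht i h1 h2 => ?_) fun t ht => ?_
  · have hin : v.st (t + 1) ≤ n := h.st_le_n ht
    have hu := (hR t ht).1.util K b hb0 hbK hb
      (fun x ⟨i, hi, _, hx⟩ j hj => by rw [hx]; exact hgrid i hi j hj) (i - v.st t) (by omega)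
    rw [hX i (by omega), ← hu, mul_left_comm]
    congr 1
    rw [Finset.mul_sum]
    refine Finset.sum_congr rfl fun j _ => ?_
    rw [mul_left_comm]
    congr 1
    obtain ⟨c, hc⟩ := Nat.exists_eq_add_of_le hin
    have hn : n = v.st t + (v.st (t + 1) - v.st t) + c := by
      have := h.st_lt t ht; omega
    have hOi := h.order_block (b j) ht h1 h2
    have hO : ∀ k < v.st (t + 1) - v.st t, v.order (b j) (v.st t + k) = v.st t + R t (b j) k :=
      fun k hk => (hR t ht).2 _ _ k hk
    unfold blockUtil
    rw [zero_add, Nat.add_sub_cancel' h1, mul_left_comm]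
    congr 1
    rw [hn, Finset.prod_range_add, Finset.prod_range_add]
    -- Earlier blocks always come first.
    have f1 : ∏ x ∈ Finset.range (v.st t),
        (if v.order (b j) x < v.order (b j) i then 1 - z (0 + x) else 1) =
        noneProb z 0 (v.st t) := by
      refine Finset.prod_congr rfl fun x hx => if_pos ?_
      rw [Finset.mem_range] at hx
      obtain ⟨t', ht', h1', h2'⟩ := h.exists_block (i := x) (by omega)
      have hlt : t' < t := by
        by_contra hge
        have := h.st_le (not_lt.mp hge) ht'.le
        omega
      have := h.order_block (b j) ht' h1' h2'
      have := h.st_le (show t' + 1 ≤ t from hlt) ht.le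
      omega
    -- Later blocks never come first.
    have f2 : ∏ x ∈ Finset.range c,
        (if v.order (b j) (v.st t + (v.st (t + 1) - v.st t) + x) < v.order (b j) i
          then 1 - z (0 + (v.st t + (v.st (t + 1) - v.st t) + x)) else 1) = 1 := by
      refine Finset.prod_eq_one fun x hx => if_neg ?_
      rw [Finset.mem_range] at hx
      set y := v.st t + (v.st (t + 1) - v.st t) + x with hy
      obtain ⟨t', ht', h1', h2'⟩ := h.exists_block (i := y) (by omega)
      have hlt : t < t' := by
        by_contra hge
        have := h.st_le (show t' + 1 ≤ t + 1 by omega) ht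
        omega
      have := h.order_block (b j) ht' h1' h2'
      have := h.st_le (show t + 1 ≤ t' from hlt) ht'.le
      omega
    rw [f1, f2, mul_one]
    congr 1
    refine Finset.prod_congr rfl fun x hx => ?_
    rw [Finset.mem_range] at hx
    have hi' := hO (i - v.st t) (by omega)
    rw [Nat.add_sub_cancel' h1] at hi'
    rw [hO x hx, hi', zero_add]
    simp only [add_lt_add_iff_left]
  · obtain ⟨⟨l1, l2, l3⟩, ⟨pd1, dpos, dB⟩, ⟨qe1, epos, eB⟩, hP, hQ, hMr, hLr⟩ :=
      h.recAt_spec hd (t := t) (by omega) rfl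
    -- The invariant covers all adjacent pairs but the topmost one, for which `hM` is assumed.
    have hM0 : (v.recAt t).M = 0 := by
      rcases Nat.lt_or_ge (t + 2) v.sp with h1 | h1
      · exact h.noMerge t h1
      · obtain rfl : t = v.sp - 2 := by omega
        exact hM (by omega)
    have hle : ((v.recAt t).e : ℝ) * ((v.recAt t).hi - (v.recAt t).mid) *
        ((v.recAt t).d - (v.recAt t).p) ≤ ((v.recAt t).mid - (v.recAt t).l) * (v.recAt t).p *
          ((v.recAt t).e - (v.recAt t).q) := by
      rcases hMr with h1 | h1
      · rw [hM0, Nat.cast_zero] at h1; linarith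
      · exact h1.2
    rw [show v.st t = (v.recAt t).l from rfl, show v.st (t + 1) = (v.recAt t).mid from rfl,
      show v.st (t + 2) = (v.recAt t).hi from rfl, hP, hQ]
    generalize v.recAt t = r at *
    have d0 : (0 : ℝ) < r.d := by exact_mod_cast dpos
    have e0 : (0 : ℝ) < r.e := by exact_mod_cast epos
    rw [Nat.cast_sub l1.le, Nat.cast_sub l2.le]
    field_simp
    linarith

end Inv

end FairSelection

/-! ### Sorting fractions by counting. -/

namespace FairSelection

/-- The lexicographic order of the fractions `N j / D j` and the indices `j`. -/
def Before (N D : ℕ → ℕ) (j i : ℕ) : Prop :=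
  N j * D i < N i * D j ∨ N j * D i = N i * D j ∧ j < i

instance (N D : ℕ → ℕ) (j i : ℕ) : Decidable (Before N D j i) := by
  unfold Before; infer_instance

/-- The position of `i` when the indices less than `n` are sorted. -/
def rankOf (N D : ℕ → ℕ) (n i : ℕ) : ℕ := ((Finset.range n).filter fun j => Before N D j i).card

theorem rankOf_lt {N D : ℕ → ℕ} {n i : ℕ} (hi : i < n) : rankOf N D n i < n := by
  have : (Finset.range n).filter (fun j => Before N D j i) ⊂ Finset.range n := by
    refine Finset.filter_ssubset.mpr ⟨i, Finset.mem_range.mpr hi, ?_⟩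
    simp [Before]
  simpa [rankOf] using Finset.card_lt_card this

/-- Cross multiplication is transitive for positive denominators; a tie between the outer fractions
forces ties with the middle one, so the index comparison is transitive as well. -/
theorem Before.trans {N D : ℕ → ℕ} {i j k : ℕ} (hi : 0 < D i) (hj : 0 < D j) (hk : 0 < D k)
    (h1 : Before N D i j) (h2 : Before N D j k) : Before N D i k := by
  have key : N i * D j ≤ N j * D i → N j * D k ≤ N k * D j → N i * D k ≤ N k * D i ∧
      (N i * D k = N k * D i → N i * D j = N j * D i ∧ N j * D k = N k * D j) := by
    intro a b
    have a' : N i * D k * D j ≤ N j * D k * D i := by nlinarith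
    have b' : N j * D k * D i ≤ N k * D i * D j := by nlinarith
    refine ⟨Nat.le_of_mul_le_mul_right (a'.trans b') hj, fun h => ?_⟩
    rw [h] at a'
    have c := le_antisymm a' b'
    constructor
    · apply Nat.eq_of_mul_eq_mul_right hk
      nlinarith
    · apply Nat.eq_of_mul_eq_mul_right hi
      nlinarith
  unfold Before at *
  obtain ⟨k1, k2⟩ := key (by omega) (by omega)
  rcases k1.lt_or_eq with h | h
  · exact .inl h
  · exact .inr ⟨h, by have := k2 h; omega⟩

theorem rankOf_lt_rankOf {N D : ℕ → ℕ} {n i j : ℕ} (hD : ∀ i < n, 0 < D i) (hi : i < n)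
    (hj : j < n) (h : Before N D i j) : rankOf N D n i < rankOf N D n j := by
  refine Finset.card_lt_card ⟨fun k hk => ?_, fun hsub => ?_⟩
  · rw [Finset.mem_filter, Finset.mem_range] at hk ⊢
    exact ⟨hk.1, hk.2.trans (hD k hk.1) (hD i hi) (hD j hj) h⟩
  · have := hsub (Finset.mem_filter.mpr ⟨Finset.mem_range.mpr hi, h⟩)
    rw [Finset.mem_filter, Before] at this
    omega

theorem rankOf_ne {N D : ℕ → ℕ} {n i j : ℕ} (hD : ∀ i < n, 0 < D i) (hi : i < n) (hj : j < n)
    (h : i ≠ j) : rankOf N D n i ≠ rankOf N D n j := by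
  have : Before N D i j ∨ Before N D j i := by
    unfold Before
    omega
  rcases this with h | h
  · exact (rankOf_lt_rankOf hD hi hj h).ne
  · exact (rankOf_lt_rankOf hD hj hi h).ne'

/-- The array `a` lists the indices less than `n` in increasing order of the fractions `N / D`. -/
structure SortsFractions (N D : ℕ → ℕ) (n : ℕ) (a : ℕ → ℕ) : Prop where
  lt : ∀ r < n, a r < n
  inj : ∀ r < n, ∀ r' < n, a r = a r' → r = r'
  surj : ∀ i < n, ∃ r < n, a r = i
  mono : ∀ r r', r ≤ r' → r' < n → N (a r) * D (a r') ≤ N (a r') * D (a r)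

/-- Ranks are distinct and less than `n`, hence a bijection, and an array inverse to the ranks lists
the fractions in order. Ties are broken by the index, so equal fractions cause no collision. -/
theorem sortsFractions_of_rankOf {N D : ℕ → ℕ} {n : ℕ} {a : ℕ → ℕ} (hD : ∀ i < n, 0 < D i)
    (ha : ∀ i < n, a (rankOf N D n i) = i) : SortsFractions N D n a := by
  have hinj : Set.InjOn (rankOf N D n) (Finset.range n : Set ℕ) := by
    intro i hi j hj hij
    rw [Finset.coe_range, Set.mem_Iio] at hi hj
    rw [← ha i hi, ← ha j hj, hij]
  have hsurj : ∀ r < n, ∃ i < n, rankOf N D n i = r := by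
    intro r hr
    have := Finset.surj_on_of_inj_on_of_card_le (s := Finset.range n) (t := Finset.range n)
      (fun i _ => rankOf N D n i)
      (fun i hi => Finset.mem_range.mpr (rankOf_lt (Finset.mem_range.mp hi)))
      (fun i j hi hj hij => hinj (by simpa using hi) (by simpa using hj) hij) le_rfl r
      (Finset.mem_range.mpr hr)
    obtain ⟨i, hi, h⟩ := this
    exact ⟨i, Finset.mem_range.mp hi, h.symm⟩
  have hrank : ∀ r < n, a r < n ∧ rankOf N D n (a r) = r := by
    intro r hr
    obtain ⟨i, hi, rfl⟩ := hsurj r hr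
    rw [ha i hi]
    exact ⟨hi, rfl⟩
  refine ⟨fun r hr => (hrank r hr).1, fun r hr r' hr' h => ?_,
    fun i hi => ⟨_, rankOf_lt hi, ha i hi⟩, fun r r' hrr hr' => ?_⟩
  · rw [← (hrank r hr).2, h, (hrank r' hr').2]
  · by_contra hc
    have h1 := hrank r (by omega)
    have h2 := hrank r' hr'
    have := rankOf_lt_rankOf hD h2.1 h1.1 (.inl (not_le.mp hc))
    omega

end FairSelection

/-! ### The sorting program. -/

namespace LogRam

instance : Add Expr := ⟨.add⟩
instance : Sub Expr := ⟨.sub⟩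
instance : Mul Expr := ⟨.mul⟩

infixr:35 " ;; " => Prog.seq

section Simp

variable (s : State)

theorem Expr.eval_add (e₁ e₂ : Expr) : (e₁ + e₂).eval s = e₁.eval s + e₂.eval s := rfl
theorem Expr.eval_sub (e₁ e₂ : Expr) : (e₁ - e₂).eval s = e₁.eval s - e₂.eval s := rfl
theorem Expr.eval_mul (e₁ e₂ : Expr) : (e₁ * e₂).eval s = e₁.eval s * e₂.eval s := rfl
theorem Expr.eval_get (a : ℕ) (i : Expr) : (Expr.get a i).eval s = s.mem a (i.eval s) := rfl
theorem Expr.eval_const (k : ℕ) : (Expr.const k).eval s = k := rfl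

theorem State.set_mem_self (a i x : ℕ) : (s.set a i x).mem a = Function.update (s.mem a) i x := by
  funext j
  simp [State.set, Function.update_apply]

theorem State.set_mem_of_ne {a b : ℕ} (h : b ≠ a) (i x : ℕ) : (s.set a i x).mem b = s.mem b := by
  funext j
  simp [State.set, h]

theorem State.set_out (a i x : ℕ) : (s.set a i x).out = s.out := rfl

end Simp

/-- Makes the current memory bound available, so that copying an entry needs no separate estimate.
-/
theorem WP.of_memBdd {b H : ℕ} {c : Prog} {Q : State → Prop} {s : State}
    (h : MemBdd b s → WP b H c Q s) : WP b H c Q s := fun hb => h hb hb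

/-- The states `s` and `s'` have the same output, and differ at most in the arrays in `l`. -/
def Frame (l : List ℕ) (s s' : State) : Prop :=
  (∀ a, a ∉ l → s'.mem a = s.mem a) ∧ s'.out = s.out

theorem Frame.refl (l : List ℕ) (s : State) : Frame l s s := ⟨fun _ _ => rfl, rfl⟩

theorem Frame.trans {l : List ℕ} {s s' s'' : State} (h : Frame l s s') (h' : Frame l s' s'') :
    Frame l s s'' :=
  ⟨fun a ha => (h'.1 a ha).trans (h.1 a ha), h'.2.trans h.2⟩

theorem Frame.mono {l l' : List ℕ} {s s' : State} (h : Frame l s s') (hl : l ⊆ l') :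
    Frame l' s s' :=
  ⟨fun a ha => h.1 a fun h' => ha (hl h'), h.2⟩

theorem Frame.set {l : List ℕ} {s s' : State} (h : Frame l s s') {a : ℕ} (ha : a ∈ l) (i x : ℕ) :
    Frame l s (s'.set a i x) :=
  ⟨fun c hc => by
    rw [State.set_mem_of_ne _ (by rintro rfl; exact hc ha)]
    exact h.1 c hc, h.2⟩

theorem Frame.mem {l : List ℕ} {s s' : State} (h : Frame l s s') {a : ℕ} (ha : a ∉ l) :
    s'.mem a = s.mem a := h.1 a ha

/-- Stores in the array `out` the indices of the fractions with numerators `na` and denominators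
`da` in increasing order, where the number of fractions is in the scalar variable `nv`. -/
def rankSort (na da nv out : ℕ) : Prog :=
  .forRange 20 (.var nv) (
    .assign 22 (.const 0) ;;
    .forRange 21 (.var nv) (
      .ite (.get na (.var 20) * .get da (.var 21) - .get na (.var 21) * .get da (.var 20))
        (.assign 22 (.var 22 + .const 1))
        (.ite (.get na (.var 21) * .get da (.var 20) - .get na (.var 20) * .get da (.var 21))
          .skip
          (.ite (.var 20 - .var 21) (.assign 22 (.var 22 + .const 1)) .skip))) ;;
    .store out (.var 22) (.var 20))

open FairSelection in
theorem WP.rankSort {b H na da nv out n : ℕ} {Q : State → Prop} {s : State}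
    (hna : na ∉ [20, 21, 22, out]) (hda : da ∉ [20, 21, 22, out]) (hnv : nv ∉ [20, 21, 22, out])
    (hout : out ∉ [20, 21, 22]) (hn : s.mem nv 0 = n) (hnH : n ≤ H) (hnb : n < 2 ^ b)
    (hD : ∀ i < n, 0 < s.mem da i)
    (hQ : ∀ s', Frame [20, 21, 22, out] s s' →
      SortsFractions (s.mem na) (s.mem da) n (s'.mem out) → Q s') :
    WP b H (rankSort na da nv out) Q s := by
  have hmem : ∀ {s' : State}, Frame [20, 21, 22, out] s s' → s'.mem na = s.mem na ∧
      s'.mem da = s.mem da ∧ s'.mem nv 0 = n := fun h =>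
    ⟨h.mem hna, h.mem hda, by rw [h.mem hnv, hn]⟩
  simp only [List.mem_cons, not_or, List.not_mem_nil, not_false_eq_true, and_true] at hout
  obtain ⟨o1, o2, o3⟩ := hout
  refine .forRange n hnH hnb (fun i s' => Frame [20, 21, 22, out] s s' ∧ s'.mem 20 0 = i ∧
    ∀ j < i, s'.mem out (rankOf (s.mem na) (s.mem da) n j) = j) ?_ ?_ ?_ ?_
  · refine ⟨(Frame.refl _ _).set (by simp) _ _, ?_, fun j hj => by omega⟩
    simp [State.set_mem_self]
  · rintro i - s' ⟨hf, h1, -⟩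
    exact ⟨h1, (hmem hf).2.2⟩
  · rintro i hi s1 ⟨hf, h1, h2⟩
    refine .seq (.store (by simp [Expr.eval_const]) ?_)
    -- The counter holds the rank of `i` among the first `j` fractions.
    refine .seq (.forRange n hnH hnb (fun j s' => Frame [20, 21, 22, out] s s' ∧ s'.mem 20 0 = i ∧
      s'.mem 21 0 = j ∧ s'.mem 22 0 = rankOf (s.mem na) (s.mem da) j i ∧
      s'.mem out = s1.mem out) ?_ ?_ ?_ ?_)
    · refine ⟨(hf.set (by simp) _ _).set (by simp) _ _, ?_, ?_, ?_, ?_⟩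
      · simp [State.set_mem_of_ne, h1]
      · simp [State.set_mem_self]
      · simp [State.set_mem_of_ne, State.set_mem_self, Expr.eval_const, rankOf]
      · simp [State.set_mem_of_ne, o2, o3]
    · rintro j - s' ⟨hf', -, h3, -⟩
      exact ⟨h3, (hmem hf').2.2⟩
    · rintro j hj s2 ⟨hf2, h3, h4, h5, h6⟩
      obtain ⟨m1, m2, m3⟩ := hmem hf2
      have hle : rankOf (s.mem na) (s.mem da) j i < 2 ^ b - 1 := by
        have : rankOf (s.mem na) (s.mem da) j i ≤ j :=
          (Finset.card_filter_le _ _).trans_eq (Finset.card_range j)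
        omega
      have hyes : Before (s.mem na) (s.mem da) j i →
          rankOf (s.mem na) (s.mem da) (j + 1) i = rankOf (s.mem na) (s.mem da) j i + 1 := by
        intro h
        rw [rankOf, Finset.range_add_one, Finset.filter_insert, if_pos h,
          Finset.card_insert_of_notMem (by simp)]
        rfl
      have hno : ¬ Before (s.mem na) (s.mem da) j i →
          rankOf (s.mem na) (s.mem da) (j + 1) i = rankOf (s.mem na) (s.mem da) j i := by
        intro h
        rw [rankOf, Finset.range_add_one, Finset.filter_insert, if_neg h]
        rfl
      have hinc : Before (s.mem na) (s.mem da) j i → WP b H (.assign 22 (.var 22 + .const 1))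
          (fun s' => s'.mem 21 0 = j ∧ Frame [20, 21, 22, out] s (s'.set 21 0 (j + 1)) ∧
            (s'.set 21 0 (j + 1)).mem 20 0 = i ∧ (s'.set 21 0 (j + 1)).mem 21 0 = j + 1 ∧
            (s'.set 21 0 (j + 1)).mem 22 0 = rankOf (s.mem na) (s.mem da) (j + 1) i ∧
            (s'.set 21 0 (j + 1)).mem out = s1.mem out) s2 := by
        intro h
        refine .store ?_ ⟨?_, (hf2.set (by simp) _ _).set (by simp) _ _, ?_, ?_, ?_, ?_⟩
        · simp only [Expr.eval_add, Expr.eval_get, Expr.eval_const, h5]; omega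
        · simp [State.set_mem_of_ne, h4]
        · simp [State.set_mem_of_ne, h3]
        · simp [State.set_mem_self]
        · simp [State.set_mem_of_ne, State.set_mem_self, Expr.eval_add, Expr.eval_get,
            Expr.eval_const, h5, hyes h]
        · simp [State.set_mem_of_ne, o2, o3, h6]
      have hskip : ¬ Before (s.mem na) (s.mem da) j i → WP b H .skip
          (fun s' => s'.mem 21 0 = j ∧ Frame [20, 21, 22, out] s (s'.set 21 0 (j + 1)) ∧
            (s'.set 21 0 (j + 1)).mem 20 0 = i ∧ (s'.set 21 0 (j + 1)).mem 21 0 = j + 1 ∧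
            (s'.set 21 0 (j + 1)).mem 22 0 = rankOf (s.mem na) (s.mem da) (j + 1) i ∧
            (s'.set 21 0 (j + 1)).mem out = s1.mem out) s2 := by
        intro h
        refine .skip ⟨h4, hf2.set (by simp) _ _, ?_, ?_, ?_, ?_⟩
        · simp [State.set_mem_of_ne, h3]
        · simp [State.set_mem_self]
        · simp [State.set_mem_of_ne, h5, hno h]
        · simp [State.set_mem_of_ne, o2, h6]
      refine .ite (fun hc => hinc ?_) fun hc => .ite (fun hc' => hskip ?_) fun hc' =>
        .ite (fun hc'' => hinc ?_) fun hc'' => hskip ?_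
      all_goals
        simp only [Expr.eval_sub, Expr.eval_mul, Expr.eval_get, Expr.eval_const, h3, h4, m1,
          m2, Before] at *
        omega
    · rintro s2 ⟨hf2, h3, h4, h5, h6⟩
      have hr := rankOf_lt (N := s.mem na) (D := s.mem da) hi
      refine .store ?_ ⟨?_, (hf2.set (by simp) _ _).set (by simp) _ _, ?_, ?_⟩
      · simp only [Expr.eval_get, Expr.eval_const, h3]; omega
      · simp [State.set_mem_of_ne, h3, Ne.symm o1]
      · simp [State.set_mem_self]
      · intro j hj
        simp only [Expr.eval_get, Expr.eval_const, h3, h5]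
        rw [State.set_mem_of_ne _ o1, State.set_mem_self, h6]
        rcases Nat.lt_succ_iff_lt_or_eq.mp hj with h | rfl
        -- Distinct ranks, so entries written earlier are not overwritten.
        · rw [Function.update_of_ne (rankOf_ne hD (by omega) hi h.ne), h2 j h]
        · rw [Function.update_self]
  · rintro s' ⟨hf, -, h⟩
    exact hQ s' hf (sortsFractions_of_rankOf hD h)

end LogRam

/-! ### The pooling program. -/

namespace LogRam

open FairSelection

theorem WP.fill {b H v a n : ℕ} {N e : Expr} {Q : State → Prop} {s : State} (f : ℕ → ℕ)
    (hva : v ≠ a) (hnH : n ≤ H) (hnb : n < 2 ^ b)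
    (hN : ∀ s', Frame [v, a] s s' → N.eval s' = n)
    (he : ∀ i < n, ∀ s', Frame [v, a] s s' → s'.mem v 0 = i → e.eval s' = f i)
    (hf : ∀ i < n, f i < 2 ^ b)
    (hQ : ∀ s', Frame [v, a] s s' → (∀ i < n, s'.mem a i = f i) → Q s') :
    WP b H (.forRange v N (.store a (.var v) e)) Q s := by
  refine .forRange n hnH hnb (fun i s' => Frame [v, a] s s' ∧ s'.mem v 0 = i ∧
    ∀ j < i, s'.mem a j = f j) ?_ ?_ ?_ ?_
  · refine ⟨(Frame.refl _ _).set (by simp) _ _, ?_, fun j hj => by omega⟩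
    simp [State.set_mem_self]
  · rintro i - s' ⟨hfr, h1, -⟩
    exact ⟨h1, hN s' hfr⟩
  · rintro i hi s' ⟨hfr, h1, h2⟩
    have he' := he i hi s' hfr h1
    refine .store (he' ▸ hf i hi) ⟨?_, (hfr.set (by simp) _ _).set (by simp) _ _, ?_, ?_⟩
    · rw [State.set_mem_of_ne _ hva, h1]
    · simp [State.set_mem_self]
    · intro j hj
      rw [State.set_mem_of_ne _ hva.symm, State.set_mem_self, Expr.eval_get, Expr.eval_const, h1,
        he']
      rcases Nat.lt_succ_iff_lt_or_eq.mp hj with h | rfl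
      · rw [Function.update_of_ne h.ne, h2 j h]
      · rw [Function.update_self]
  · rintro s' ⟨hfr, -, h⟩
    exact hQ s' hfr h

/-- The parameter in the array `a` of the current merge. -/
abbrev Expr.cur (a : ℕ) : Expr := .get a (.var 35)

/-- Records the parameters of a merge of the two topmost blocks. -/
def recordTop : Prog :=
  .store 46 (.var 35) (.get 8 (.var 23 - .const 2)) ;;
  .store 47 (.var 35) (.get 8 (.var 23 - .const 1)) ;;
  .store 48 (.var 35) (.get 8 (.var 23)) ;;
  .store 42 (.var 35) (.get 9 (.var 23 - .const 2)) ;;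
  .store 43 (.var 35) (.get 10 (.var 23 - .const 2)) ;;
  .store 44 (.var 35) (.get 9 (.var 23 - .const 1)) ;;
  .store 45 (.var 35) (.get 10 (.var 23 - .const 1)) ;;
  .store 40 (.var 35) (.cur 43 * (.cur 47 - .cur 46) * (.cur 45 - .cur 44) -
    (.cur 48 - .cur 47) * .cur 44 * (.cur 43 - .cur 42)) ;;
  .store 41 (.var 35) (.cur 45 * (.cur 48 - .cur 47) * (.cur 43 - .cur 42) -
    (.cur 47 - .cur 46) * .cur 42 * (.cur 45 - .cur 44))

/-- Moves the breakpoint with index `j`, where `j` is in the scalar variable `21`, from a part to the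
merged block. The speeds in the part are in the arrays `xa` and `ya`. -/
def moveBreakpoint (xa ya : ℕ) : Prog :=
  .ite (.get 51 (.var 21) * (.cur 40 * .cur xa) -
      .get 50 (.var 21) * (.cur 40 * .cur xa + .cur 41 * .cur ya))
    (.store 50 (.var 21) (.get 50 (.var 21) * (.cur 40 * .cur xa + .cur 41 * .cur ya)) ;;
      .store 51 (.var 21) (.get 51 (.var 21) * ((.cur 40 + .cur 41) * .cur xa)))
    (.store 50 (.var 21) (.get 51 (.var 21) * ((.cur 40 + .cur 41) * .cur ya) -
        (.get 51 (.var 21) - .get 50 (.var 21)) * (.cur 40 * .cur xa + .cur 41 * .cur ya)) ;;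
      .store 51 (.var 21) (.get 51 (.var 21) * ((.cur 40 + .cur 41) * .cur ya))) ;;
  .store 52 (.var 21) (.cur 46)

/-- Moves all breakpoints of the two topmost blocks to the merged block. -/
def moveBreakpoints : Prog :=
  .forRange 21 (.var 35) (
    .ite ((.get 52 (.var 21) - .cur 46) + (.cur 46 - .get 52 (.var 21)))
      (.ite ((.get 52 (.var 21) - .cur 47) + (.cur 47 - .get 52 (.var 21)))
        .skip (moveBreakpoint 42 43))
      (moveBreakpoint 45 44))

/-- Merges the two topmost blocks. -/
def mergeTop : Prog :=
  moveBreakpoints ;;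
  .store 50 (.var 35) (.cur 40) ;;
  .store 51 (.var 35) (.cur 40 + .cur 41) ;;
  .store 52 (.var 35) (.cur 46) ;;
  .store 9 (.var 23 - .const 2) (.cur 42 * .cur 44) ;;
  .store 10 (.var 23 - .const 2) (.cur 43 * .cur 45) ;;
  .assign 23 (.var 23 - .const 1) ;;
  .store 8 (.var 23) (.var 24) ;;
  .assign 35 (.var 35 + .const 1)

/-- Puts the next agent on the stack, as a block. -/
def pushNext : Prog :=
  .store 9 (.var 23) (.get 6 (.var 24)) ;;
  .store 10 (.var 23) (.get 7 (.var 24)) ;;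
  .assign 23 (.var 23 + .const 1) ;;
  .assign 24 (.var 24 + .const 1) ;;
  .store 8 (.var 23) (.var 24)

/-- One step of the algorithm that merges blocks. -/
def pavaStep : Prog :=
  .store 41 (.var 35) (.const 0) ;;
  .ite (.var 23 - .const 1) recordTop .skip ;;
  .ite (.cur 41) mergeTop (.ite (.var 2 - .var 24) pushNext .skip)

/-- Merges adjacent blocks until their average utilities increase. -/
def pava : Prog :=
  .assign 23 (.const 0) ;; .assign 24 (.const 0) ;; .assign 35 (.const 0) ;;
  .store 8 (.const 0) (.const 0) ;;
  .forRange 20 (.var 2 + .var 2) pavaStep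

/-- The merges recorded in a state. -/
def recsOf (s : State) (j : ℕ) : MergeRec where
  L := s.mem 40 j
  M := s.mem 41 j
  p := s.mem 42 j
  d := s.mem 43 j
  q := s.mem 44 j
  e := s.mem 45 j
  l := s.mem 46 j
  mid := s.mem 47 j
  hi := s.mem 48 j

/-- The data of the algorithm that merges blocks in a state. -/
def viewOf (s : State) : PavaView where
  sp := s.mem 23 0
  k := s.mem 24 0
  cnt := s.mem 35 0
  st := s.mem 8
  bp := s.mem 9
  bd := s.mem 10
  xn := s.mem 50
  xd := s.mem 51
  xr := s.mem 52
  recs := recsOf s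

/-- The arrays with the parameters of the merges. -/
abbrev recArrays : List ℕ := [40, 41, 42, 43, 44, 45, 46, 47, 48]

theorem WP.recordTop {b H : ℕ} {Q : State → Prop} {s : State} (hsp : 2 ≤ s.mem 23 0)
    (hL : ((viewOf s).recAt (s.mem 23 0 - 2)).L < 2 ^ b)
    (hM : ((viewOf s).recAt (s.mem 23 0 - 2)).M < 2 ^ b)
    (hQ : ∀ s', Frame recArrays s s' →
      recsOf s' (s.mem 35 0) = (viewOf s).recAt (s.mem 23 0 - 2) →
      (∀ j, j ≠ s.mem 35 0 → recsOf s' j = recsOf s j) → Q s') : WP b H recordTop Q s := by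
  refine .of_memBdd fun hb => ?_
  obtain ⟨t, ht⟩ : ∃ t, s.mem 23 0 = t + 2 := ⟨s.mem 23 0 - 2, by omega⟩
  simp only [PavaView.recAt, viewOf, ht, Nat.add_sub_cancel] at hL hM
  unfold LogRam.recordTop
  -- The first seven stores copy existing entries; only `L` and `M` are computed and need the bounds
  -- `hL` and `hM`.
  iterate 7
    refine .seq (.store ?_ ?_)
    · simp [Expr.eval_get, Expr.eval_sub, Expr.eval_const, State.set_mem_of_ne]
      exact hb _ _
  refine .seq (.store ?_ (.store ?_ (hQ _ ?_ ?_ ?_)))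
  · simpa [Expr.eval_get, Expr.eval_sub, Expr.eval_mul, Expr.eval_const, State.set_mem_of_ne,
      State.set_mem_self, ht] using hL
  · simpa [Expr.eval_get, Expr.eval_sub, Expr.eval_mul, Expr.eval_const, State.set_mem_of_ne,
      State.set_mem_self, ht] using hM
  · iterate 9 refine Frame.set ?_ (by simp) _ _
    exact Frame.refl _ _
  · simp [recsOf, PavaView.recAt, viewOf, Expr.eval_get, Expr.eval_sub, Expr.eval_mul,
      Expr.eval_const, State.set_mem_of_ne, State.set_mem_self, ht]
  · intro j hj
    simp [recsOf, Expr.eval_get, Expr.eval_const, State.set_mem_of_ne, State.set_mem_self, hj]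

/-- The numerator, the denominator and the block of a moved breakpoint. -/
def movedX (r : MergeRec) (x y u v : ℕ) : ℕ × ℕ × ℕ :=
  (if u * (r.L * x + r.M * y) < v * (r.L * x) then u * (r.L * x + r.M * y)
    else v * ((r.L + r.M) * y) - (v - u) * (r.L * x + r.M * y),
  if u * (r.L * x + r.M * y) < v * (r.L * x) then v * ((r.L + r.M) * x) else v * ((r.L + r.M) * y),
  r.l)

/-- The breakpoint with index `j` after a merge. -/
def newX (v : PavaView) (r : MergeRec) (j : ℕ) : ℕ × ℕ × ℕ :=
  if v.xr j = r.l then movedX r r.e r.q (v.xn j) (v.xd j)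
  else if v.xr j = r.mid then movedX r r.p r.d (v.xn j) (v.xd j)
  else (v.xn j, v.xd j, v.xr j)

theorem WP.moveBreakpoint {b H xa ya : ℕ} {Q : State → Prop} {s : State}
    (hxa : xa ∉ [50, 51]) (hya : ya ∉ [50, 51]) {T : ℕ × ℕ × ℕ}
    (hT : T = movedX (recsOf s (s.mem 35 0)) (s.mem xa (s.mem 35 0)) (s.mem ya (s.mem 35 0))
      (s.mem 50 (s.mem 21 0)) (s.mem 51 (s.mem 21 0)))
    (h1 : T.1 < 2 ^ b) (h2 : T.2.1 < 2 ^ b)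
    (hQ : ∀ s', Frame [50, 51, 52] s s' → s'.mem 50 = Function.update (s.mem 50) (s.mem 21 0) T.1 →
      s'.mem 51 = Function.update (s.mem 51) (s.mem 21 0) T.2.1 →
      s'.mem 52 = Function.update (s.mem 52) (s.mem 21 0) T.2.2 → Q s') :
    WP b H (moveBreakpoint xa ya) Q s := by
  simp only [List.mem_cons, List.not_mem_nil, or_false, not_or] at hxa hya
  refine .of_memBdd fun hb => ?_
  subst hT
  simp only [movedX, recsOf] at h1 h2 hQ
  refine .seq (.ite (fun hc => ?_) fun hc => ?_)
  all_goals
    simp only [Expr.eval_sub, Expr.eval_mul, Expr.eval_add, Expr.eval_get, Expr.eval_const,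
      ne_eq, Nat.sub_eq_zero_iff_le, not_le] at hc
  · simp only [hc, if_true] at h1 h2 hQ
    refine .seq (.store ?_ (.store ?_ (.store ?_ (hQ _ ?_ ?_ ?_ ?_))))
    rotate_left 3
    · exact (((Frame.refl _ _).set (by simp) _ _).set (by simp) _ _).set (by simp) _ _

    all_goals
      simp only [Expr.eval_mul, Expr.eval_add, Expr.eval_get, Expr.eval_const,
        State.set_mem_of_ne, State.set_mem_self, ne_eq, hxa, not_false_eq_true,
        Nat.reduceEqDiff]
    all_goals first | assumption | exact hb _ _
  · simp only [not_lt.mpr hc, if_false] at h1 h2 hQ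
    refine .seq (.store ?_ (.store ?_ (.store ?_ (hQ _ ?_ ?_ ?_ ?_))))
    rotate_left 3
    · exact (((Frame.refl _ _).set (by simp) _ _).set (by simp) _ _).set (by simp) _ _
    all_goals
      simp only [Expr.eval_sub, Expr.eval_mul, Expr.eval_add, Expr.eval_get, Expr.eval_const,
        State.set_mem_of_ne, State.set_mem_self, ne_eq, hya, not_false_eq_true,
        Nat.reduceEqDiff]
    all_goals first | assumption | exact hb _ _

/-- The numerator is below the denominator, so only the denominator has to be estimated. -/
theorem movedX_lt {n B : ℕ} {r : MergeRec} (hr : r.Good n B) {x y u v m b : ℕ}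
    (hW : 0 < r.L * x + r.M * y) (hx : x ≤ 2 ^ B) (hy : y ≤ 2 ^ B) (huv : u < v)
    (hv : v ≤ 2 ^ ((4 * B + 1) * m)) (hb : (4 * B + 1) * (m + 1) < b) :
    (movedX r x y u v).1 < 2 ^ b ∧ (movedX r x y u v).2.1 < 2 ^ b := by
  have h1 := (parentSeed_natCast hr.LM_pos hW huv).2
  have hmul : ∀ y ≤ 2 ^ B, v * ((r.L + r.M) * y) < 2 ^ b := fun y hy => by
    calc v * ((r.L + r.M) * y) ≤ 2 ^ ((4 * B + 1) * m) * (2 ^ (3 * B + 1) * 2 ^ B) :=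
          Nat.mul_le_mul hv (Nat.mul_le_mul hr.LM_le hy)
      _ = 2 ^ ((4 * B + 1) * (m + 1)) := by rw [← pow_add, ← pow_add]; congr 1; ring
      _ < 2 ^ b := Nat.pow_lt_pow_right (by omega) hb
  have h2 : (movedX r x y u v).2.1 < 2 ^ b := by
    simp only [movedX]
    split_ifs
    · exact hmul x hx
    · exact hmul y hy
  exact ⟨lt_trans h1 h2, h2⟩

theorem WP.moveBreakpoints {b H n B m : ℕ} {Q : State → Prop} {s : State} {v : PavaView}
    {r : MergeRec} (hm : s.mem 35 0 = m) (hmH : m ≤ H) (hmb : m < 2 ^ b)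
    (hr : recsOf s m = r) (hgood : r.Good n B)
    (hxn : v.xn = s.mem 50) (hxd : v.xd = s.mem 51) (hxr : v.xr = s.mem 52)
    (hlt : ∀ j < m, v.xn j < v.xd j) (hle : ∀ j < m, v.xd j ≤ 2 ^ ((4 * B + 1) * m))
    (hb : (4 * B + 1) * (m + 1) < b)
    (hQ : ∀ s', Frame [21, 50, 51, 52] s s' →
      (∀ j < m, (s'.mem 50 j, s'.mem 51 j, s'.mem 52 j) = newX v r j) → Q s') :
    WP b H moveBreakpoints Q s := by
  have hrec : ∀ {s'}, Frame [21, 50, 51, 52] s s' → recsOf s' m = r ∧ s'.mem 35 0 = m := by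
    intro s' hf
    rw [← hr, ← hm]
    simp only [recsOf]
    rw [hf.mem (a := 40) (by simp), hf.mem (a := 41) (by simp), hf.mem (a := 42) (by simp),
      hf.mem (a := 43) (by simp), hf.mem (a := 44) (by simp), hf.mem (a := 45) (by simp),
      hf.mem (a := 46) (by simp), hf.mem (a := 47) (by simp), hf.mem (a := 48) (by simp),
      hf.mem (a := 35) (by simp)]
    exact ⟨rfl, rfl⟩
  -- Breakpoints with index below `i` have been moved, the others are still the old ones.
  refine .forRange m hmH hmb (fun i s' => Frame [21, 50, 51, 52] s s' ∧ s'.mem 21 0 = i ∧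
    ∀ j < m, (s'.mem 50 j, s'.mem 51 j, s'.mem 52 j) =
      if j < i then newX v r j else (v.xn j, v.xd j, v.xr j)) ?_ ?_ ?_ ?_
  · refine ⟨(Frame.refl _ _).set (by simp) _ _, by simp [State.set_mem_self], fun j hj => ?_⟩
    simp [State.set_mem_of_ne, hxn, hxd, hxr]
  · rintro i - s' ⟨hf, h1, -⟩
    exact ⟨h1, (hrec hf).2⟩
  · rintro i hi s' ⟨hf, h1, h2⟩
    obtain ⟨hr', hm'⟩ := hrec hf
    have hcur := h2 i hi
    rw [if_neg (lt_irrefl _), Prod.mk.injEq, Prod.mk.injEq] at hcur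
    obtain ⟨c1, c2, c3⟩ := hcur
    have hL : s'.mem 46 m = r.l := by rw [← hr']; rfl
    have hmid : s'.mem 47 m = r.mid := by rw [← hr']; rfl
    have hstep : ∀ {s'' : State}, Frame [50, 51, 52] s' s'' →
        (∀ j < m, (s''.mem 50 j, s''.mem 51 j, s''.mem 52 j) =
          if j < i + 1 then newX v r j else (v.xn j, v.xd j, v.xr j)) →
        s''.mem 21 0 = i ∧ Frame [21, 50, 51, 52] s (s''.set 21 0 (i + 1)) ∧
        (s''.set 21 0 (i + 1)).mem 21 0 = i + 1 ∧
        ∀ j < m, ((s''.set 21 0 (i + 1)).mem 50 j, (s''.set 21 0 (i + 1)).mem 51 j,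
          (s''.set 21 0 (i + 1)).mem 52 j) =
          if j < i + 1 then newX v r j else (v.xn j, v.xd j, v.xr j) := by
      intro s'' hf'' hx
      refine ⟨by rw [hf''.mem (by simp), h1],
        (hf.trans (hf''.mono (by simp))).set (by simp) _ _, by simp [State.set_mem_self], ?_⟩
      intro j hj
      rw [← hx j hj]
      simp [State.set_mem_of_ne]
    have hmove : ∀ xa ya, xa ∉ [50, 51] → ya ∉ [50, 51] →
        newX v r i = movedX r (s'.mem xa m) (s'.mem ya m) (v.xn i) (v.xd i) →
        0 < r.L * s'.mem xa m + r.M * s'.mem ya m → s'.mem xa m ≤ 2 ^ B → s'.mem ya m ≤ 2 ^ B →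
        WP b H (LogRam.moveBreakpoint xa ya) (fun s'' => s''.mem 21 0 = i ∧
          Frame [21, 50, 51, 52] s (s''.set 21 0 (i + 1)) ∧
          (s''.set 21 0 (i + 1)).mem 21 0 = i + 1 ∧
          ∀ j < m, ((s''.set 21 0 (i + 1)).mem 50 j, (s''.set 21 0 (i + 1)).mem 51 j,
            (s''.set 21 0 (i + 1)).mem 52 j) =
          if j < i + 1 then newX v r j else (v.xn j, v.xd j, v.xr j)) s' := by
      intro xa ya hxa hya hnew hW hx hy
      have hlt' := movedX_lt hgood hW hx hy (hlt i hi) (hle i hi) hb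
      rw [← hnew] at hlt'
      refine .moveBreakpoint hxa hya (T := newX v r i) ?_ hlt'.1 hlt'.2
        fun s'' hf'' e1 e2 e3 => hstep hf'' fun j hj => ?_
      · rw [hnew, hm', hr', h1, c1, c2]
      · rw [e1, e2, e3, h1]
        rcases lt_trichotomy j i with hji | rfl | hji
        · rw [Function.update_of_ne hji.ne, Function.update_of_ne hji.ne,
            Function.update_of_ne hji.ne, h2 j hj, if_pos hji, if_pos (by omega)]
        · simp
        · rw [Function.update_of_ne hji.ne', Function.update_of_ne hji.ne',
            Function.update_of_ne hji.ne', h2 j hj, if_neg (by omega), if_neg (by omega)]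
    refine .ite (fun hc => .ite (fun hc' => .skip (hstep (Frame.refl _ _) fun j hj => ?_))
      fun hc' => ?_) fun hc => ?_
    all_goals
      simp only [Expr.eval_sub, Expr.eval_add, Expr.eval_get, Expr.eval_const, h1, hm', c3,
        hL, hmid] at *
    · rw [h2 j hj]
      rcases lt_trichotomy j i with hji | rfl | hji
      · rw [if_pos hji, if_pos (by omega)]
      · rw [if_neg (lt_irrefl _), if_pos (by omega), newX, if_neg (by omega), if_neg (by omega)]
      · rw [if_neg (by omega), if_neg (by omega)]
    · have e1 : s'.mem 42 m = r.p := by rw [← hr']; rfl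
      have e2 : s'.mem 43 m = r.d := by rw [← hr']; rfl
      refine hmove 42 43 (by simp) (by simp) ?_ ?_ ?_ ?_
      · rw [newX, if_neg (by omega), if_pos (by omega), e1, e2]
      · rw [e1, e2]; exact hgood.right_pos
      · rw [e1]; exact hgood.p_le
      · rw [e2]; exact hgood.d_le
    · have e1 : s'.mem 45 m = r.e := by rw [← hr']; rfl
      have e2 : s'.mem 44 m = r.q := by rw [← hr']; rfl
      refine hmove 45 44 (by simp) (by simp) ?_ ?_ ?_ ?_
      · rw [newX, if_pos (by omega), e1, e2]
      · rw [e1, e2]; exact hgood.left_pos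
      · rw [e1]; exact hgood.e_le
      · rw [e2]; exact hgood.q_le
  · rintro s' ⟨hf, -, h2⟩
    exact hQ s' hf fun j hj => by rw [h2 j hj, if_pos hj]

end LogRam

/-! ### Correctness of the pooling program. -/

namespace LogRam

open FairSelection

theorem newX_left {v : PavaView} {r : MergeRec} {j : ℕ} (h : v.xr j = r.l) :
    newX v r j = movedX r r.e r.q (v.xn j) (v.xd j) := if_pos h

theorem newX_right {v : PavaView} {r : MergeRec} {j : ℕ} (h : v.xr j = r.mid) (hlr : r.l ≠ r.mid) :
    newX v r j = movedX r r.p r.d (v.xn j) (v.xd j) := by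
  rw [newX, if_neg (by omega), if_pos h]

theorem newX_other {v : PavaView} {r : MergeRec} {j : ℕ} (h : v.xr j ≠ r.l) (h' : v.xr j ≠ r.mid) :
    newX v r j = (v.xn j, v.xd j, v.xr j) := by
  rw [newX, if_neg h, if_neg h']

/-- `Good` is part of the invariant after the merge. It is read off from a hypothetical merged
state, because the program needs its bounds while the merge is still in progress. -/
theorem good_recAt {z : ℕ → ℝ} {n B : ℕ} {pn pd : ℕ → ℕ} {v : PavaView}
    (hd : SortedData z n B pn pd) (h : PavaInv z n B pn pd v) (hsp : 2 ≤ v.sp) {r : MergeRec}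
    (hr : r = v.recAt (v.sp - 2)) (hM : 0 < r.M) : r.Good n B := by
  let v' : PavaView :=
    { sp := v.sp - 1, k := v.k, cnt := v.cnt + 1
      st := Function.update v.st (v.sp - 1) v.k
      bp := Function.update v.bp (v.sp - 2) (r.p * r.q)
      bd := Function.update v.bd (v.sp - 2) (r.d * r.e)
      xn := fun j => if j = v.cnt then r.L else (newX v r j).1
      xd := fun j => if j = v.cnt then r.L + r.M else (newX v r j).2.1
      xr := fun j => if j = v.cnt then r.l else (newX v r j).2.2
      recs := fun j => if j = v.cnt then r else v.recs j }
  have hlr : r.l ≠ r.mid := (h.recAt_spec hd (by omega) hr).1.1.ne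
  have h' : PavaInv z n B pn pd v' := by
    refine h.merge hd hsp hr hM rfl rfl rfl rfl rfl rfl ?_ ?_ ?_ ?_ ?_ ?_
    · simp [v']
    · intro j hj hx
      simp [v', hj.ne, newX_left hx, movedX]
    · intro j hj hx
      simp [v', hj.ne, newX_right hx hlr, movedX]
    · intro j hj hx hx'
      simp [v', hj.ne, newX_other hx hx']
    · intro j hj
      simp [v', hj.ne]
    · simp [v']
  have := h'.good v.cnt (Nat.lt_succ_self _)
  simpa [v'] using this

/-- The arrays that `pavaStep` modifies, apart from the loop variable. -/
abbrev stepArrays : List ℕ :=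
  [21, 23, 24, 35, 8, 9, 10, 40, 41, 42, 43, 44, 45, 46, 47, 48, 50, 51, 52]

theorem viewOf_congr {s s' : State} (h : Frame recArrays s s') :
    viewOf s' = { viewOf s with recs := recsOf s' } := by
  simp only [viewOf]
  rw [h.mem (a := 23) (by simp), h.mem (a := 24) (by simp), h.mem (a := 35) (by simp),
    h.mem (a := 8) (by simp), h.mem (a := 9) (by simp), h.mem (a := 10) (by simp),
    h.mem (a := 50) (by simp), h.mem (a := 51) (by simp), h.mem (a := 52) (by simp)]

theorem recsOf_congr {l : List ℕ} {s s' : State} (h : Frame l s s')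
    (hl : ∀ a ∈ recArrays, a ∉ l) : recsOf s' = recsOf s := by
  funext j
  simp only [recsOf]
  rw [h.mem (hl 40 (by simp)), h.mem (hl 41 (by simp)), h.mem (hl 42 (by simp)),
    h.mem (hl 43 (by simp)), h.mem (hl 44 (by simp)), h.mem (hl 45 (by simp)),
    h.mem (hl 46 (by simp)), h.mem (hl 47 (by simp)), h.mem (hl 48 (by simp))]

theorem WP.mergeTop {b H n B : ℕ} {z : ℕ → ℝ} {pn pd : ℕ → ℕ} {Q : State → Prop} {s : State}
    {v : PavaView} (hd : SortedData z n B pn pd) (h : PavaInv z n B pn pd v)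
    (hsp : 2 ≤ v.sp) (hv : viewOf s = { v with recs := recsOf s })
    (hrecs : ∀ j < v.cnt, recsOf s j = v.recs j) (hr : recsOf s v.cnt = v.recAt (v.sp - 2))
    (hM : 0 < (recsOf s v.cnt).M) (hH : n ≤ H) (hb : (4 * B + 1) * (n + 1) < b)
    (hnb : n < 2 ^ b)
    (hQ : ∀ s', Frame stepArrays s s' → PavaInv z n B pn pd (viewOf s') →
      (viewOf s').k = v.k → (viewOf s').cnt = v.cnt + 1 → Q s') :
    WP b H mergeTop Q s := by
  obtain ⟨r, hrdef⟩ : ∃ r, recsOf s v.cnt = r := ⟨_, rfl⟩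
  rw [hrdef] at hr hM
  have hgood := good_recAt hd h hsp hr hM
  have hlr : r.l ≠ r.mid := hgood.l_lt.ne
  have hcnt : v.cnt + 1 ≤ n := by
    have := h.cnt
    have := h.k_le
    omega
  have hv' := hv
  simp only [viewOf, PavaView.mk.injEq, and_true] at hv'
  obtain ⟨v1, v2, v3, v4, v5, v6, v7, v8, v9⟩ := hv'
  have hb1 : (4 * B + 1) * (v.cnt + 1) < b := by nlinarith
  have hpow : ∀ x c, x ≤ 2 ^ c → c ≤ 4 * B + 1 → x < 2 ^ b := fun x c hx hc =>
    hx.trans_lt (Nat.pow_lt_pow_right (by omega) (by nlinarith))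
  unfold LogRam.mergeTop
  refine .seq (.moveBreakpoints (v := v) (m := v.cnt) v3 (by omega) (by omega) hrdef hgood v7.symm
    v8.symm v9.symm h.xlt h.xle hb1 fun s1 hf1 hx1 => .of_memBdd fun hb1 => ?_)
  have m35 : s1.mem 35 = s.mem 35 := hf1.mem (by simp)
  have m23 : s1.mem 23 = s.mem 23 := hf1.mem (by simp)
  have m24 : s1.mem 24 = s.mem 24 := hf1.mem (by simp)
  have m8 : s1.mem 8 = s.mem 8 := hf1.mem (by simp)
  have m9 : s1.mem 9 = s.mem 9 := hf1.mem (by simp)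
  have m10 : s1.mem 10 = s.mem 10 := hf1.mem (by simp)
  have mrec : recsOf s1 = recsOf s := recsOf_congr hf1 (by decide)
  have hrec1 : recsOf s1 v.cnt = r := by rw [mrec, hrdef]
  have rL : s1.mem 40 v.cnt = r.L := by rw [← hrec1]; rfl
  have rM : s1.mem 41 v.cnt = r.M := by rw [← hrec1]; rfl
  have rp : s1.mem 42 v.cnt = r.p := by rw [← hrec1]; rfl
  have rd : s1.mem 43 v.cnt = r.d := by rw [← hrec1]; rfl
  have rq : s1.mem 44 v.cnt = r.q := by rw [← hrec1]; rfl
  have re : s1.mem 45 v.cnt = r.e := by rw [← hrec1]; rfl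
  have rl : s1.mem 46 v.cnt = r.l := by rw [← hrec1]; rfl
  have hmulB : ∀ x y, x ≤ 2 ^ B → y ≤ 2 ^ B → x * y < 2 ^ b := fun x y hx hy =>
    hpow _ (B + B) (by rw [pow_add]; exact Nat.mul_le_mul hx hy) (by omega)
  have hLM : r.L + r.M < 2 ^ b := hpow _ _ hgood.LM_le (by omega)
  refine .seq (.store ?_ (.seq (.store ?_ (.seq (.store ?_ (.seq (.store ?_ (.seq (.store ?_
    (.seq (.store ?_ (.seq (.store ?_ (.store ?_ (hQ _ ?_ ?_ ?_ ?_)))))))))))))))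
  all_goals try simp only [Expr.eval_sub, Expr.eval_mul, Expr.eval_add, Expr.eval_get,
        Expr.eval_const, State.set_mem_of_ne, State.set_mem_self, ne_eq, not_false_eq_true,
        Nat.reduceEqDiff, m35, v3, rL, rM, rp, rd, rq, re, rl]
  · omega
  · exact hLM
  · rw [← rl]; exact hb1 _ _
  · exact hmulB _ _ hgood.p_le hgood.q_le
  · exact hmulB _ _ hgood.d_le hgood.e_le
  · exact (Nat.sub_le _ _).trans_lt (hb1 _ _)
  · exact hb1 _ _
  · omega
  · iterate 8 refine Frame.set ?_ (by simp) _ _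
    exact hf1.mono (by simp)
  · refine h.merge hd hsp hr hM ?_ ?_ ?_ ?_ ?_ ?_ ?_ ?_ ?_ ?_ ?_ ?_
    all_goals try simp only [viewOf, State.set_mem_of_ne, State.set_mem_self, ne_eq,
      not_false_eq_true, Nat.reduceEqDiff, m23, m24, m35, m8, m9, m10, v1, v2, v4, v5, v6,
      Function.update_self]
    · exact ⟨trivial, trivial, trivial⟩
    · intro j hj hx
      rw [Function.update_of_ne hj.ne, Function.update_of_ne hj.ne, Function.update_of_ne hj.ne]
      have := hx1 j hj
      rw [newX_left hx, movedX, Prod.mk.injEq, Prod.mk.injEq] at this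
      exact ⟨this.2.2, this.1, this.2.1⟩
    · intro j hj hx
      rw [Function.update_of_ne hj.ne, Function.update_of_ne hj.ne, Function.update_of_ne hj.ne]
      have := hx1 j hj
      rw [newX_right hx hlr, movedX, Prod.mk.injEq, Prod.mk.injEq] at this
      exact ⟨this.2.2, this.1, this.2.1⟩
    · intro j hj hx hx'
      rw [Function.update_of_ne hj.ne, Function.update_of_ne hj.ne, Function.update_of_ne hj.ne]
      have := hx1 j hj
      rw [newX_other hx hx', Prod.mk.injEq, Prod.mk.injEq] at this
      exact ⟨this.2.2, this.1, this.2.1⟩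
    · intro j hj
      rw [← hrecs j hj, ← mrec]
      simp [recsOf, State.set_mem_of_ne]
    · rw [← hrec1]
      simp [recsOf, State.set_mem_of_ne]
  · simp [viewOf, State.set_mem_of_ne, m24, v2]
  · simp [viewOf, State.set_mem_self]

theorem WP.pushNext {b H n B : ℕ} {z : ℕ → ℝ} {Q : State → Prop} {s : State}
    {v : PavaView} (h : PavaInv z n B (s.mem 6) (s.mem 7) v)
    (hk : v.k < n) (hv : viewOf s = { v with recs := recsOf s })
    (hrecs : ∀ j < v.cnt, recsOf s j = v.recs j)
    (hM : 2 ≤ v.sp → (v.recAt (v.sp - 2)).M = 0) (hnb : n < 2 ^ b)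
    (hQ : ∀ s', Frame stepArrays s s' → PavaInv z n B (s.mem 6) (s.mem 7) (viewOf s') →
      (viewOf s').k = v.k + 1 → (viewOf s').cnt = v.cnt → Q s') :
    WP b H pushNext Q s := by
  have hv' := hv
  simp only [viewOf, PavaView.mk.injEq, and_true] at hv'
  obtain ⟨v1, v2, v3, v4, v5, v6, v7, v8, v9⟩ := hv'
  have := h.cnt
  unfold LogRam.pushNext
  refine .of_memBdd fun hb => .seq (.store ?_ (.seq (.store ?_ (.seq (.store ?_ (.seq (.store ?_
    (.store ?_ (hQ _ ?_ ?_ ?_ ?_)))))))))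
  all_goals try simp only [Expr.eval_add, Expr.eval_get,
        Expr.eval_const, State.set_mem_of_ne, State.set_mem_self, ne_eq, not_false_eq_true,
        Nat.reduceEqDiff, v1, v2, Function.update_self]
  · exact hb _ _
  · exact hb _ _
  · omega
  · omega
  · omega
  · iterate 5 refine Frame.set ?_ (by simp) _ _
    exact Frame.refl _ _
  · refine h.push hk hM ?_ ?_ ?_ ?_ ?_ ?_ ?_ ?_ ?_ ?_
    all_goals try simp only [viewOf, State.set_mem_of_ne, State.set_mem_self, ne_eq,
      not_false_eq_true, Nat.reduceEqDiff, v3, v4, v5, v6, v7, v8, v9,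
      Function.update_self]
    · intro j hj
      rw [← hrecs j hj]
      simp [recsOf, State.set_mem_of_ne]
  · simp [viewOf, State.set_mem_of_ne, State.set_mem_self]
  · simp [viewOf, State.set_mem_of_ne, v3]

/-- Every step either merges or pushes, which raises `k + cnt` by one, or nothing is left to do and
the state stays final. -/
theorem WP.pavaStep {b H n B t : ℕ} {z : ℕ → ℝ} {Q : State → Prop} {s : State}
    (hd : SortedData z n B (s.mem 6) (s.mem 7))
    (h : PavaInv z n B (s.mem 6) (s.mem 7) (viewOf s)) (hn : s.mem 2 0 = n)
    (ht : (viewOf s).k + (viewOf s).cnt = t ∨ (viewOf s).k = n ∧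
      (2 ≤ (viewOf s).sp → ((viewOf s).recAt ((viewOf s).sp - 2)).M = 0))
    (hH : n ≤ H) (hb : (4 * B + 1) * (n + 1) < b) (hnb : n < 2 ^ b)
    (hQ : ∀ s', Frame stepArrays s s' → PavaInv z n B (s.mem 6) (s.mem 7) (viewOf s') →
      ((viewOf s').k + (viewOf s').cnt = t + 1 ∨ (viewOf s').k = n ∧
      (2 ≤ (viewOf s').sp → ((viewOf s').recAt ((viewOf s').sp - 2)).M = 0)) → Q s') :
    WP b H pavaStep Q s := by
  -- The part of the step after the tentative record, common to both branches of the first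
  -- conditional.
  have hmid : ∀ s1, Frame recArrays s s1 → (∀ j < (viewOf s).cnt, recsOf s1 j = recsOf s j) →
      (2 ≤ (viewOf s).sp → recsOf s1 (viewOf s).cnt = (viewOf s).recAt ((viewOf s).sp - 2)) →
      (¬ 2 ≤ (viewOf s).sp → (recsOf s1 (viewOf s).cnt).M = 0) →
      WP b H (.ite (.cur 41) LogRam.mergeTop (.ite (.var 2 - .var 24) LogRam.pushNext .skip)) Q
        s1 := by
    intro s1 hf hj hr hM0
    have hv := viewOf_congr hf
    have e35 : s1.mem 35 = s.mem 35 := hf.mem (by simp)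
    have e24 : s1.mem 24 = s.mem 24 := hf.mem (by simp)
    have e2 : s1.mem 2 = s.mem 2 := hf.mem (by simp)
    have e6 : s1.mem 6 = s.mem 6 := hf.mem (by simp)
    have e7 : s1.mem 7 = s.mem 7 := hf.mem (by simp)
    have hMM : (recsOf s1 (viewOf s).cnt).M = s1.mem 41 (s.mem 35 0) := rfl
    have hfs : ∀ {s'}, Frame stepArrays s1 s' → Frame stepArrays s s' := fun h' =>
      (hf.mono (by simp)).trans h'
    have hkk : (viewOf s).k = s.mem 24 0 := rfl
    have hkn := h.k_le
    refine .ite (fun hc => ?_) fun hc => .ite (fun hc' => ?_) fun hc' => .skip ?_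
    all_goals
      simp only [Expr.eval_sub, Expr.eval_get, Expr.eval_const, e35, e24, e2, hn] at *
    · have hsp : 2 ≤ (viewOf s).sp := by
        by_contra hcon
        exact hc (hM0 hcon)
      have hMpos : 0 < (recsOf s1 (viewOf s).cnt).M := Nat.pos_of_ne_zero hc
      refine .mergeTop hd h hsp hv hj (hr hsp) hMpos hH hb hnb
        fun s' hf' hI h1 h2 => hQ s' (hfs hf') hI (.inl ?_)
      rcases ht with ht | ht
      · omega
      · have := ht.2 hsp
        rw [hr hsp] at hMpos
        omega
    · have hM : 2 ≤ (viewOf s).sp → ((viewOf s).recAt ((viewOf s).sp - 2)).M = 0 := fun h' => by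
        rw [← hr h']; exact hc
      rw [← e6, ← e7] at h
      refine .pushNext h (by omega) hv hj hM hnb fun s' hf' hI h1 h2 =>
        hQ s' (hfs hf') (by rw [← e6, ← e7]; exact hI) (.inl ?_)
      rcases ht with ht | ht <;> omega
    · have hM : 2 ≤ (viewOf s).sp → ((viewOf s).recAt ((viewOf s).sp - 2)).M = 0 := fun h' => by
        rw [← hr h']; exact hc
      refine hQ s1 (hf.mono (by simp)) ?_ (.inr ?_)
      · rw [hv]
        exact h.congr_recs hj
      · rw [hv]
        exact ⟨show (viewOf s).k = n by omega, hM⟩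
  unfold LogRam.pavaStep
  have e35 : ∀ x, (s.set 41 x 0).mem 35 = s.mem 35 := fun x => State.set_mem_of_ne _ (by simp) _ _
  -- Resetting `M` in the scratch record prevents a merge from stale data when the stack has fewer
  -- than two blocks.
  have hset : ∀ j, j ≠ s.mem 35 0 → recsOf (s.set 41 (s.mem 35 0) 0) j = recsOf s j := by
    intro j hj
    simp [recsOf, State.set_mem_of_ne, State.set_mem_self, hj]
  have hsv : viewOf (s.set 41 (s.mem 35 0) 0) =
      { viewOf s with recs := recsOf (s.set 41 (s.mem 35 0) 0) } :=
    viewOf_congr ((Frame.refl _ _).set (by simp) _ _)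
  have hfr : Frame recArrays s (s.set 41 (s.mem 35 0) 0) := (Frame.refl _ _).set (by simp) _ _
  have hle : ∀ {x}, x ≤ 2 ^ (3 * B) → x < 2 ^ b := fun hx =>
    hx.trans_lt (Nat.pow_lt_pow_right (by omega) (by nlinarith))
  refine .seq (.store (by simp [Expr.eval_const]) (.seq (.ite (fun hc => ?_) fun hc => .skip ?_)))
  all_goals
    simp only [Expr.eval_sub, Expr.eval_get, Expr.eval_const, State.set_mem_of_ne, ne_eq,
      not_false_eq_true, Nat.reduceEqDiff] at hc ⊢
  · have hsp : 2 ≤ s.mem 23 0 := by omega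
    have h23 : (s.set 41 (s.mem 35 0) 0).mem 23 = s.mem 23 := State.set_mem_of_ne _ (by simp) _ _
    have hbd := h.recAt_le hd (t := s.mem 23 0 - 2) (by simp only [viewOf]; omega) rfl
    have hrec : (viewOf (s.set 41 (s.mem 35 0) 0)).recAt (s.mem 23 0 - 2) =
        (viewOf s).recAt (s.mem 23 0 - 2) := by rw [hsv]; rfl
    refine .recordTop (by rw [h23]; exact hsp) ?_ ?_ fun s1 hf1 hr1 ho1 => ?_
    · rw [h23, hrec]; exact hle hbd.1
    · rw [h23, hrec]; exact hle hbd.2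
    · rw [e35, h23, hrec] at hr1
      rw [e35] at ho1
      refine hmid s1 (hfr.trans hf1) (fun j hj => ?_) (fun _ => hr1) fun h' => absurd hsp h'
      have hne : j ≠ s.mem 35 0 := ne_of_lt hj
      rw [ho1 j hne, hset j hne]
  · have hsp : ¬ 2 ≤ s.mem 23 0 := by omega
    refine hmid _ hfr (fun j hj => hset j (ne_of_lt hj)) (fun h' => absurd h' hsp) fun _ => ?_
    simp [recsOf, viewOf, State.set_mem_self]

/-- The arrays that `pava` modifies. -/
abbrev pavaArrays : List ℕ := 20 :: stepArrays

/-- There are at most `n` pushes and fewer than `n` merges if the stack is nonempty, so `2 * n`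
rounds suffice and a fixed loop bound can replace a termination test. -/
theorem WP.pava {b H n B : ℕ} {z : ℕ → ℝ} {Q : State → Prop} {s : State}
    (hd : SortedData z n B (s.mem 6) (s.mem 7)) (hn : s.mem 2 0 = n)
    (hH : 2 * n ≤ H) (hb : (4 * B + 1) * (n + 1) < b) (hnb : 2 * n < 2 ^ b)
    (hQ : ∀ s', Frame pavaArrays s s' → PavaInv z n B (s.mem 6) (s.mem 7) (viewOf s') →
      (viewOf s').k = n → (2 ≤ (viewOf s').sp →
        ((viewOf s').recAt ((viewOf s').sp - 2)).M = 0) → Q s') : WP b H pava Q s := by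
  unfold LogRam.pava
  refine .seq (.store (by simp [Expr.eval_const]) (.seq (.store (by simp [Expr.eval_const])
    (.seq (.store (by simp [Expr.eval_const]) (.seq (.store (by simp [Expr.eval_const])
    (.forRange (2 * n) hH hnb (fun t s' => Frame pavaArrays s s' ∧ s'.mem 20 0 = t ∧
      PavaInv z n B (s.mem 6) (s.mem 7) (viewOf s') ∧
      ((viewOf s').k + (viewOf s').cnt = t ∨ (viewOf s').k = n ∧
      (2 ≤ (viewOf s').sp → ((viewOf s').recAt ((viewOf s').sp - 2)).M = 0))) ?_ ?_ ?_ ?_))))))))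
  · refine ⟨?_, ?_, pavaInv_init ?_ ?_ ?_ ?_, .inl ?_⟩
    · iterate 5 refine Frame.set ?_ (by simp) _ _
      exact Frame.refl _ _
    all_goals simp [viewOf, State.set_mem_of_ne, State.set_mem_self, Expr.eval_const]
  · rintro t - s' ⟨hf, h1, -⟩
    refine ⟨h1, ?_⟩
    simp only [Expr.eval_add, Expr.eval_get, Expr.eval_const]
    rw [hf.mem (by simp), hn]
    omega
  · rintro t ht s' ⟨hf, h1, hI, hdone⟩
    have e6 : s'.mem 6 = s.mem 6 := hf.mem (by simp)
    have e7 : s'.mem 7 = s.mem 7 := hf.mem (by simp)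
    have e2 : s'.mem 2 0 = n := by rw [hf.mem (by simp), hn]
    rw [← e6, ← e7] at hd hI
    refine .pavaStep hd hI e2 hdone (by omega) hb (by omega) fun s1 hf1 hI1 hd1 => ?_
    have hv : viewOf (s1.set 20 0 (t + 1)) = viewOf s1 := by
      simp only [viewOf, State.set_mem_of_ne, ne_eq, not_false_eq_true, Nat.reduceEqDiff]
      rw [recsOf_congr ((Frame.refl [20] s1).set (by simp) 0 (t + 1)) (by decide)]
    rw [hv]
    refine ⟨by rw [hf1.mem (by simp), h1], ?_, by simp [State.set_mem_self], ?_, hd1⟩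
    · exact (hf.trans (hf1.mono (by simp))).set (by simp) _ _
    · rw [← e6, ← e7]; exact hI1
  · rintro s' ⟨hf, -, hI, hdone⟩
    -- If all rounds made progress, then `k + cnt = 2 * n`; with `cnt + sp = k ≤ n` this leaves `k =
    -- n` and an empty stack.
    have h1 := hI.cnt
    have h2 := hI.k_le
    refine hQ s' hf hI (by omega) fun h3 => ?_
    rcases hdone with h | h
    · omega
    · exact h.2 h3

end LogRam

/-! ### Undoing the merges at a given seed. -/

namespace LogRam

open FairSelection

/-- The parameter in the array `a` of the merge whose index is in the scalar variable `22`. -/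
abbrev Expr.mrg (a : ℕ) : Expr := .get a (.var 22)

/-- The entry of the array `a` for the block whose first agent is in the array `i`. -/
abbrev Expr.blk (a i : ℕ) : Expr := .get a (.get i (.var 22))

/-- Splits a merged block into its parts. -/
def splitStep : Prog :=
  .ite (.mrg 40 * .blk 55 46 - .blk 54 46 * (.mrg 40 + .mrg 41))
    (.store 54 (.mrg 47) (.blk 54 46 * (.mrg 40 + .mrg 41) * .mrg 42) ;;
      .store 55 (.mrg 47) (.blk 55 46 * (.mrg 40 * .mrg 42 + .mrg 41 * .mrg 43)) ;;
      .store 56 (.mrg 47) (.blk 56 46 + (.mrg 47 - .mrg 46)) ;;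
      .store 54 (.mrg 46) (.blk 54 46 * (.mrg 40 + .mrg 41) * .mrg 45) ;;
      .store 55 (.mrg 46) (.blk 55 46 * (.mrg 40 * .mrg 45 + .mrg 41 * .mrg 44)))
    (.store 54 (.mrg 47) (.blk 55 46 * (.mrg 40 * .mrg 42 + .mrg 41 * .mrg 43) -
        (.blk 55 46 - .blk 54 46) * (.mrg 40 + .mrg 41) * .mrg 43) ;;
      .store 55 (.mrg 47) (.blk 55 46 * (.mrg 40 * .mrg 42 + .mrg 41 * .mrg 43)) ;;
      .store 56 (.mrg 47) (.blk 56 46) ;;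
      .store 54 (.mrg 46) (.blk 55 46 * (.mrg 40 * .mrg 45 + .mrg 41 * .mrg 44) -
        (.blk 55 46 - .blk 54 46) * (.mrg 40 + .mrg 41) * .mrg 44) ;;
      .store 55 (.mrg 46) (.blk 55 46 * (.mrg 40 * .mrg 45 + .mrg 41 * .mrg 44)) ;;
      .store 56 (.mrg 46) (.blk 56 46 + (.mrg 48 - .mrg 47)))

/-- The arrays `54`, `55` and `56` hold the seeds `S`, as fractions, and the positions `O`. -/
structure SeedData (n c : ℕ) (S : ℕ → ℝ) (O : ℕ → ℕ) (s : State) : Prop where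
  pos : ∀ i < n, 0 < s.mem 55 i
  le : ∀ i < n, s.mem 54 i ≤ s.mem 55 i
  le_pow : ∀ i < n, s.mem 55 i ≤ 2 ^ c
  eq : ∀ i < n, S i = (s.mem 54 i : ℝ) / s.mem 55 i
  pos_eq : ∀ i < n, s.mem 56 i = O i
  pos_le : ∀ i < n, O i ≤ 2 ^ c

/-- The seeds of both parts are computed from that of the merged block, at a cost of `4 * B + 1`
bits in the denominators. A position grows by at most `n ≤ 2 ^ B ≤ 2 ^ c`, which fits into the same
allowance. -/
theorem WP.splitStep {b H n B c : ℕ} {S : ℕ → ℝ} {O : ℕ → ℕ} {Q : State → Prop} {s : State}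
    {r : MergeRec} (hr : recsOf s (s.mem 22 0) = r) (hgood : r.Good n B) (hn : n ≤ 2 ^ B)
    (hB : B ≤ c) (hb : c + (4 * B + 1) < b) (h : SeedData n c S O s)
    (hQ : ∀ s', Frame [54, 55, 56] s s' →
      SeedData n (c + (4 * B + 1)) (r.splitSeed S) (r.splitPos S O) s' → Q s') :
    WP b H splitStep Q s := by
  have rL : s.mem 40 (s.mem 22 0) = r.L := by rw [← hr]; rfl
  have rM : s.mem 41 (s.mem 22 0) = r.M := by rw [← hr]; rfl
  have rp : s.mem 42 (s.mem 22 0) = r.p := by rw [← hr]; rfl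
  have rd : s.mem 43 (s.mem 22 0) = r.d := by rw [← hr]; rfl
  have rq : s.mem 44 (s.mem 22 0) = r.q := by rw [← hr]; rfl
  have re : s.mem 45 (s.mem 22 0) = r.e := by rw [← hr]; rfl
  have rl : s.mem 46 (s.mem 22 0) = r.l := by rw [← hr]; rfl
  have rmid : s.mem 47 (s.mem 22 0) = r.mid := by rw [← hr]; rfl
  have rhi : s.mem 48 (s.mem 22 0) = r.hi := by rw [← hr]; rfl
  have l1 := hgood.l_lt
  have l2 := hgood.mid_lt
  have l3 := hgood.hi_le
  have hln : r.l < n := by omega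
  obtain ⟨u, hu⟩ : ∃ u, s.mem 54 r.l = u := ⟨_, rfl⟩
  obtain ⟨w, hw⟩ : ∃ w, s.mem 55 r.l = w := ⟨_, rfl⟩
  have hwpos : 0 < w := hw ▸ h.pos _ hln
  have huw : u ≤ w := by rw [← hu, ← hw]; exact h.le _ hln
  have hwle : w ≤ 2 ^ c := hw ▸ h.le_pow _ hln
  have hSl : S r.l = (u : ℝ) / w := by rw [← hu, ← hw]; exact h.eq _ hln
  have hOl : s.mem 56 r.l = O r.l := h.pos_eq _ hln
  have hOle := h.pos_le _ hln
  have hne : r.l ≠ r.mid := l1.ne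
  have hWle : ∀ x y, x ≤ 2 ^ B → y ≤ 2 ^ B →
      w * (r.L * x + r.M * y) ≤ 2 ^ (c + (4 * B + 1)) := fun x y hx hy => by
    rw [pow_add]
    refine Nat.mul_le_mul hwle ?_
    calc r.L * x + r.M * y ≤ r.L * 2 ^ B + r.M * 2 ^ B :=
          Nat.add_le_add (Nat.mul_le_mul_left _ hx) (Nat.mul_le_mul_left _ hy)
      _ = (r.L + r.M) * 2 ^ B := (add_mul _ _ _).symm
      _ ≤ 2 ^ (3 * B + 1) * 2 ^ B := Nat.mul_le_mul_right _ hgood.LM_le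
      _ = 2 ^ (4 * B + 1) := by rw [← pow_add]; congr 1; omega
  have hA := childSeed_natCast hgood.LM_pos hgood.left_pos hwpos huw
  have hBs := childSeed_natCast hgood.LM_pos hgood.right_pos hwpos huw
  rw [← hSl] at hA hBs
  have hWA := hWle _ _ hgood.e_le hgood.q_le
  have hWB := hWle _ _ hgood.p_le hgood.d_le
  have hWApos := Nat.mul_pos hwpos hgood.left_pos
  have hWBpos := Nat.mul_pos hwpos hgood.right_pos
  have hlt : ∀ x, x ≤ 2 ^ (c + (4 * B + 1)) → x < 2 ^ b := fun x hx =>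
    hx.trans_lt (Nat.pow_lt_pow_right (by omega) hb)
  have hcle : 2 ^ c ≤ 2 ^ (c + (4 * B + 1)) := Nat.pow_le_pow_right two_pos (by omega)
  have hOadd : ∀ x ≤ n, O r.l + x ≤ 2 ^ (c + (4 * B + 1)) := fun x hx => by
    have h1 : 2 ^ B ≤ 2 ^ c := Nat.pow_le_pow_right two_pos hB
    have h2 : 2 ^ (c + 1) ≤ 2 ^ (c + (4 * B + 1)) := Nat.pow_le_pow_right two_pos (by omega)
    rw [pow_succ] at h2
    omega
  have hiff : S r.l < r.lam ↔ u * (r.L + r.M) < r.L * w := by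
    have hLM : (0 : ℝ) < r.L + r.M := by exact_mod_cast hgood.LM_pos
    rw [hSl, MergeRec.lam, div_lt_div_iff₀ (by exact_mod_cast hwpos) hLM]
    exact_mod_cast Iff.rfl
  have hother : ∀ {A : ℕ → ℕ} {x y : ℕ} {i : ℕ}, i ≠ r.mid → i ≠ r.l →
      Function.update (Function.update A r.mid x) r.l y i = A i := fun h1 h2 => by
    rw [Function.update_of_ne h2, Function.update_of_ne h1]
  have hmidv : ∀ {A : ℕ → ℕ} {x y : ℕ},
      Function.update (Function.update A r.mid x) r.l y r.mid = x := fun {A x y} => by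
    rw [Function.update_of_ne hne.symm, Function.update_self]
  -- The two branches differ only in the numerators and the positions; the four possible effects on
  -- the seeds are treated together here.
  have key : ∀ s', Frame [54, 55, 56] s s' →
      s'.mem 54 = Function.update (Function.update (s.mem 54) r.mid
        (if u * (r.L + r.M) < r.L * w then u * (r.L + r.M) * r.p
          else w * (r.L * r.p + r.M * r.d) - (w - u) * (r.L + r.M) * r.d)) r.l
        (if u * (r.L + r.M) < r.L * w then u * (r.L + r.M) * r.e
          else w * (r.L * r.e + r.M * r.q) - (w - u) * (r.L + r.M) * r.q) →
      s'.mem 55 = Function.update (Function.update (s.mem 55) r.mid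
        (w * (r.L * r.p + r.M * r.d))) r.l (w * (r.L * r.e + r.M * r.q)) →
      (∀ i < n, s'.mem 56 i = r.splitPos S O i) → Q s' := by
    intro s' hf h54 h55 h56
    have hcase : ∀ i, i = r.mid ∨ i = r.l ∨ i ≠ r.mid ∧ i ≠ r.l := fun i => by tauto
    refine hQ s' hf ⟨?_, ?_, ?_, ?_, h56, ?_⟩
    · intro i hi
      rw [h55]
      rcases hcase i with rfl | rfl | ⟨h1, h2⟩
      · rwa [hmidv]
      · rwa [Function.update_self]
      · rw [hother h1 h2]; exact h.pos i hi
    · intro i hi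
      rw [h54, h55]
      rcases hcase i with rfl | rfl | ⟨h1, h2⟩
      · rw [hmidv, hmidv]; exact hBs.2
      · rw [Function.update_self, Function.update_self]; exact hA.2
      · rw [hother h1 h2, hother h1 h2]; exact h.le i hi
    · intro i hi
      rw [h55]
      rcases hcase i with rfl | rfl | ⟨h1, h2⟩
      · rwa [hmidv]
      · rwa [Function.update_self]
      · rw [hother h1 h2]; exact (h.le_pow i hi).trans hcle
    · intro i hi
      rw [h54, h55]
      rcases hcase i with rfl | rfl | ⟨h1, h2⟩
      · rw [hmidv, hmidv, MergeRec.splitSeed, if_pos rfl]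
        exact hBs.1
      · rw [Function.update_self, Function.update_self, MergeRec.splitSeed, if_neg hne, if_pos rfl]
        exact hA.1
      · rw [hother h1 h2, hother h1 h2, MergeRec.splitSeed, if_neg h1, if_neg h2]
        exact h.eq i hi
    · intro i hi
      have := (h.pos_le i hi).trans hcle
      have := hOadd (r.mid - r.l) (by omega)
      have := hOadd (r.hi - r.mid) (by omega)
      have := hOadd 0 (by omega)
      unfold MergeRec.splitPos
      split_ifs <;> omega
  unfold LogRam.splitStep
  refine .ite (fun hc => ?_) fun hc => ?_
  all_goals simp only [Expr.eval_sub, Expr.eval_mul, Expr.eval_add, Expr.eval_get,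
        Expr.eval_const, rL, rM, rl, hu, hw] at hc
  · have hc' : u * (r.L + r.M) < r.L * w := by omega
    simp only [hc', if_true] at key hA hBs
    -- The entries at `mid` are written first, since they read the entries at `l`, which still
    -- describe the merged block.
    refine .seq (.store ?_ (.seq (.store ?_ (.seq (.store ?_ (.seq (.store ?_ (.store ?_
      (key _ ?_ ?_ ?_ ?_)))))))))
    all_goals try simp only [Expr.eval_sub, Expr.eval_mul, Expr.eval_add, Expr.eval_get,
        Expr.eval_const, State.set_mem_of_ne, State.set_mem_self, ne_eq, not_false_eq_true,
        Nat.reduceEqDiff, rL, rM, rp, rd, rq, re, rl, rmid, hu, hw, hOl, hne,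
        Function.update_of_ne]
    · exact hlt _ (hBs.2.trans hWB)
    · exact hlt _ hWB
    · exact hlt _ (hOadd _ (by omega))
    · exact hlt _ (hA.2.trans hWA)
    · exact hlt _ hWA
    · iterate 5 refine Frame.set ?_ (by simp) _ _
      exact Frame.refl _ _
    · intro i hi
      rw [MergeRec.splitPos, if_pos (hiff.mpr hc')]
      by_cases h1 : i = r.mid
      · rw [h1, Function.update_self, if_pos rfl]
      · rw [Function.update_of_ne h1, if_neg h1, h.pos_eq i hi]
  · have hc' : ¬ u * (r.L + r.M) < r.L * w := by omega
    simp only [hc', if_false] at key hA hBs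
    refine .seq (.store ?_ (.seq (.store ?_ (.seq (.store ?_ (.seq (.store ?_ (.seq (.store ?_
      (.store ?_ (key _ ?_ ?_ ?_ ?_)))))))))))
    all_goals try simp only [Expr.eval_sub, Expr.eval_mul, Expr.eval_add, Expr.eval_get,
        Expr.eval_const, State.set_mem_of_ne, State.set_mem_self, ne_eq, not_false_eq_true,
        Nat.reduceEqDiff, rL, rM, rp, rd, rq, re, rl, rmid, rhi, hu, hw, hOl, hne,
        Function.update_of_ne]
    · exact hlt _ (hBs.2.trans hWB)
    · exact hlt _ hWB
    · exact hlt _ (hOadd 0 (by omega))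
    · exact hlt _ (hA.2.trans hWA)
    · exact hlt _ hWA
    · exact hlt _ (hOadd _ (by omega))
    · iterate 6 refine Frame.set ?_ (by simp) _ _
      exact Frame.refl _ _
    · intro i hi
      rw [MergeRec.splitPos, if_neg (fun h' => hc' (hiff.mp h'))]
      by_cases h1 : i = r.mid
      · rw [h1, hmidv, if_pos rfl]
      · by_cases h2 : i = r.l
        · rw [h2, Function.update_self, if_neg hne, if_pos rfl]
        · rw [hother h1 h2, if_neg h1, if_neg h2, h.pos_eq i hi]

end LogRam

/-! ### Writing the rankings. -/

namespace LogRam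

open FairSelection

/-- Computes in the array `56` the positions of the agents at the seed whose index among the
breakpoints is in the scalar variable `39`. -/
def orderAt : Prog :=
  .forRange 20 (.var 2) (.store 54 (.var 20) (.get 50 (.get 53 (.var 39)))) ;;
  .forRange 20 (.var 2) (.store 55 (.var 20) (.get 51 (.get 53 (.var 39)))) ;;
  .forRange 20 (.var 2) (.store 56 (.var 20) (.var 20)) ;;
  .forRange 20 (.var 35) (.assign 22 (.var 35 - .var 20 - .const 1) ;; splitStep)

/-- Writes the ranking for the seeds between two adjacent breakpoints, with its weight. -/
def writeCell : Prog :=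
  .write (.get 50 (.get 53 (.var 39 + .const 1)) * .get 51 (.get 53 (.var 39)) -
    .get 50 (.get 53 (.var 39)) * .get 51 (.get 53 (.var 39 + .const 1))) ;;
  .write (.get 51 (.get 53 (.var 39)) * .get 51 (.get 53 (.var 39 + .const 1))) ;;
  orderAt ;;
  .forRange 20 (.var 2) (.store 57 (.get 56 (.var 20)) (.get 5 (.var 20))) ;;
  .forRange 20 (.var 2) (.write (.get 57 (.var 20)))

/-- Writes all rankings with their weights. -/
def writeCells : Prog := .forRange 39 (.var 38) writeCell

/-- The conditions on the merges and the breakpoints under which the rankings are written. -/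
structure GridData (n B m : ℕ) (s : State) : Prop where
  n_eq : s.mem 2 0 = n
  n_le : n ≤ 2 ^ B
  cnt : s.mem 35 0 = m
  m_lt : m < n
  len : s.mem 38 0 = m + 1
  good : ∀ j < m, (recsOf s j).Good n B
  pos : ∀ j ≤ m + 1, 0 < s.mem 51 (s.mem 53 j)
  le : ∀ j ≤ m + 1, s.mem 50 (s.mem 53 j) ≤ s.mem 51 (s.mem 53 j)
  le_pow : ∀ j ≤ m + 1, s.mem 51 (s.mem 53 j) ≤ 2 ^ ((4 * B + 1) * n)

/-- The breakpoint with index `j`, in increasing order. -/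
noncomputable def gridPoint (s : State) (j : ℕ) : ℝ :=
  (s.mem 50 (s.mem 53 j) : ℝ) / s.mem 51 (s.mem 53 j)

/-- The arrays that determine the output. -/
abbrev gridArrays : List ℕ := [2, 5, 35, 38, 50, 51, 53, 40, 41, 42, 43, 44, 45, 46, 47, 48]

theorem GridData.congr {n B m : ℕ} {s s' : State} (h : GridData n B m s)
    (hs : ∀ a ∈ gridArrays, s'.mem a = s.mem a) :
    GridData n B m s' ∧ gridPoint s' = gridPoint s ∧ recsOf s' = recsOf s := by
  have hr : recsOf s' = recsOf s := by
    funext j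
    simp only [recsOf]
    rw [hs 40 (by simp), hs 41 (by simp), hs 42 (by simp), hs 43 (by simp), hs 44 (by simp),
      hs 45 (by simp), hs 46 (by simp), hs 47 (by simp), hs 48 (by simp)]
  have h2 := hs 2 (by simp)
  have h35 := hs 35 (by simp)
  have h38 := hs 38 (by simp)
  have h50 := hs 50 (by simp)
  have h51 := hs 51 (by simp)
  have h53 := hs 53 (by simp)
  refine ⟨⟨by rw [h2, h.n_eq], h.n_le, by rw [h35, h.cnt], h.m_lt, by rw [h38, h.len],
    by rw [hr]; exact h.good, by rw [h51, h53]; exact h.pos, by rw [h50, h51, h53]; exact h.le,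
    by rw [h51, h53]; exact h.le_pow⟩, ?_, hr⟩
  funext j
  simp only [gridPoint]
  rw [h50, h51, h53]

/-- Every agent starts with the common seed and her own index as position; the merges are then
undone from the latest to the earliest. -/
theorem WP.orderAt {b H n B m j : ℕ} {Q : State → Prop} {s : State} (h : GridData n B m s)
    (hj : j ≤ m) (hs : s.mem 39 0 = j) (hH : n ≤ H) (hb : (4 * B + 1) * (2 * n + 2) < b)
    (hnb : n < 2 ^ b)
    (hQ : ∀ s', Frame [20, 22, 54, 55, 56] s s' → (∀ i < n, s'.mem 56 i =
      evalPos (recsOf s) m (fun _ => gridPoint s j) (fun i => i) i) → Q s') :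
    WP b H orderAt Q s := by
  unfold LogRam.orderAt
  refine .of_memBdd fun hmb => .seq (.fill (fun _ => s.mem 50 (s.mem 53 j)) (by simp) hH hnb
    (fun s' hf => by rw [Expr.eval_get, Expr.eval_const, hf.mem (by simp), h.n_eq])
    (fun i hi s' hf hi' => by
      simp only [Expr.eval_get, Expr.eval_const]
      rw [hf.mem (a := 39) (by simp), hf.mem (a := 50) (by simp), hf.mem (a := 53) (by simp), hs])
    (fun _ _ => hmb _ _) fun s1 hf1 h1 => ?_)
  refine .seq (.fill (fun _ => s.mem 51 (s.mem 53 j)) (by simp) hH hnb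
    (fun s' hf => by
      rw [Expr.eval_get, Expr.eval_const, hf.mem (by simp), hf1.mem (by simp), h.n_eq])
    (fun i hi s' hf hi' => by
      simp only [Expr.eval_get, Expr.eval_const]
      rw [hf.mem (a := 39) (by simp), hf.mem (a := 51) (by simp), hf.mem (a := 53) (by simp),
        hf1.mem (a := 39) (by simp), hf1.mem (a := 51) (by simp), hf1.mem (a := 53) (by simp), hs])
    (fun _ _ => hmb _ _) fun s2 hf2 h2 => ?_)
  refine .seq (.fill (fun i => i) (by simp) hH hnb
    (fun s' hf => by
      rw [Expr.eval_get, Expr.eval_const, hf.mem (by simp), hf2.mem (by simp), hf1.mem (by simp),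
        h.n_eq])
    (fun i hi s' hf hi' => by rw [Expr.eval_get, Expr.eval_const, hi'])
    (fun i hi => by omega) fun s3 hf3 h3 => ?_)
  have hf : Frame [20, 22, 54, 55, 56] s s3 :=
    ((hf1.mono (by simp)).trans (hf2.mono (by simp))).trans (hf3.mono (by simp))
  have hmn := h.m_lt
  have hB1 : B ≤ 4 * B + 1 := by omega
  have hcb : ∀ t ≤ m, (4 * B + 1) * (n + 1 + t) < b := fun t ht => by nlinarith
  have hpow : 2 ^ ((4 * B + 1) * n) ≤ 2 ^ ((4 * B + 1) * (n + 1)) :=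
    Nat.pow_le_pow_right two_pos (Nat.mul_le_mul_left _ (by omega))
  have hpow' : 2 ^ B ≤ 2 ^ ((4 * B + 1) * (n + 1)) :=
    Nat.pow_le_pow_right two_pos (by nlinarith)
  -- The exponent `(4 * B + 1) * (n + 1)` covers the breakpoints and the positions. Each of the
  -- fewer than `n` splits adds `4 * B + 1`, which stays below `(4 * B + 1) * (2 * n + 2)`.
  have h0 : SeedData n ((4 * B + 1) * (n + 1 + 0)) (fun _ => gridPoint s j) (fun i => i)
      (s3.set 20 0 0) := by
    have e4 : ∀ i < n, s3.mem 54 i = s.mem 50 (s.mem 53 j) := fun i hi => by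
      rw [hf3.mem (by simp), hf2.mem (by simp), h1 i hi]
    have e5 : ∀ i < n, s3.mem 55 i = s.mem 51 (s.mem 53 j) := fun i hi => by
      rw [hf3.mem (by simp), h2 i hi]
    refine ⟨?_, ?_, ?_, ?_, ?_, ?_⟩
    all_goals
      intro i hi
      try simp only [State.set_mem_of_ne, ne_eq, not_false_eq_true, Nat.reduceEqDiff, h3 i hi, e4 i hi,
        e5 i hi]
    · exact h.pos j (by omega)
    · exact h.le j (by omega)
    · exact (h.le_pow j (by omega)).trans hpow
    · rfl
    · have := h.n_le
      rw [add_zero]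
      omega
  refine .forRange m (by omega) (by omega) (fun t s' => Frame [20, 22, 54, 55, 56] s s' ∧
    s'.mem 20 0 = t ∧ ∃ S O, SeedData n ((4 * B + 1) * (n + 1 + t)) S O s' ∧
      evalPos (recsOf s) m (fun _ => gridPoint s j) (fun i => i) =
        evalPos (recsOf s) (m - t) S O) ?_ ?_ ?_ ?_
  · exact ⟨hf.set (by simp) _ _, by simp [State.set_mem_self], _, _, h0, rfl⟩
  · rintro t - s' ⟨hf', ht, -⟩
    refine ⟨ht, ?_⟩
    rw [Expr.eval_get, Expr.eval_const, hf'.mem (by simp), h.cnt]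
  · rintro t ht s' ⟨hf', ht', S, O, hS, he⟩
    have e35 : s'.mem 35 0 = m := by rw [hf'.mem (by simp), h.cnt]
    have hidx : m - t = (m - t - 1) + 1 := by omega
    have hrec : recsOf s' = recsOf s := recsOf_congr hf' (by decide)
    have hSs : SeedData n ((4 * B + 1) * (n + 1 + t)) S O (s'.set 22 0 (m - t - 1)) := by
      refine ⟨?_, ?_, ?_, ?_, ?_, ?_⟩ <;>
        try simp only [State.set_mem_of_ne, ne_eq, not_false_eq_true, Nat.reduceEqDiff]
      exacts [hS.pos, hS.le, hS.le_pow, hS.eq, hS.pos_eq, hS.pos_le]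
    refine .seq (.store ?_ ?_)
    · simp only [Expr.eval_sub, Expr.eval_get, Expr.eval_const, e35, ht']
      omega
    · simp only [Expr.eval_sub, Expr.eval_get, Expr.eval_const, e35, ht']
      refine .splitStep (r := recsOf s (m - t - 1)) ?_ (h.good _ (by omega)) h.n_le ?_ ?_ hSs
        fun s1 hf1 hS1 => ?_
      · rw [recsOf_congr ((Frame.refl [22] s').set (by simp) 0 _) (by decide), hrec]
        simp [State.set_mem_self]
      · nlinarith
      · have := hcb (t + 1) (by omega)
        linarith
      · refine ⟨?_, ?_, by simp [State.set_mem_self],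
          (recsOf s (m - t - 1)).splitSeed S, (recsOf s (m - t - 1)).splitPos S O, ?_, ?_⟩
        · rw [hf1.mem (by simp), State.set_mem_of_ne _ (by simp), ht']
        · exact ((hf'.set (by simp) _ _).trans (hf1.mono (by simp))).set (by simp) _ _
        · rw [show (4 * B + 1) * (n + 1 + t) + (4 * B + 1) = (4 * B + 1) * (n + 1 + (t + 1)) by
            ring] at hS1
          refine ⟨?_, ?_, ?_, ?_, ?_, ?_⟩ <;>
            try simp only [State.set_mem_of_ne, ne_eq, not_false_eq_true, Nat.reduceEqDiff]
          exacts [hS1.pos, hS1.le, hS1.le_pow, hS1.eq, hS1.pos_eq, hS1.pos_le]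
        -- `evalPos` peels off the record with the largest index, which is the record `m - t - 1` in
        -- round `t`.
        · rw [he, hidx, evalPos, show m - (t + 1) = m - t - 1 by omega]
          simp only [Nat.add_sub_cancel]
  · rintro s' ⟨hf', -, S, O, hS, he⟩
    rw [Nat.sub_self] at he
    refine hQ s' hf' fun i hi => ?_
    rw [he, evalPos, hS.pos_eq i hi]

/-- The arrays that `writeCell` modifies. -/
abbrev cellArrays : List ℕ := [20, 22, 54, 55, 56, 57]

/-- The computed array maps sorted indices to positions, while the output lists agents by position;
so the array is inverted in `57` before it is written. Injectivity ensures that no entry is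
overwritten. -/
theorem WP.writeCell {b H n B m j : ℕ} {Q : State → Prop} {s : State} (h : GridData n B m s)
    (hj : j ≤ m) (hs : s.mem 39 0 = j) (hH : n ≤ H) (hb : (4 * B + 1) * (2 * n + 2) < b)
    (hnb : n < 2 ^ b) {O : ℕ → ℕ}
    (hO : O = evalPos (recsOf s) m (fun _ => gridPoint s j) fun i => i)
    (hinj : ∀ i < n, ∀ i' < n, O i = O i' → i = i') (W : WeightedRanking n)
    (hnum : W.num = s.mem 50 (s.mem 53 (j + 1)) * s.mem 51 (s.mem 53 j) -
      s.mem 50 (s.mem 53 j) * s.mem 51 (s.mem 53 (j + 1)))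
    (hden : W.den = s.mem 51 (s.mem 53 j) * s.mem 51 (s.mem 53 (j + 1)))
    (hW : ∀ k : Fin n, ∃ i < n, O i = k ∧ (W.ranking k : ℕ) = s.mem 5 i)
    (hQ : ∀ s', (∀ a, a ∉ cellArrays → s'.mem a = s.mem a) → s'.out = s.out ++ W.encode → Q s') :
    WP b H writeCell Q s := by
  unfold LogRam.writeCell
  refine .of_memBdd fun hmb => .seq (.write (.seq (.write ?_)))
  simp only [Expr.eval_sub, Expr.eval_mul, Expr.eval_add, Expr.eval_get, Expr.eval_const,
    State.emit, hs, ← hnum, ← hden]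
  refine .seq (.orderAt (s := ⟨s.mem, _⟩) (h.congr (s' := ⟨s.mem, s.out ++ [W.num] ++ [W.den]⟩)
    fun _ _ => rfl).1 hj hs hH hb hnb
    fun s1 hf1 h1 => ?_)
  have h1' : ∀ i < n, s1.mem 56 i = O i := fun i hi => by rw [hO]; exact h1 i hi
  have hout1 : s1.out = s.out ++ [W.num] ++ [W.den] := hf1.2
  have hf1' : ∀ a, a ∉ [20, 22, 54, 55, 56] → s1.mem a = s.mem a := fun a ha => hf1.mem ha
  refine .seq (.forRange n hH hnb (fun t s' => Frame [20, 57] s1 s' ∧ s'.mem 20 0 = t ∧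
    ∀ i < t, s'.mem 57 (O i) = s.mem 5 i) ?_ ?_ ?_ ?_)
  · exact ⟨(Frame.refl _ _).set (by simp) _ _, by simp [State.set_mem_self],
      fun i hi => absurd hi (Nat.not_lt_zero i)⟩
  · rintro t - s' ⟨hf', ht, -⟩
    refine ⟨ht, ?_⟩
    rw [Expr.eval_get, Expr.eval_const, hf'.mem (by simp), hf1' _ (by simp), h.n_eq]
  · rintro t ht s' ⟨hf', ht', hS⟩
    have e5 : s'.mem 5 = s.mem 5 := by rw [hf'.mem (by simp), hf1' _ (by simp)]
    have e56 : s'.mem 56 t = O t := by rw [hf'.mem (by simp), h1' t ht]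
    refine .store ?_ ?_
    · simp only [Expr.eval_get, Expr.eval_const, ht', e5]
      exact hmb _ _
    · simp only [Expr.eval_get, Expr.eval_const, ht', e5, e56]
      refine ⟨by rw [State.set_mem_of_ne _ (by simp), ht'],
        (hf'.set (by simp) _ _).set (by simp) _ _, by simp [State.set_mem_self], fun i hi => ?_⟩
      rw [State.set_mem_of_ne _ (by simp), State.set_mem_self]
      rcases Nat.lt_succ_iff_lt_or_eq.mp hi with hi' | rfl
      · rw [Function.update_of_ne, hS i hi']
        intro he
        have := hinj i (by omega) t ht he
        omega
      · rw [Function.update_self]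
  · rintro s2 ⟨hf2, -, hS⟩
    refine .forRange n hH hnb (fun t s' => (∀ a, a ∉ [20] → s'.mem a = s2.mem a) ∧
      s'.mem 20 0 = t ∧ s'.out = s2.out ++ (List.range t).map (s2.mem 57)) ?_ ?_ ?_ ?_
    · refine ⟨fun a ha => State.set_mem_of_ne _ (by simpa using ha) _ _,
        by simp [State.set_mem_self], by simp [State.set_out]⟩
    · rintro t - s' ⟨hf', ht, -⟩
      refine ⟨ht, ?_⟩
      rw [Expr.eval_get, Expr.eval_const, hf' _ (by simp), hf2.mem (by simp), hf1' _ (by simp),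
        h.n_eq]
    · rintro t ht s' ⟨hf', ht', hS'⟩
      refine .write ⟨ht', fun a ha => ?_, by simp [State.set_mem_self], ?_⟩
      · rw [State.set_mem_of_ne _ (by simpa using ha)]
        exact hf' a ha
      · simp only [State.set_out, State.emit, Expr.eval_get, Expr.eval_const, ht', hS',
          hf' 57 (by simp), List.range_succ, List.map_append, List.append_assoc, List.map_cons,
          List.map_nil]
    · rintro s' ⟨hf', -, hS'⟩
      refine hQ s' (fun a ha => ?_) ?_
      · simp only [List.mem_cons, not_or] at ha
        rw [hf' a (by simp [ha]), hf2.mem (by simp [ha]), hf1' a (by simp [ha])]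
      · rw [hS', hf2.2, hout1, WeightedRanking.encode]
        simp only [List.append_assoc, List.cons_append, List.nil_append]
        congr 3
        refine List.ext_getElem (by simp) fun k hk hk' => ?_
        simp only [List.length_map, List.length_range] at hk
        obtain ⟨i, hi, he, hr⟩ := hW ⟨k, hk⟩
        simp only [List.getElem_map, List.getElem_range, List.getElem_ofFn]
        rw [hr, ← hS i hi, he]

theorem WP.writeCells {b H n B m : ℕ} {Q : State → Prop} {s : State} (h : GridData n B m s)
    (hH : n ≤ H) (hb : (4 * B + 1) * (2 * n + 2) < b) (hnb : n < 2 ^ b) {O : ℕ → ℕ → ℕ}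
    (hO : ∀ j ≤ m, O j = evalPos (recsOf s) m (fun _ => gridPoint s j) fun i => i)
    (hinj : ∀ j ≤ m, ∀ i < n, ∀ i' < n, O j i = O j i' → i = i') (W : ℕ → WeightedRanking n)
    (hnum : ∀ j ≤ m, (W j).num = s.mem 50 (s.mem 53 (j + 1)) * s.mem 51 (s.mem 53 j) -
      s.mem 50 (s.mem 53 j) * s.mem 51 (s.mem 53 (j + 1)))
    (hden : ∀ j ≤ m, (W j).den = s.mem 51 (s.mem 53 j) * s.mem 51 (s.mem 53 (j + 1)))
    (hW : ∀ j ≤ m, ∀ k : Fin n, ∃ i < n, O j i = k ∧ ((W j).ranking k : ℕ) = s.mem 5 i)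
    (hQ : ∀ s', s'.out = s.out ++
      ((List.range (m + 1)).map W).flatMap WeightedRanking.encode → Q s') :
    WP b H writeCells Q s := by
  have hmn := h.m_lt
  refine .forRange (m + 1) (by omega) (by omega) (fun t s' =>
    (∀ a, a ∉ 39 :: cellArrays → s'.mem a = s.mem a) ∧ s'.mem 39 0 = t ∧
      s'.out = s.out ++ ((List.range t).map W).flatMap WeightedRanking.encode) ?_ ?_ ?_ ?_
  · refine ⟨fun a ha => ?_, by simp [State.set_mem_self], by simp [State.set_out]⟩
    simp only [List.mem_cons, not_or] at ha
    exact State.set_mem_of_ne _ ha.1 _ _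
  · rintro t - s' ⟨hf', ht, -⟩
    refine ⟨ht, ?_⟩
    rw [Expr.eval_get, Expr.eval_const, hf' _ (by simp), h.len]
  · rintro t ht s' ⟨hf', ht', hS'⟩
    have ht1 : t ≤ m := by omega
    obtain ⟨hg, hp, hr⟩ := h.congr fun a ha => hf' a (by
      simp only [List.mem_cons, List.not_mem_nil, or_false] at ha
      rcases ha with rfl | rfl | rfl | rfl | rfl | rfl | rfl | rfl | rfl | rfl | rfl | rfl | rfl |
        rfl | rfl | rfl <;> simp)
    have e5 := hf' 5 (by simp)
    have e50 := hf' 50 (by simp)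
    have e51 := hf' 51 (by simp)
    have e53 := hf' 53 (by simp)
    refine .writeCell (O := O t) hg ht1 ht' hH hb hnb ?_ (hinj t ht1) (W t) ?_ ?_ ?_
      fun s1 hf1 ho => ⟨?_, fun a ha => ?_, by simp [State.set_mem_self], ?_⟩
    · rw [hr, hp]; exact hO t ht1
    · rw [e50, e51, e53]; exact hnum t ht1
    · rw [e51, e53]; exact hden t ht1
    · rw [e5]; exact hW t ht1
    · rw [hf1 _ (by simp), ht']
    · have ha' := ha
      simp only [List.mem_cons, not_or] at ha
      rw [State.set_mem_of_ne _ ha.1, hf1 a (by simp [ha]), hf' a ha']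
    · rw [State.set_out, ho, hS', List.range_succ, List.map_append, List.flatMap_append]
      simp
  · rintro s' ⟨-, -, hS'⟩
    exact hQ s' hS'

end LogRam

/-! ### From the grid of seeds to a lottery. -/

namespace FairSelection

theorem sum_fin_lt {n i : ℕ} (hi : i ≤ n) (f : ℕ → ℝ) :
    ∑ j with ((j : Fin n) : ℕ) < i, f j = ∑ j ∈ Finset.range i, f j := by
  refine Finset.sum_bij (fun j _ => (j : ℕ)) (fun j hj => ?_) (fun j _ j' _ h => Fin.ext h)
    (fun j hj => ?_) fun _ _ => rfl
  · simpa using hj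
  · rw [Finset.mem_range] at hj
    exact ⟨⟨j, by omega⟩, by simpa using hj, rfl⟩

theorem prod_fin_lt {n i : ℕ} (hi : i ≤ n) (f : ℕ → ℝ) :
    ∏ j with ((j : Fin n) : ℕ) < i, f j = ∏ j ∈ Finset.range i, f j := by
  refine Finset.prod_bij (fun j _ => (j : ℕ)) (fun j hj => ?_) (fun j _ j' _ h => Fin.ext h)
    (fun j hj => ?_) fun _ _ => rfl
  · simpa using hj
  · rw [Finset.mem_range] at hj
    exact ⟨⟨j, by omega⟩, by simpa using hj, rfl⟩

/-- `a` translates sorted indices into agents and `o` sorted indices into positions, so the ranking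
sends a position through `o.symm` and then `a`. -/
theorem rankUtil_eq_blockUtil {n : ℕ} {μ : Fin n → ℝ} {z : ℕ → ℝ} {a o π : Equiv.Perm (Fin n)}
    (hz : ∀ i : Fin n, z i = μ (a i)) {O : ℕ → ℕ} (hO : ∀ i : Fin n, O i = o i) (hπ : π = o.symm.trans a)
    (i : Fin n) : rankUtil μ π (a i) = blockUtil z 0 n O i := by
  have hs : ∀ j, π.symm (a j) = o j := fun j => by simp [hπ]
  rw [rankUtil, blockUtil, zero_add, hz, Finset.prod_filter, ← Equiv.prod_comp a,
    ← Fin.prod_univ_eq_prod_range (fun j => if O j < O i then 1 - z (0 + j) else 1)]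
  congr 1
  refine Finset.prod_congr rfl fun j _ => ?_
  rw [hs, hs, hO, hO, zero_add, hz]
  simp only [Fin.lt_def]

theorem majorizes_of_pava {n B : ℕ} {z : ℕ → ℝ} {pn pd : ℕ → ℕ} {v : PavaView}
    (hd : SortedData z n B pn pd) (h : PavaInv z n B pn pd v) (hk : v.k = n)
    (hM : 2 ≤ v.sp → (v.recAt (v.sp - 2)).M = 0) {μ : Fin n → ℝ} (a : Equiv.Perm (Fin n))
    (hz : ∀ i : Fin n, z i = μ (a i)) {K : ℕ} {b : ℕ → ℝ} (hb0 : b 0 = 0)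
    (hbK : b K = 1) (hb : ∀ j < K, b j ≤ b (j + 1))
    (hgrid : ∀ i < v.cnt, ∀ j < K, b j < (v.xn i : ℝ) / v.xd i → b (j + 1) ≤ (v.xn i : ℝ) / v.xd i)
    (o : ℕ → Equiv.Perm (Fin n)) (ho : ∀ j < K, ∀ i : Fin n, v.order (b j) i = o j i) :
    Majorizes μ fun i =>
      ∑ j ∈ Finset.range K, (b (j + 1) - b j) * rankUtil μ ((o j).symm.trans a) i := by
  obtain ⟨X, hX⟩ : ∃ X : ℕ → ℝ, ∀ i, X i = ∑ j ∈ Finset.range K,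
    (b (j + 1) - b j) * blockUtil z 0 n (v.order (b j)) i := ⟨_, fun _ => rfl⟩
  obtain ⟨h1, h2⟩ := h.tight hd hk hM hb0 hbK hb hgrid fun i _ => hX i
  refine majorizes_of_tight μ _ a X (fun i => (Finset.sum_congr rfl fun j hj => ?_).trans (hX i).symm) h1
    fun i hi => ?_
  · rw [rankUtil_eq_blockUtil hz (ho j (Finset.mem_range.mp hj)) rfl]
  · refine (h2 i hi).imp id fun h3 => ?_
    rw [sum_fin_lt (by omega), h3, noneProb, ← prod_fin_lt (n := n) (by omega)]
    simp only [zero_add, hz]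

/-- A list may repeat a ranking, so expectations under the described distribution are regrouped into
sums over the entries of the list. -/
theorem sum_weight_filter {n : ℕ} (l : List (WeightedRanking n)) (f : Equiv.Perm (Fin n) → ℝ≥0∞) :
    ∑ π, ((l.filter fun r => r.ranking = π).map WeightedRanking.weight).sum * f π =
      (l.map fun r => r.weight * f r.ranking).sum := by
  induction l with
  | nil => simp
  | cons r l ih =>
    rw [List.map_cons, List.sum_cons, ← ih]
    have : ∀ π, (((r :: l).filter fun r => r.ranking = π).map WeightedRanking.weight).sum * f π =
        (if r.ranking = π then r.weight * f π else 0) +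
          ((l.filter fun r => r.ranking = π).map WeightedRanking.weight).sum * f π := fun π => by
      by_cases hr : r.ranking = π
      · simp [hr, add_mul]
      · simp [hr]
    simp only [this, Finset.sum_add_distrib, Finset.sum_ite_eq, Finset.mem_univ, if_true]

/-- The distribution that a list of rankings with weights describes. -/
noncomputable def listLottery {n : ℕ} (l : List (WeightedRanking n))
    (h : (l.map WeightedRanking.weight).sum = 1) : PMF (Equiv.Perm (Fin n)) :=
  PMF.ofFintype (fun π => ((l.filter fun r => r.ranking = π).map WeightedRanking.weight).sum) (by
    have := sum_weight_filter l fun _ => 1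
    simp only [mul_one] at this
    rw [this, ← h])

theorem sum_map_range {M : Type*} [AddCommMonoid M] (f : ℕ → M) (K : ℕ) :
    ((List.range K).map f).sum = ∑ j ∈ Finset.range K, f j := by
  induction K with
  | zero => simp
  | succ K ih => simp [List.range_succ, Finset.sum_range_succ, ih]

theorem sum_weight_range {n K : ℕ} {W : ℕ → WeightedRanking n} {b : ℕ → ℝ} (hb0 : b 0 = 0)
    (hbK : b K = 1) (hb : ∀ j < K, b j ≤ b (j + 1))
    (hW : ∀ j < K, (W j).weight = ENNReal.ofReal (b (j + 1) - b j)) :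
    (((List.range K).map W).map WeightedRanking.weight).sum = 1 := by
  rw [List.map_map, sum_map_range]
  simp only [Function.comp_apply]
  rw [Finset.sum_congr rfl fun j hj => hW j (Finset.mem_range.mp hj),
    ← ENNReal.ofReal_sum_of_nonneg fun j hj => sub_nonneg.mpr (hb j (Finset.mem_range.mp hj)),
    Finset.sum_range_sub, hbK, hb0, sub_zero, ENNReal.ofReal_one]

/-- The weights are the lengths of the cells, so the expected utilities are exactly the Riemann sums
in `EqualizesBlock`. Equal breakpoints merely give weight `0`. -/
theorem expUtil_listLottery {n K : ℕ} (μ : Fin n → unitInterval) {W : ℕ → WeightedRanking n}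
    {b : ℕ → ℝ} (hb : ∀ j < K, b j ≤ b (j + 1))
    (hW : ∀ j < K, (W j).weight = ENNReal.ofReal (b (j + 1) - b j))
    (h : (((List.range K).map W).map WeightedRanking.weight).sum = 1) (i : Fin n) :
    expUtil (fun i => (μ i : ℝ)) (fun π => (listLottery _ h π).toReal) i =
      ∑ j ∈ Finset.range K, (b (j + 1) - b j) * rankUtil (fun i => (μ i : ℝ)) (W j).ranking i := by
  have hnn := fun π => rankUtil_nonneg μ π i
  have h1 := congrArg ENNReal.toReal (sum_weight_filter ((List.range K).map W)
    fun π => ENNReal.ofReal (rankUtil (fun i => (μ i : ℝ)) π i))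
  rw [List.map_map, sum_map_range, ENNReal.toReal_sum, ENNReal.toReal_sum] at h1
  · have h2 : ∀ j ∈ Finset.range K, (((fun r : WeightedRanking n => r.weight * ENNReal.ofReal
        (rankUtil (fun i => (μ i : ℝ)) r.ranking i)) ∘ W) j).toReal =
        (b (j + 1) - b j) * rankUtil (fun i => (μ i : ℝ)) (W j).ranking i := fun j hj => by
      rw [Finset.mem_range] at hj
      rw [Function.comp_apply, hW j hj, ENNReal.toReal_mul, ENNReal.toReal_ofReal (hnn _),
        ENNReal.toReal_ofReal (sub_nonneg.mpr (hb j hj))]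
    rw [Finset.sum_congr rfl h2] at h1
    rw [← h1, expUtil]
    refine Finset.sum_congr rfl fun π _ => ?_
    rw [ENNReal.toReal_mul, ENNReal.toReal_ofReal (hnn _)]
    rfl
  · intro j hj
    rw [Finset.mem_range] at hj
    rw [Function.comp_apply, hW j hj]
    exact ENNReal.mul_ne_top ENNReal.ofReal_ne_top ENNReal.ofReal_ne_top
  · intro π _
    refine ENNReal.mul_ne_top ?_ ENNReal.ofReal_ne_top
    exact (listLottery _ h).apply_ne_top π

theorem monotone_of_sortsFractions {N D : ℕ → ℕ} {k : ℕ} {a : ℕ → ℕ} (h : SortsFractions N D k a)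
    (hD : ∀ i < k, 0 < D i) {r r' : ℕ} (hr : r ≤ r') (hr' : r' < k) :
    (N (a r) : ℝ) / D (a r) ≤ (N (a r') : ℝ) / D (a r') := by
  have h1 : (0 : ℝ) < D (a r) := by exact_mod_cast hD _ (h.lt r (by omega))
  have h2 : (0 : ℝ) < D (a r') := by exact_mod_cast hD _ (h.lt r' hr')
  rw [div_le_div_iff₀ h1 h2]
  exact_mod_cast h.mono r r' hr hr'

/-- Adding the fractions `0` and `1` to the sorted breakpoints yields a grid of `[0, 1]`. -/
theorem grid_of_sortsFractions {N D : ℕ → ℕ} {m : ℕ} {a : ℕ → ℕ}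
    (h : SortsFractions N D (m + 1) a) (hD : ∀ i < m + 1, 0 < D i) (hle : ∀ i < m + 1, N i ≤ D i)
    (h0 : N m = 0) {b : ℕ → ℝ} (hb : ∀ j < m + 1, b j = (N (a j) : ℝ) / D (a j))
    (hb1 : b (m + 1) = 1) :
    b 0 = 0 ∧ (∀ j < m + 1, b j ≤ b (j + 1)) ∧ ∀ i < m, ∀ j < m + 1,
      b j < (N i : ℝ) / D i → b (j + 1) ≤ (N i : ℝ) / D i := by
  refine ⟨?_, fun j hj => ?_, fun i hi j hj hlt => ?_⟩
  · obtain ⟨r, hr, hrm⟩ := h.surj m (by omega)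
    have h1 := h.mono 0 r (by omega) hr
    rw [hrm, h0, zero_mul, Nat.le_zero] at h1
    have h2 : N (a 0) = 0 :=
      (Nat.mul_eq_zero.mp h1).resolve_right (hD m (by omega)).ne'
    rw [hb 0 (by omega), h2]
    simp
  · rcases Nat.lt_or_ge (j + 1) (m + 1) with h1 | h1
    · rw [hb j hj, hb _ h1]
      exact monotone_of_sortsFractions h hD (by omega) h1
    · obtain rfl : j = m := by omega
      rw [hb j hj, hb1]
      exact div_le_one_of_le₀ (by exact_mod_cast hle _ (h.lt j hj)) (by positivity)
  · obtain ⟨r, hr, hri⟩ := h.surj i (by omega)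
    rw [← hri] at hlt ⊢
    have hjr : j < r := by
      by_contra hcon
      rw [hb j hj] at hlt
      exact absurd hlt (not_lt.mpr (monotone_of_sortsFractions h hD (not_lt.mp hcon) hj))
    rw [hb _ (by omega)]
    exact monotone_of_sortsFractions h hD hjr hr

theorem exists_perm {n : ℕ} {O : ℕ → ℕ} (hlt : ∀ i < n, O i < n)
    (hinj : ∀ i < n, ∀ j < n, O i = O j → i = j) :
    ∃ o : Equiv.Perm (Fin n), ∀ i : Fin n, O i = o i := by
  have : Function.Bijective fun i : Fin n => (⟨O i, hlt i i.2⟩ : Fin n) :=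
    Finite.injective_iff_bijective.mp fun i j hij =>
      Fin.ext (hinj i i.2 j j.2 (Fin.mk.inj_iff.mp hij))
  exact ⟨Equiv.ofBijective _ this, fun i => rfl⟩

end FairSelection

/-! ### Input, breakpoints and the whole program. -/

namespace LogRam

open FairSelection

/-- Reads the success probabilities, and sorts them. -/
def setup : Prog :=
  .assign 2 (.div (.var 1) (.const 2)) ;;
  .forRange 20 (.var 2) (.store 3 (.var 20) (.get 0 (.var 20 + .var 20))) ;;
  .forRange 20 (.var 2) (.store 4 (.var 20) (.get 0 (.var 20 + .var 20 + .const 1))) ;;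
  rankSort 3 4 2 5 ;;
  .forRange 20 (.var 2) (.store 6 (.var 20) (.get 4 (.get 5 (.var 20)) - .get 3 (.get 5 (.var 20)))) ;;
  .forRange 20 (.var 2) (.store 7 (.var 20) (.get 4 (.get 5 (.var 20))))

/-- Adds the breakpoints `0` and `1`, and sorts the breakpoints. -/
def sortBreakpoints : Prog :=
  .store 50 (.var 35) (.const 0) ;; .store 51 (.var 35) (.const 1) ;;
  .assign 38 (.var 35 + .const 1) ;;
  rankSort 50 51 38 53 ;;
  .store 50 (.var 38) (.const 1) ;; .store 51 (.var 38) (.const 1) ;;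
  .store 53 (.var 38) (.var 38)

/-- Computes a randomization over ranking schemes. -/
def lotteryProg : Prog := setup ;; pava ;; sortBreakpoints ;; writeCells

/-- Array `5` sorts the agents by success probability, while `6` and `7` hold the probabilities of
value `0` as fractions. The product of the denominators is invariant under the permutation, so the
bound of the input carries over. -/
theorem WP.setup {b H n B : ℕ} {Q : State → Prop} {s : State} (hlen : s.mem 1 0 = n + n)
    (hD : ∀ i < n, 0 < s.mem 0 (i + i + 1))
    (hN : ∀ i < n, s.mem 0 (i + i) ≤ s.mem 0 (i + i + 1))
    (hprod : ∏ i ∈ Finset.range n, s.mem 0 (i + i + 1) ≤ 2 ^ B) (hB : n ≤ 2 ^ B)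
    (hH : n ≤ H) (hnb : n < 2 ^ b)
    (hQ : ∀ s', s'.out = s.out → s'.mem 2 0 = n →
      (∃ a : Equiv.Perm (Fin n), (∀ i : Fin n, s'.mem 5 i = (a i : ℕ)) ∧
        ∃ z : ℕ → ℝ, SortedData z n B (s'.mem 6) (s'.mem 7) ∧ ∀ i : Fin n,
          z i = (s.mem 0 (a i + a i) : ℝ) / s.mem 0 (a i + a i + 1)) → Q s') :
    WP b H setup Q s := by
  unfold LogRam.setup
  refine .of_memBdd fun hmb => .seq (.store ?_ ?_)
  · simp only [Expr.eval, hlen]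
    omega
  simp only [Expr.eval, hlen, ← two_mul, Nat.mul_div_cancel_left n two_pos]
  obtain ⟨s0, hs0⟩ : ∃ s0, s.set 2 0 n = s0 := ⟨_, rfl⟩
  have f0 : Frame [2] s s0 := hs0 ▸ (Frame.refl _ _).set (by simp) _ _
  have n0 : s0.mem 2 0 = n := by simp [← hs0, State.set_mem_self]
  rw [hs0]
  refine .seq (.fill (fun i => s.mem 0 (i + i)) (by simp) hH hnb
    (fun s' hf => by rw [Expr.eval_get, Expr.eval_const, hf.mem (by simp), n0])
    (fun i hi s' hf hi' => by
      simp only [Expr.eval_get, Expr.eval_const, Expr.eval_add, hi']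
      rw [hf.mem (by simp), f0.mem (by simp)])
    (fun _ _ => hmb _ _) fun s1 f1 h1 => ?_)
  have n1 : s1.mem 2 0 = n := by rw [f1.mem (by simp), n0]
  refine .seq (.fill (fun i => s.mem 0 (i + i + 1)) (by simp) hH hnb
    (fun s' hf => by rw [Expr.eval_get, Expr.eval_const, hf.mem (by simp), n1])
    (fun i hi s' hf hi' => by
      simp only [Expr.eval_get, Expr.eval_const, Expr.eval_add, hi']
      rw [hf.mem (by simp), f1.mem (by simp), f0.mem (by simp)])
    (fun _ _ => hmb _ _) fun s2 f2 h2 => ?_)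
  have n2 : s2.mem 2 0 = n := by rw [f2.mem (by simp), n1]
  have h1' : ∀ i < n, s2.mem 3 i = s.mem 0 (i + i) := fun i hi => by
    rw [f2.mem (by simp), h1 i hi]
  refine .of_memBdd fun hmb2 => .seq (.rankSort (by simp) (by simp) (by simp) (by simp) n2 hH hnb
    (fun i hi => by rw [h2 i hi]; exact hD i hi) fun s3 f3 h3 => ?_)
  have n3 : s3.mem 2 0 = n := by rw [f3.mem (by simp), n2]
  have h33 : s3.mem 3 = s2.mem 3 := f3.mem (by simp)
  have h34 : s3.mem 4 = s2.mem 4 := f3.mem (by simp)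
  refine .seq (.fill (fun i => s2.mem 4 (s3.mem 5 i) - s2.mem 3 (s3.mem 5 i)) (by simp) hH hnb
    (fun s' hf => by rw [Expr.eval_get, Expr.eval_const, hf.mem (by simp), n3])
    (fun i hi s' hf hi' => by
      simp only [Expr.eval_get, Expr.eval_const, Expr.eval_sub, hi']
      rw [hf.mem (a := 5) (by simp), hf.mem (a := 4) (by simp), hf.mem (a := 3) (by simp), h33,
        h34])
    (fun _ _ => (Nat.sub_le _ _).trans_lt (hmb2 _ _)) fun s4 f4 h4 => ?_)
  have n4 : s4.mem 2 0 = n := by rw [f4.mem (by simp), n3]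
  refine .fill (fun i => s2.mem 4 (s3.mem 5 i)) (by simp) hH hnb
    (fun s' hf => by rw [Expr.eval_get, Expr.eval_const, hf.mem (by simp), n4])
    (fun i hi s' hf hi' => by
      simp only [Expr.eval_get, Expr.eval_const, hi']
      rw [hf.mem (a := 5) (by simp), hf.mem (a := 4) (by simp), f4.mem (a := 5) (by simp),
        f4.mem (a := 4) (by simp), h34])
    (fun _ _ => hmb2 _ _) fun s5 f5 h5 => ?_
  obtain ⟨a, ha⟩ := exists_perm h3.lt h3.inj
  have hlt := h3.lt
  refine hQ s5 (by rw [f5.2, f4.2, f3.2, f2.2, f1.2, f0.2]) (by rw [f5.mem (by simp), n4])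
    ⟨a, fun i => by rw [f5.mem (by simp), f4.mem (by simp), ha],
      fun i => (s.mem 0 (s3.mem 5 i + s3.mem 5 i) : ℝ) / s.mem 0 (s3.mem 5 i + s3.mem 5 i + 1),
      ⟨?_, ?_, ?_, ?_, ?_, hB⟩, fun i => by simp only [ha]⟩
  · intro j hj
    rw [h5 j hj, h2 _ (hlt j hj)]
    exact hD _ (hlt j hj)
  · intro j hj
    rw [h5 j hj, f5.mem (by simp), h4 j hj]
    exact Nat.sub_le _ _
  · intro j hj
    have hj' := hlt j hj
    have := hD _ hj'
    rw [h5 j hj, f5.mem (by simp), h4 j hj, h2 _ hj', h1' _ hj', Nat.cast_sub (hN _ hj'),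
      sub_div, div_self (by positivity)]
  · intro i j hij hj
    have hi' := hlt i (by omega)
    have hj' := hlt j hj
    have := monotone_of_sortsFractions h3 (fun i hi => by rw [h2 i hi]; exact hD i hi) hij hj
    rwa [h1' _ hi', h1' _ hj', h2 _ hi', h2 _ hj'] at this
  · rw [Finset.prod_congr rfl fun j hj => h5 j (Finset.mem_range.mp hj),
      ← Fin.prod_univ_eq_prod_range (fun j => s2.mem 4 (s3.mem 5 j))]
    simp only [ha]
    rw [Equiv.prod_comp a fun i : Fin n => s2.mem 4 i,
      Fin.prod_univ_eq_prod_range (fun j => s2.mem 4 j),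
      Finset.prod_congr rfl fun j hj => h2 j (Finset.mem_range.mp hj)]
    exact hprod

/-- The breakpoint `0` takes part in the sort. The breakpoint `1` is appended afterwards, which is
legitimate because all others are less than `1`. -/
theorem WP.sortBreakpoints {b H n B : ℕ} {z : ℕ → ℝ} {pn pd : ℕ → ℕ} {Q : State → Prop} {s : State}
    (h : PavaInv z n B pn pd (viewOf s)) (hn0 : 0 < n) (hk : (viewOf s).k = n)
    (hn : s.mem 2 0 = n) (hB : n ≤ 2 ^ B) (hH : n ≤ H) (hnb : n < 2 ^ b)
    (hQ : ∀ s', s'.out = s.out → s'.mem 5 = s.mem 5 → GridData n B (viewOf s).cnt s' →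
      recsOf s' = recsOf s → gridPoint s' 0 = 0 → gridPoint s' ((viewOf s).cnt + 1) = 1 →
      (∀ j < (viewOf s).cnt + 1, gridPoint s' j ≤ gridPoint s' (j + 1)) →
      (∀ i < (viewOf s).cnt, ∀ j < (viewOf s).cnt + 1,
        gridPoint s' j < ((viewOf s).xn i : ℝ) / (viewOf s).xd i →
          gridPoint s' (j + 1) ≤ ((viewOf s).xn i : ℝ) / (viewOf s).xd i) → Q s') :
    WP b H sortBreakpoints Q s := by
  have hsp : 0 < (viewOf s).sp := by
    by_contra hcon
    have h1 := h.st_sp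
    rw [Nat.eq_zero_of_not_pos hcon, h.st_zero] at h1
    omega
  have hcnt := h.cnt
  obtain ⟨m, hm⟩ : ∃ m, (viewOf s).cnt = m := ⟨_, rfl⟩
  have hxlt := h.xlt
  have hxle := h.xle
  have hgood := h.good
  rw [hm] at hQ hcnt hxlt hxle hgood
  have hm' : s.mem 35 0 = m := hm
  -- There are agents, so the stack is nonempty and fewer than `n` merges took place.
  have hmn : m < n := by omega
  have h1b : 1 < 2 ^ b := by omega
  unfold LogRam.sortBreakpoints
  refine .seq (.store (by simp [Expr.eval_const]) (.seq (.store (by simpa [Expr.eval_const] using h1b)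
    (.seq (.store ?_ ?_)))))
  all_goals simp only [Expr.eval_get, Expr.eval_const, Expr.eval_add, State.set_mem_of_ne, ne_eq,
    not_false_eq_true, Nat.reduceEqDiff, hm']
  · omega
  obtain ⟨s1, hs1⟩ : ∃ s1, ((s.set 50 m 0).set 51 m 1).set 38 0 (m + 1) = s1 := ⟨_, rfl⟩
  have f1 : Frame [50, 51, 38] s s1 := by
    rw [← hs1]
    exact (((Frame.refl _ _).set (by simp) _ _).set (by simp) _ _).set (by simp) _ _
  have a50 : s1.mem 50 = Function.update (s.mem 50) m 0 := by
    simp [← hs1, State.set_mem_self, State.set_mem_of_ne]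
  have a51 : s1.mem 51 = Function.update (s.mem 51) m 1 := by
    simp [← hs1, State.set_mem_self, State.set_mem_of_ne]
  have a38 : s1.mem 38 0 = m + 1 := by simp [← hs1, State.set_mem_self]
  rw [hs1]
  have hxn : ∀ i < m, s1.mem 50 i = (viewOf s).xn i := fun i hi => by
    rw [a50, Function.update_of_ne hi.ne]; rfl
  have hxd : ∀ i < m, s1.mem 51 i = (viewOf s).xd i := fun i hi => by
    rw [a51, Function.update_of_ne hi.ne]; rfl
  have hn_m : s1.mem 50 m = 0 := by rw [a50, Function.update_self]
  have hd_m : s1.mem 51 m = 1 := by rw [a51, Function.update_self]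
  have hcase : ∀ i < m + 1, i < m ∨ i = m := fun i hi => by omega
  have hpos : ∀ i < m + 1, 0 < s1.mem 51 i := fun i hi => by
    rcases hcase i hi with hi | rfl
    · rw [hxd i hi]; have := hxlt i hi; omega
    · rw [hd_m]; exact one_pos
  have hle : ∀ i < m + 1, s1.mem 50 i ≤ s1.mem 51 i := fun i hi => by
    rcases hcase i hi with hi | rfl
    · rw [hxn i hi, hxd i hi]; exact (hxlt i hi).le
    · rw [hn_m]; exact Nat.zero_le _
  have hpow : ∀ i < m + 1, s1.mem 51 i ≤ 2 ^ ((4 * B + 1) * n) := fun i hi => by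
    rcases hcase i hi with hi | rfl
    · rw [hxd i hi]
      exact (hxle i hi).trans (Nat.pow_le_pow_right two_pos (Nat.mul_le_mul_left _ hmn.le))
    · rw [hd_m]; exact Nat.one_le_two_pow
  refine .seq (.rankSort (by simp) (by simp) (by simp) (by simp) a38 (by omega) (by omega) hpos
    fun s2 f2 h2 => ?_)
  have b38 : s2.mem 38 0 = m + 1 := by rw [f2.mem (by simp), a38]
  refine .seq (.store (by simpa [Expr.eval_const] using h1b) (.seq (.store
    (by simpa [Expr.eval_const] using h1b) (.store ?_ ?_))))
  all_goals simp only [Expr.eval_get, Expr.eval_const, State.set_mem_of_ne, ne_eq,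
    not_false_eq_true, Nat.reduceEqDiff, b38]
  · omega
  obtain ⟨s3, hs3⟩ : ∃ s3, ((s2.set 50 (m + 1) 1).set 51 (m + 1) 1).set 53 (m + 1) (m + 1) = s3 :=
    ⟨_, rfl⟩
  have f3 : Frame [50, 51, 53] s2 s3 := by
    rw [← hs3]
    exact (((Frame.refl _ _).set (by simp) _ _).set (by simp) _ _).set (by simp) _ _
  have f : Frame [20, 21, 22, 38, 50, 51, 53] s s3 :=
    ((f1.mono (by simp)).trans (f2.mono (by simp))).trans (f3.mono (by simp))
  have c50 : s3.mem 50 = Function.update (s1.mem 50) (m + 1) 1 := by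
    rw [← f2.mem (a := 50) (by simp)]
    simp [← hs3, State.set_mem_self, State.set_mem_of_ne]
  have c51 : s3.mem 51 = Function.update (s1.mem 51) (m + 1) 1 := by
    rw [← f2.mem (a := 51) (by simp)]
    simp [← hs3, State.set_mem_self, State.set_mem_of_ne]
  have c53 : s3.mem 53 = Function.update (s2.mem 53) (m + 1) (m + 1) := by
    simp [← hs3, State.set_mem_self, State.set_mem_of_ne]
  have d50 : ∀ j < m + 1, s3.mem 50 (s3.mem 53 j) = s1.mem 50 (s2.mem 53 j) := fun j hj => by
    rw [c50, c53, Function.update_of_ne hj.ne, Function.update_of_ne (h2.lt j hj).ne]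
  have d51 : ∀ j < m + 1, s3.mem 51 (s3.mem 53 j) = s1.mem 51 (s2.mem 53 j) := fun j hj => by
    rw [c51, c53, Function.update_of_ne hj.ne, Function.update_of_ne (h2.lt j hj).ne]
  have e50 : s3.mem 50 (s3.mem 53 (m + 1)) = 1 := by
    rw [c50, c53, Function.update_self, Function.update_self]
  have e51 : s3.mem 51 (s3.mem 53 (m + 1)) = 1 := by
    rw [c51, c53, Function.update_self, Function.update_self]
  have hcase' : ∀ j ≤ m + 1, j < m + 1 ∨ j = m + 1 := fun j hj => by omega
  have hrec : recsOf s3 = recsOf s := recsOf_congr f (by decide)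
  have hg1 : gridPoint s3 (m + 1) = 1 := by simp [gridPoint, e50, e51]
  obtain ⟨g0, gmono, ggrid⟩ := grid_of_sortsFractions h2 hpos hle hn_m
    (b := gridPoint s3) (fun j hj => by rw [gridPoint, d50 j hj, d51 j hj]) hg1
  rw [hs3]
  refine hQ s3 f.2 (f.mem (by simp)) ⟨?_, hB, ?_, hmn, ?_, ?_, ?_, ?_, ?_⟩ hrec g0 hg1 gmono ?_
  · rw [f.mem (by simp), hn]
  · rw [f.mem (by simp), hm']
  · rw [f3.mem (by simp), b38]
  · rw [hrec]; exact hgood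
  · intro j hj
    rcases hcase' j hj with hj | rfl
    · rw [d51 j hj]; exact hpos _ (h2.lt j hj)
    · rw [e51]; exact one_pos
  · intro j hj
    rcases hcase' j hj with hj | rfl
    · rw [d50 j hj, d51 j hj]; exact hle _ (h2.lt j hj)
    · rw [e50, e51]
  · intro j hj
    rcases hcase' j hj with hj | rfl
    · rw [d51 j hj]; exact hpow _ (h2.lt j hj)
    · rw [e51]; exact Nat.one_le_two_pow
  · intro i hi
    rw [← hxn i hi, ← hxd i hi]
    exact ggrid i hi

end LogRam

/-! ### Correctness and running time of the whole program. -/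

namespace LogRam

open FairSelection

theorem WP.lotteryProg {b H n B : ℕ} {μ : Fin n → unitInterval} {s : State} (hn : 0 < n)
    (hlen : s.mem 1 0 = n + n) (hD : ∀ i < n, 0 < s.mem 0 (i + i + 1))
    (hN : ∀ i < n, s.mem 0 (i + i) ≤ s.mem 0 (i + i + 1))
    (hμ : ∀ i : Fin n, (μ i : ℝ) = (s.mem 0 (i + i) : ℝ) / s.mem 0 (i + i + 1))
    (hprod : ∏ i ∈ Finset.range n, s.mem 0 (i + i + 1) ≤ 2 ^ B) (hB : n ≤ 2 ^ B)
    (hH : 2 * n ≤ H) (hb : (4 * B + 1) * (2 * n + 2) < b) (hnb : 2 * n < 2 ^ b)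
    (hout : s.out = []) :
    WP b H lotteryProg (fun s' => ∃ η : PMF (Equiv.Perm (Fin n)), Describes s'.out η ∧
      Majorizes (fun i => (μ i : ℝ)) (expUtil (fun i => (μ i : ℝ)) fun π => (η π).toReal)) s := by
  unfold LogRam.lotteryProg
  refine .seq (.setup hlen hD hN hprod hB (by omega) (by omega) ?_)
  rintro s1 o1 n1 ⟨a, ha, z, hd, hz⟩
  refine .seq (.pava hd n1 hH (by nlinarith) hnb fun s2 f2 hI hk hM => ?_)
  have n2 : s2.mem 2 0 = n := by rw [f2.mem (by simp), n1]
  refine .seq (.sortBreakpoints hI hn hk n2 hB (by omega) (by omega)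
    fun s3 o3 h5 hg hr g0 g1 gmono ggrid => ?_)
  have hrv : recsOf s3 = (viewOf s2).recs := hr
  clear hr
  generalize viewOf s2 = v at *
  obtain ⟨m, hm⟩ : ∃ m, v.cnt = m := ⟨_, rfl⟩
  have h5a : ∀ i : Fin n, s3.mem 5 i = a i := fun i => by rw [h5, f2.mem (by simp), ha]
  choose o ho using fun j => exists_perm (n := n) (O := v.order (gridPoint s3 j))
    (fun i hi => by have := hI.order_lt (gridPoint s3 j) (i := i) (by omega); omega)
    (fun i hi i' hi' => hI.order_inj (gridPoint s3 j) (by omega) (by omega))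
  have hmaj := majorizes_of_pava hd hI hk hM (μ := fun i => (μ i : ℝ)) a
    (fun i => by rw [hz, hμ]) g0 g1 gmono ggrid o fun j _ => ho j
  rw [hm] at hg gmono g1 hmaj
  -- Only the cells `j ≤ m` matter; for other `j` an arbitrary weight serves as default, so that `W`
  -- is total.
  have hex : ∀ j, ∃ W : WeightedRanking n, W.ranking = (o j).symm.trans a ∧ (j ≤ m →
      W.num = s3.mem 50 (s3.mem 53 (j + 1)) * s3.mem 51 (s3.mem 53 j) -
        s3.mem 50 (s3.mem 53 j) * s3.mem 51 (s3.mem 53 (j + 1)) ∧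
      W.den = s3.mem 51 (s3.mem 53 j) * s3.mem 51 (s3.mem 53 (j + 1))) := fun j => by
    by_cases hj : j ≤ m
    · exact ⟨⟨_, _, Nat.mul_pos (hg.pos j (by omega)) (hg.pos (j + 1) (by omega)), _⟩, rfl,
        fun _ => ⟨rfl, rfl⟩⟩
    · exact ⟨⟨0, 1, one_pos, _⟩, rfl, fun h => absurd h hj⟩
  choose W hW hW' using hex
  have hweight : ∀ j < m + 1, (W j).weight =
      ENNReal.ofReal (gridPoint s3 (j + 1) - gridPoint s3 j) := fun j hj => by
    have p1 : (0 : ℝ) < s3.mem 51 (s3.mem 53 j) := by exact_mod_cast hg.pos j (by omega)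
    have p2 : (0 : ℝ) < s3.mem 51 (s3.mem 53 (j + 1)) := by
      exact_mod_cast hg.pos (j + 1) (by omega)
    have hle := gmono j hj
    unfold gridPoint at hle ⊢
    -- Monotonicity of the grid makes the truncated subtraction in the weight exact.
    rw [div_le_div_iff₀ p1 p2] at hle
    have hle' : s3.mem 50 (s3.mem 53 j) * s3.mem 51 (s3.mem 53 (j + 1)) ≤
        s3.mem 50 (s3.mem 53 (j + 1)) * s3.mem 51 (s3.mem 53 j) := by exact_mod_cast hle
    rw [WeightedRanking.weight, (hW' j (by omega)).1, (hW' j (by omega)).2,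
      div_sub_div _ _ p2.ne' p1.ne', ENNReal.ofReal_div_of_pos (mul_pos p2 p1),
      ← ENNReal.ofReal_natCast, ← ENNReal.ofReal_natCast, Nat.cast_sub hle']
    push_cast
    congr 2
    · ring
    · ring
  have hsum := sum_weight_range g0 g1 gmono hweight
  refine .writeCells hg (by omega) hb (by omega) (O := fun j => v.order (gridPoint s3 j)) ?_ ?_ W
    (fun j hj => (hW' j hj).1) (fun j hj => (hW' j hj).2) ?_ ?_
  · intro j hj
    rw [hrv, PavaView.order, hm]
  · exact fun j _ i hi i' hi' => hI.order_inj _ (by omega) (by omega)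
  · intro j hj k
    refine ⟨(o j).symm k, Fin.is_lt _, ?_, ?_⟩
    · rw [ho, Equiv.apply_symm_apply]
    · rw [h5a, hW]; rfl
  · intro s' hs'
    rw [o3, f2.2, o1, hout, List.nil_append] at hs'
    refine ⟨listLottery _ hsum, ⟨_, hs', fun π => rfl⟩, ?_⟩
    rw [show expUtil (fun i => (μ i : ℝ)) (fun π => (listLottery _ hsum π).toReal) = _ from
      funext (expUtil_listLottery μ gmono hweight hsum)]
    simp only [hW]
    exact hmaj

section Encoding

/-- The list of numerators and denominators. -/
abbrev pairs (l : List ℚ) : List ℕ := l.flatMap fun q => [q.num.natAbs, q.den]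

theorem length_pairs (l : List ℚ) : (pairs l).length = l.length + l.length := by
  induction l with
  | nil => rfl
  | cons q l ih => simp [pairs] at ih ⊢; omega

theorem getD_pairs (l : List ℚ) {i : ℕ} (hi : i < l.length) :
    (pairs l).getD (i + i) 0 = l[i].num.natAbs ∧ (pairs l).getD (i + i + 1) 0 = l[i].den := by
  induction l generalizing i with
  | nil => simp at hi
  | cons q l ih =>
    cases i with
    | zero => simp [pairs]
    | succ i =>
      have := ih (i := i) (by simpa using hi)
      rw [show i + 1 + (i + 1) = i + i + 1 + 1 by omega]
      simpa [pairs] using this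

theorem le_inputSize {l : List ℕ} {x : ℕ} (h : x ∈ l) : 1 + Nat.size x ≤ inputSize l :=
  List.le_sum_of_mem (List.mem_map_of_mem h)

theorem length_le_inputSize (l : List ℕ) : l.length ≤ inputSize l := by
  induction l with
  | nil => rfl
  | cons x l ih => simp [inputSize] at ih ⊢; omega

/-- Bit lengths add up under multiplication, so the input size can serve as the bound `B` on all
block probabilities. -/
theorem prod_den_le (l : List ℚ) : (l.map Rat.den).prod ≤ 2 ^ inputSize (pairs l) := by
  induction l with
  | nil => exact Nat.one_le_two_pow
  | cons q l ih =>
    have h1 : inputSize (pairs (q :: l)) =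
        Nat.size q.den + (2 + Nat.size q.num.natAbs) + inputSize (pairs l) := by
      simp [inputSize, pairs]
      omega
    rw [List.map_cons, List.prod_cons, h1, pow_add]
    refine Nat.mul_le_mul ((Nat.lt_size_self _).le.trans ?_) ih
    exact Nat.pow_le_pow_right two_pos (by omega)

end Encoding

theorem memBdd_initial {l : List ℕ} {b : ℕ} (h : inputSize l ≤ b) : MemBdd b (initial l) := by
  intro a i
  have hb : inputSize l < 2 ^ b := h.trans_lt Nat.lt_two_pow_self
  simp only [initial]
  split_ifs
  · by_cases hi : i < l.length
    · rw [List.getD_eq_getElem _ _ hi]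
      have := le_inputSize (List.getElem_mem hi)
      exact Nat.size_le.mp (by omega)
    · rw [List.getD_eq_default _ _ (not_lt.mp hi)]
      omega
  · have := length_le_inputSize l
    omega
  · omega

/-- With input size `I`, take `B = I`, `b = (4 * I + 1) * (2 * I + 2) + 1` and `H = 2 * I`. The
budget is then a polynomial in `I`, since the weight and the loop depth of the program are
constants. -/
theorem exists_poly_lotteryProg : ∃ p : Polynomial ℕ, ∀ x : RationalInstance,
    ∃ (s : State) (t : ℕ) (η : PMF (Equiv.Perm (Fin x.n))),
      Runs lotteryProg (initial x.encode) s t ∧ t ≤ p.eval (inputSize x.encode) ∧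
      Describes s.out η ∧ Majorizes (fun i => (x.toReal i : ℝ))
        (expUtil (fun i => (x.toReal i : ℝ)) fun π => (η π).toReal) := by
  refine ⟨Polynomial.C lotteryProg.weight *
    ((4 * Polynomial.X + 1) * (2 * Polynomial.X + 2) + 1 + 1) *
      (2 * Polynomial.X + 1) ^ lotteryProg.depth, fun x => ?_⟩
  have hlen : x.encode.length = x.n + x.n := by
    have := length_pairs (List.ofFn x.prob)
    rwa [List.length_ofFn] at this
  have hget : ∀ i : Fin x.n, (initial x.encode).mem 0 (i + i) = (x.prob i).num.natAbs ∧
      (initial x.encode).mem 0 (i + i + 1) = (x.prob i).den := fun i => by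
    have := getD_pairs (List.ofFn x.prob) (i := i) (by simp)
    rw [List.getElem_ofFn] at this
    exact this
  have hle : ∀ i, (x.prob i).num.natAbs ≤ (x.prob i).den := fun i => by
    have h1 := Rat.num_nonneg.mpr (x.nonneg i)
    have h2 := x.le_one i
    rw [Rat.le_iff] at h2
    simp at h2
    omega
  have hprod : ∏ i ∈ Finset.range x.n, (initial x.encode).mem 0 (i + i + 1) ≤
      2 ^ inputSize x.encode := by
    rw [← Fin.prod_univ_eq_prod_range fun i => (initial x.encode).mem 0 (i + i + 1)]
    simp only [fun i => (hget i).2]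
    have := prod_den_le (List.ofFn x.prob)
    rwa [List.map_ofFn, List.prod_ofFn] at this
  obtain ⟨I, hI⟩ : ∃ I, inputSize x.encode = I := ⟨_, rfl⟩
  have hnI : x.n + x.n ≤ I := by
    rw [← hlen, ← hI]
    exact length_le_inputSize _
  have hn := Nat.pos_of_neZero x.n
  have hIb : I < (4 * I + 1) * (2 * I + 2) + 1 := by nlinarith
  rw [hI] at hprod ⊢
  obtain ⟨s, t, hr, ht, -, η, h1, h2⟩ := WP.lotteryProg (μ := x.toReal) (B := I)
    (b := (4 * I + 1) * (2 * I + 2) + 1) (H := 2 * I) hn (s := initial x.encode)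
    (by simp [initial, hlen]) (fun i hi => by rw [(hget ⟨i, hi⟩).2]; exact Rat.den_pos _)
    (fun i hi => by rw [(hget ⟨i, hi⟩).2, (hget ⟨i, hi⟩).1]; exact hle _)
    (fun i => by
      rw [(hget i).1, (hget i).2]
      have h0 := Rat.num_nonneg.mpr (x.nonneg i)
      have h3 : ((x.prob i).num.natAbs : ℝ) = ((x.prob i).num : ℝ) := by
        rw [← Int.cast_natCast, Int.natAbs_of_nonneg h0]
      rw [h3]
      exact Rat.cast_def _)
    hprod ((by omega : x.n ≤ I).trans Nat.lt_two_pow_self.le) (by omega)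
    (Nat.lt_succ_of_le (Nat.mul_le_mul_left _ (by omega)))
    ((by omega : 2 * x.n ≤ I).trans_lt (hIb.trans Nat.lt_two_pow_self)) rfl
    (memBdd_initial (by omega))
  refine ⟨s, t, η, hr, ht.trans_eq ?_, h1, h2⟩
  simp [Prog.budget]

end LogRam

-- A single lottery per `μ` has to serve both claims. For rational `μ` it is the one that the
-- program prints, which is well defined since the rational vector is determined by `μ`; for any
-- other `μ` the computational claim is vacuous and a limit lottery is used.
open FairSelection LogRam in
theorem exists_majorizing_lottery (p : Polynomial ℕ) (hp : ∀ x : RationalInstance,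
    ∃ (s : State) (t : ℕ) (η : PMF (Equiv.Perm (Fin x.n))),
      Runs lotteryProg (initial x.encode) s t ∧ t ≤ p.eval (inputSize x.encode) ∧
      Describes s.out η ∧ Majorizes (fun i => (x.toReal i : ℝ))
        (expUtil (fun i => (x.toReal i : ℝ)) fun π => (η π).toReal))
    (n : ℕ) [NeZero n] (μ : Fin n → unitInterval) : ∃ η : PMF (Equiv.Perm (Fin n)),
      Majorizes (fun i => (μ i : ℝ)) (expUtil (fun i => (μ i : ℝ)) fun π => (η π).toReal) ∧
      ∀ (q : Fin n → ℚ) (h0 : ∀ i, 0 ≤ q i) (h1 : ∀ i, q i ≤ 1), (∀ i, (q i : ℝ) = μ i) →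
        ∃ (s : State) (t : ℕ), Runs lotteryProg (initial (RationalInstance.mk n q h0 h1).encode) s t ∧
          t ≤ p.eval (inputSize (RationalInstance.mk n q h0 h1).encode) ∧ Describes s.out η := by
  by_cases h : ∃ q : Fin n → ℚ, ∀ i, (q i : ℝ) = μ i
  · obtain ⟨q, hq⟩ := h
    have h0 : ∀ i, 0 ≤ q i := fun i => by
      have := (μ i).2.1
      rw [← hq] at this
      exact_mod_cast this
    have h1 : ∀ i, q i ≤ 1 := fun i => by
      have := (μ i).2.2
      rw [← hq] at this
      exact_mod_cast this
    obtain ⟨s, t, η, hr, ht, hd, hm⟩ := hp ⟨n, q, h0, h1⟩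
    refine ⟨η, ?_, fun q' h0' h1' hq' => ?_⟩
    · have : RationalInstance.toReal ⟨n, q, h0, h1⟩ = μ := funext fun i => Subtype.ext (hq i)
      rwa [this] at hm
    · obtain rfl : q' = q := funext fun i => by
        have := (hq' i).trans (hq i).symm
        exact_mod_cast this
      exact ⟨s, t, hr, ht, hd⟩
  · obtain ⟨η, hη⟩ := exists_majorizing_of_rat (fun q hq => by
      obtain ⟨_, _, η, _, _, _, hm⟩ := hp ⟨n, q, fun i => (hq i).1, fun i => (hq i).2⟩
      exact ⟨η, hm⟩) μ
    exact ⟨η, hη, fun q _ _ hq => absurd ⟨q, hq⟩ h⟩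

theorem theorem1 :
    ∃ η : ∀ n : ℕ, [NeZero n] → (Fin n → unitInterval) → PMF (Equiv.Perm (Fin n)),
      (∀ (n : ℕ) [NeZero n] (μ : Fin n → unitInterval),
        FairSelection.IsMajorized 1
          (FairSelection.fullRevelationRanking (fun i => FairSelection.bernoulliLaw (μ i))
            (η n μ)).toPolicy) ∧
      LogRam.PolyTimeSolvable FairSelection.RationalInstance.encode
        (fun x out => FairSelection.Describes out (η x.n x.toReal)) := by
  obtain ⟨p, hp⟩ := LogRam.exists_poly_lotteryProg
  choose η hη hrun using exists_majorizing_lottery p hp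
  refine ⟨η, fun n _ μ => FairSelection.isMajorized_of_majorizes μ _ (hη n μ),
    LogRam.lotteryProg, p, fun x => ?_⟩
  exact hrun x.n x.toReal x.prob x.nonneg x.le_one fun i => rfl
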